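/- Let $k$ be a field, regarded as a trivially-valued field. A log scheme over $k$ means a $k$-scheme $X$ with a Zariski sheaf of multiplicative monoids $\mathcal{O}_X^\times\subseteq\mathcal{M}_{X^+}\subseteq\mathcal{O}_X$ that is fine and saturated (fs); $k$ carries the trivial log structure. Put $\mathcal{C}_{X^+}=\mathcal{M}_{X^+}/\mathcal{O}_X^\times$ and let $\mathcal{I}_{X^+,x}\subseteq\mathcal{O}_{X,x}$ be the ideal generated by $\mathcal{M}_{X^+,x}\setminus\mathcal{O}_{X,x}^\times$. $X^+$ is log-regular if, for all $x \in X$, $\mathcal{O}_{X,x}/\mathcal{I}_{X^+,x}$ is a regular local ring and $\dim\mathcal{O}_{X,x}=\dim(\mathcal{O}_{X,x}/\mathcal{I}_{X^+,x})+\operatorname{rank}\mathcal{C}_{X^+,x}^{\mathrm{gp}}$. A log-regular pair is a log-regular $X^+$ whose underlying scheme is a normal variety (integral, separated, of finite type) over $k$. Its Kato fan $F_{X^+}$ is the set of $x\in X$ with $\mathcal{I}_{X^+,x}=\mathfrak{m}_x$ (the generic points of the strata of the boundary divisor, including the generic point of $X$); the strata are the closures of these points. Let $X^{\beth}$ be the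 space of those points $(\xi,|\cdot|)$ of the Berkovich analytification $X^{\mathrm{an}}$ that admit a centre on $X$. For $x\in F_{X^+}$ and a monoid morphism $\alpha\colon\mathcal{C}_{X^+,x}\to\mathbf{R}_+=[0,\infty)$, let $v_\alpha$ be the minimal semivaluation $\mathcal{O}_{X,x}\to[0,\infty]$ that is trivial on $k$ and satisfies $v_\alpha(f)=\alpha(\overline f)$ for $f\in\mathcal{M}_{X^+,x}$. The skeleton $\mathrm{Sk}(X^+)\subseteq X^{\beth}$ is the set of all $v_\alpha$ ($x\in F_{X^+}$, $\alpha\in\mathrm{Hom}(\mathcal{C}_{X^+,x},\mathbf{R}_+)$) with the subspace topology. Its vertex is the trivial valuation $v_0$ on the function field, and its link is the topological quotient $(\mathrm{Sk}(X^+)\setminus\{v_0\})/\mathbf{R}_{>0}$ by rescaling $v\mapsto a v$. The join $A\ast B$ of two spaces is the quotient of $(A\times B\times[0,1])\sqcup A\sqcup B$ by $(a,b,0)\sim a$ and $(a,b,1)\sim b$ (so $\emptyset\ast B=B$ and $A\ast\emptyset=A$). Let $X^+$ and $Y^+$ be log-regular pairs over $k$ all of whose strata are geometrically irreducible over $k$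 (automatic if $k$ is algebraically closed), and let $Z^+$ be their product in the category of fs log schemes over $k$, with projections $\mathrm{pr}_X$ and $\mathrm{pr}_Y$. If $k$ is not perfect, assume moreover that $Z^+$ is log-regular. Then: 1. the map $(\mathrm{pr}_X^{\beth},\mathrm{pr}_Y^{\beth})$ restricts to a homeomorphism $\mathrm{Sk}(Z^+)\simeq\mathrm{Sk}(X^+)\times\mathrm{Sk}(Y^+)$; 2. the link of $\mathrm{Sk}(Z^+)$ is homeomorphic to the join of the link of $\mathrm{Sk}(X^+)$ and the link of $\mathrm{Sk}(Y^+)$. -/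

import Mathlib

open CategoryTheory CategoryTheory.Limits AlgebraicGeometry TopologicalSpace
open scoped NNReal

universe u

noncomputable section

namespace LogSkeleton

/-! ## Fine and saturated log schemes (Zariski topology, log structures `M ⊆ 𝒪`) -/

/-- A fine and saturated monoid: finitely generated, cancellative, and every `g = a / b` in the
group of fractions with `g ^ n` in the monoid for some `n ≥ 1` lies in the monoid. -/
structure IsFsMonoid (P : Type u) [CommMonoid P] : Prop where
  fg : Monoid.FG P
  cancel : IsCancelMul P
  saturated : ∀ (a b : P) (n : ℕ), 0 < n → b ^ n ∣ a ^ n → b ∣ a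

/-- A log structure on `X` given by a sheaf of multiplicative submonoids
`𝒪_X^× ⊆ M ⊆ 𝒪_X`. -/
structure LogStructure (X : Scheme.{u}) where
  /-- The submonoid of sections over an open set. -/
  sections : ∀ U : X.Opens, Submonoid Γ(X, U)
  unit_mem : ∀ (U : X.Opens) (s : Γ(X, U)), IsUnit s → s ∈ sections U
  res_mem : ∀ (U V : X.Opens) (h : V ≤ U) (s : Γ(X, U)), s ∈ sections U →
    X.presheaf.map (homOfLE h).op s ∈ sections V
  mem_of_local : ∀ (U : X.Opens) (s : Γ(X, U)),
    (∀ x ∈ U, ∃ (V : X.Opens) (h : V ≤ U), x ∈ V ∧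
      X.presheaf.map (homOfLE h).op s ∈ sections V) → s ∈ sections U

namespace LogStructure

variable {X : Scheme.{u}} (M : LogStructure X)

/-- The stalk `M_x`, as a submonoid of the local ring `𝒪_{X,x}`. -/
def stalk (x : X) : Submonoid (X.presheaf.stalk x) where
  carrier := {f | ∃ (U : X.Opens) (hx : x ∈ U) (s : Γ(X, U)),
    s ∈ M.sections U ∧ X.presheaf.germ U x hx s = f}
  one_mem' := ⟨⊤, trivial, 1, one_mem _, map_one _⟩
  mul_mem' := by
    rintro _ _ ⟨U, hU, s, hs, rfl⟩ ⟨V, hV, t, ht, rfl⟩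
    refine ⟨U ⊓ V, ⟨hU, hV⟩, X.presheaf.map (homOfLE inf_le_left).op s *
      X.presheaf.map (homOfLE inf_le_right).op t,
      mul_mem (M.res_mem _ _ _ _ hs) (M.res_mem _ _ _ _ ht), ?_⟩
    rw [map_mul]
    congr 1
    · exact X.presheaf.germ_res_apply (homOfLE inf_le_left) x ⟨hU, hV⟩ s
    · exact X.presheaf.germ_res_apply (homOfLE inf_le_right) x ⟨hU, hV⟩ t

/-- The characteristic monoid `𝒞_x = M_x / 𝒪_{X,x}^×` (all units of `𝒪_{X,x}` lie in `M_x`). -/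
abbrev Char (x : X) : Type u := Associates (M.stalk x)

/-- The ideal of `𝒪_{X,x}` generated by `M_x ∖ 𝒪_{X,x}^×`. -/
def ideal (x : X) : Ideal (X.presheaf.stalk x) :=
  Ideal.span {f | f ∈ M.stalk x ∧ ¬ IsUnit f}

/-- `φ : P → Γ(U, M)` is a chart of `M` on `U`: at every point `y` of `U` the induced map from the
pushout `P ⊕_{φ⁻¹(𝒪^×)} 𝒪_{X,y}^×` to `M_y` is an isomorphism. -/
structure IsChart (U : X.Opens) {P : Type u} [CommMonoid P] (φ : P →* Γ(X, U)) : Prop where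
  mem : ∀ p, φ p ∈ M.sections U
  surj : ∀ (y : X) (hy : y ∈ U), ∀ f ∈ M.stalk y, ∃ (p : P) (a : X.presheaf.stalk y),
    IsUnit a ∧ f = X.presheaf.germ U y hy (φ p) * a
  inj : ∀ (y : X) (hy : y ∈ U) (p q : P) (a : X.presheaf.stalk y), IsUnit a →
    X.presheaf.germ U y hy (φ p) = X.presheaf.germ U y hy (φ q) * a →
    ∃ s t : P, IsUnit (X.presheaf.germ U y hy (φ s)) ∧ IsUnit (X.presheaf.germ U y hy (φ t)) ∧
      p * s = q * t ∧ X.presheaf.germ U y hy (φ t) = a * X.presheaf.germ U y hy (φ s)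

/-- The log structure is fine and saturated: locally it has a chart by an fs monoid. -/
def IsFs : Prop :=
  ∀ x : X, ∃ (U : X.Opens) (_ : x ∈ U) (P : Type u) (_ : CommMonoid P) (φ : P →* Γ(X, U)),
    IsFsMonoid P ∧ M.IsChart U φ

/-- Log-regularity at `x`: `𝒪_{X,x} / I_x` is a regular local ring and
`dim 𝒪_{X,x} = dim (𝒪_{X,x} / I_x) + rank 𝒞_x^gp`. -/
structure IsLogRegularAt (x : X) : Prop where
  regular : IsRegularLocalRing (X.presheaf.stalk x ⧸ M.ideal x)
  dim_eq : ringKrullDim (X.presheaf.stalk x) = ringKrullDim (X.presheaf.stalk x ⧸ M.ideal x) +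
    (Module.finrank ℤ (Additive (Algebra.GrothendieckGroup (M.Char x))) : ℕ)

/-- The points of the Kato fan: the points `x` at which the maximal ideal is generated by the
non-invertible elements of `M_x` (for a log-regular log scheme these are the generic points of the
strata of its boundary divisor, the generic point of `X` included). -/
def katoFan : Set X := {x | M.ideal x = IsLocalRing.maximalIdeal (X.presheaf.stalk x)}

end LogStructure

/-- A fine and saturated log scheme over the field `k` (carrying the trivial log structure). -/
structure FsLogScheme (k : Type u) [Field k] where
  /-- The underlying scheme. -/
  X : Scheme.{u}
  /-- The structure morphism. -/
  str : X ⟶ Spec (.of k)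
  /-- The log structure. -/
  M : LogStructure X
  fs : M.IsFs

namespace FsLogScheme

variable {k : Type u} [Field k]

/-- A morphism of log schemes over `k`: a `k`-morphism pulling `M_Y` back into `M_X`. -/
@[ext]
structure Hom (X Y : FsLogScheme k) where
  /-- The underlying morphism of schemes. -/
  f : X.X ⟶ Y.X
  comp_str : f ≫ Y.str = X.str
  map_mem : ∀ (U : Y.X.Opens) (s : Γ(Y.X, U)), s ∈ Y.M.sections U →
    f.app U s ∈ X.M.sections (f ⁻¹ᵁ U)

instance : Category (FsLogScheme k) where
  Hom := Hom
  id X := ⟨𝟙 X.X, Category.id_comp _, fun U s hs => by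
    rw [Scheme.Hom.id_app]
    exact hs⟩
  comp f g := ⟨f.f ≫ g.f, by rw [Category.assoc, g.comp_str, f.comp_str], fun U s hs => by
    rw [Scheme.Hom.comp_app]
    exact f.map_mem _ _ (g.map_mem U s hs)⟩
  id_comp _ := Hom.ext (Category.id_comp _)
  comp_id _ := Hom.ext (Category.comp_id _)
  assoc _ _ _ := Hom.ext (Category.assoc _ _ _)

/-- `Z`, with the projections `p` and `q`, is the product of `X` and `Y` in the category of fine
and saturated log schemes over `k`. -/
def IsProduct {X Y Z : FsLogScheme k} (p : Z ⟶ X) (q : Z ⟶ Y) : Prop :=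
  Nonempty (IsLimit (BinaryFan.mk p q))

variable (X : FsLogScheme k)

/-- The underlying scheme is a normal variety over `k`. -/
structure IsNormalVariety : Prop where
  integral : IsIntegral X.X
  separated : IsSeparated X.str
  locallyOfFiniteType : LocallyOfFiniteType X.str
  quasiCompact : QuasiCompact X.str
  normal : ∀ x : X.X, IsIntegrallyClosed (X.X.presheaf.stalk x)

/-- The log scheme is log-regular at all points. -/
def IsLogRegular : Prop := ∀ x : X.X, X.M.IsLogRegularAt x

/-- A log-regular pair: a log-regular log scheme on a normal variety. -/
structure IsLogRegularPair : Prop where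
  variety : X.IsNormalVariety
  logRegular : X.IsLogRegular

/-- The strata of `X` (the closures of the points of the Kato fan) are geometrically irreducible
over `k`; this is a condition on the residue fields of their generic points. -/
def HasGeometricallyIrreducibleStrata : Prop :=
  ∀ x ∈ X.M.katoFan, GeometricallyIrreducible (X.X.fromSpecResidueField x ≫ X.str)

/-! ## The Berkovich analytification over the trivially-valued field `k` -/

/-- The ring homomorphism `k → 𝒪_{X,x}`. -/
def toStalk (x : X.X) : k →+* X.X.presheaf.stalk x :=
  ((Scheme.ΓSpecIso (.of k)).inv ≫ X.str.appTop ≫ X.X.presheaf.germ ⊤ x (Opens.mem_top x)).hom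

lemma toStalk_comp_stalkMap {X Y : FsLogScheme k} (f : X ⟶ Y) (x : X.X) :
    (f.f.stalkMap x).hom.comp (Y.toStalk (f.f x)) = X.toStalk x := by
  have h : (Scheme.ΓSpecIso (.of k)).inv ≫ Y.str.appTop ≫
      Y.X.presheaf.germ ⊤ (f.f x) (Opens.mem_top _) ≫ f.f.stalkMap x =
      (Scheme.ΓSpecIso (.of k)).inv ≫ X.str.appTop ≫ X.X.presheaf.germ ⊤ x (Opens.mem_top x) := by
    rw [Scheme.Hom.germ_stalkMap, ← f.comp_str, Scheme.Hom.comp_appTop, Category.assoc]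
    rfl
  exact congrArg CommRingCat.Hom.hom h

/-- A point of `X^an`: a point `ξ` of `X` and a (non-archimedean, multiplicatively written)
absolute value on the residue field of `ξ` that is trivial on `k`. The corresponding additive
valuation is `- log |·|`. -/
structure An where
  /-- The point `ξ`. -/
  ker : X.X
  /-- The absolute value. -/
  val : Valuation (X.X.residueField ker) ℝ≥0
  trivial_on : ∀ c : k, c ≠ 0 → val ((X.X.residue ker).hom (X.toStalk ker c)) = 1

/-- The weakest topology such that `ker` is continuous and, for every open `U` and every regular
function `f` on `U`, the function `p ↦ |f(p)|` on `ker ⁻¹ U` is continuous. -/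
instance : TopologicalSpace X.An :=
  .generateFrom
    ({W | ∃ U : X.X.Opens, W = {p | p.ker ∈ U}} ∪
     {W | ∃ (U : X.X.Opens) (f : Γ(X.X, U)) (V : Set ℝ≥0), IsOpen V ∧
        W = {p | ∃ h : p.ker ∈ U, p.val (X.X.evaluation U p.ker h f) ∈ V}})

variable {X}

/-- For `ξ ⤳ x`, a point of `X^an` with kernel `ξ` induces a multiplicative seminorm
on `𝒪_{X,x}`. -/
def An.seminorm (p : X.An) {x : X.X} (h : p.ker ⤳ x) :
    Valuation (X.X.presheaf.stalk x) ℝ≥0 :=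
  p.val.comap (X.X.presheaf.stalkSpecializes h ≫ X.X.residue p.ker).hom

/-- `x` is the centre of `p`: the valuation ring of `p` dominates the image of `𝒪_{X,x}` in the
residue field of `ker p`. -/
def An.IsCentre (p : X.An) (x : X.X) : Prop :=
  ∃ h : p.ker ⤳ x, ∀ f : X.X.presheaf.stalk x,
    p.seminorm h f ≤ 1 ∧ (p.seminorm h f < 1 ↔ f ∈ IsLocalRing.maximalIdeal _)

variable (X) in
/-- `X^ℶ`: the points of `X^an` that admit a centre on `X`. -/
def beth : Set X.An := {p | ∃ x, p.IsCentre x}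

/-- The map `X^an → Y^an` induced by a morphism. -/
def An.map {X Y : FsLogScheme k} (f : X ⟶ Y) (p : X.An) : Y.An where
  ker := f.f p.ker
  val := p.val.comap (f.f.residueFieldMap p.ker).hom
  trivial_on c hc := by
    have h : (f.f.residueFieldMap p.ker).hom ((Y.X.residue _).hom (Y.toStalk _ c)) =
        (X.X.residue p.ker).hom (X.toStalk p.ker c) := by
      have h1 := congr($(Scheme.residue_residueFieldMap f.f p.ker).hom (Y.toStalk _ c))
      have h2 := congr($(toStalk_comp_stalkMap f p.ker) c)
      exact h1.trans (congrArg (X.X.residue p.ker).hom h2)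
    rw [Valuation.comap_apply, h, p.trivial_on c hc]

/-- The rescaling `a · p`, with `|f(a · p)| = |f(p)| ^ a`. -/
def An.scale (a : ℝ) (ha : 0 < a) (p : X.An) : X.An where
  ker := p.ker
  val := p.val.map
    { toFun := fun r => r ^ a
      map_zero' := NNReal.zero_rpow ha.ne'
      map_one' := NNReal.one_rpow a
      map_mul' := fun _ _ => NNReal.mul_rpow } (NNReal.monotone_rpow_of_nonneg ha.le)
  trivial_on c hc := by
    simp [p.trivial_on c hc]

lemma An.scale_one (p : X.An) : p.scale 1 one_pos = p := by
  obtain ⟨x, v, hv⟩ := p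
  have h : (An.scale 1 one_pos ⟨x, v, hv⟩ : X.An).val = v :=
    Valuation.ext fun f => NNReal.rpow_one (v f)
  unfold An.scale at h ⊢
  congr

lemma An.scale_scale (p : X.An) (a b : ℝ) (ha : 0 < a) (hb : 0 < b) :
    (p.scale a ha).scale b hb = p.scale (a * b) (mul_pos ha hb) := by
  have h : ((p.scale a ha).scale b hb).val = (p.scale (a * b) (mul_pos ha hb)).val :=
    Valuation.ext fun f => (NNReal.rpow_mul (p.val f) a b).symm
  unfold An.scale at h ⊢
  congr

/-! ## The skeleton -/

/-- The semivaluation `- log w` on `𝒪_{X,x}` takes values in `[0, ∞]`, extends the trivial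
valuation on `k`, and is equal to `α` on `M_x`. -/
structure Extends {x : X.X} (α : X.M.Char x →* Multiplicative ℝ≥0)
    (w : Valuation (X.X.presheaf.stalk x) ℝ≥0) : Prop where
  le_one : ∀ f, w f ≤ 1
  trivial_on : ∀ c : k, c ≠ 0 → w (X.toStalk x c) = 1
  apply_mem : ∀ m : X.M.stalk x,
    (w m : ℝ) = Real.exp (-((α (Associates.mk m)).toAdd : ℝ≥0))

/-- `- log w` is the minimal semivaluation `v_α` extending `α`. As `- log` reverses the order,
`w` is the largest one. -/
def IsMinimalExtension {x : X.X} (α : X.M.Char x →* Multiplicative ℝ≥0)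
    (w : Valuation (X.X.presheaf.stalk x) ℝ≥0) : Prop :=
  Extends α w ∧ ∀ w', Extends α w' → ∀ f, w' f ≤ w f

variable (X)

/-- The face `Sk_x(X) = {v_α : α ∈ Hom(𝒞_x, ℝ_+)}` of the skeleton. -/
def face (x : X.X) : Set X.An :=
  {p | p ∈ X.beth ∧ ∃ (h : p.ker ⤳ x) (α : X.M.Char x →* Multiplicative ℝ≥0),
    IsMinimalExtension α (p.seminorm h)}

/-- The skeleton, with the subspace topology. -/
def skeleton : Set X.An := ⋃ x ∈ X.M.katoFan, X.face x

variable {X}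

/-- `p` is the trivial valuation `v_0` on the function field. -/
def An.IsVertex (p : X.An) : Prop :=
  IsGenericPoint p.ker Set.univ ∧ ∀ f, f ≠ 0 → p.val f = 1

variable (X)

/-- The skeleton without its vertex. -/
def puncturedSkeleton : Set X.An := {p | p ∈ X.skeleton ∧ ¬ p.IsVertex}

/-- Two points are equivalent if they differ by the rescaling action of the positive reals. -/
def linkSetoid : Setoid X.puncturedSkeleton where
  r p q := ∃ (a : ℝ) (ha : 0 < a), (q : X.An) = (p : X.An).scale a ha
  iseqv :=
    { refl := fun p => ⟨1, one_pos, by rw [An.scale_one]⟩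
      symm := by
        rintro p q ⟨a, ha, h⟩
        refine ⟨a⁻¹, inv_pos.2 ha, ?_⟩
        rw [h, An.scale_scale]
        simp [mul_inv_cancel₀ ha.ne', An.scale_one]
      trans := by
        rintro p q r ⟨a, ha, h⟩ ⟨b, hb, h'⟩
        exact ⟨a * b, mul_pos ha hb, by rw [h', h, An.scale_scale]⟩ }

/-- The link of the skeleton, with the quotient topology. -/
def Link : Type u := Quotient X.linkSetoid

instance : TopologicalSpace X.Link := inferInstanceAs (TopologicalSpace (Quotient X.linkSetoid))

end FsLogScheme

/-! ## Joins -/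

/-- The identifications `(a, b, 0) ∼ a` and `(a, b, 1) ∼ b`. -/
inductive JoinRel (A B : Type*) : (A × B × unitInterval) ⊕ (A ⊕ B) →
    (A × B × unitInterval) ⊕ (A ⊕ B) → Prop
  | left (a : A) (b : B) : JoinRel A B (.inl (a, b, 0)) (.inr (.inl a))
  | right (a : A) (b : B) : JoinRel A B (.inl (a, b, 1)) (.inr (.inr b))

/-- The join of `A` and `B`: the quotient of `A × B × [0, 1]`, `A` and `B` by the identifications
`(a, b, 0) ∼ a` and `(a, b, 1) ∼ b`. For nonempty `A` and `B` the summands `A` and `B` may be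
omitted; with them the join with the empty space is the other factor. -/
def Join (A B : Type*) : Type _ := Quot (JoinRel A B)

instance (A B : Type*) [TopologicalSpace A] [TopologicalSpace B] : TopologicalSpace (Join A B) :=
  inferInstanceAs (TopologicalSpace (Quot (JoinRel A B)))

end LogSkeleton

end

/-! The skeleton is a union of faces, one for each point `x` of the Kato fan, and the face of `x` is
a copy of the space of weights on the characteristic monoid at `x`. The proof makes this description
precise enough to multiply.

Monomial valuations. At a point of the Kato fan the monomials generate the maximal ideal, and
log-regularity bounds the rank of the characteristic group by the dimension of the local ring `R`. A
relation expressing a monomial `p` through monomials that are larger in a monomial order would make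
all multiples of `p` superfluous, so that the length of `R / 𝔪 ^ n` would grow like `n ^ (rank - 1)`
only. This contradicts the lower bound `n ^ dim R` (`exists_pow_le_mul_length`,
`IsMonomialSystem.notMem_span`). Hence every nonzero `f` has an initial monomial for every monomial
order, initial monomials multiply, and if `α` is monotone for the order then `f ↦ exp (-α (in f))`
is a valuation, the largest one extending `exp (-α)`: this is `v_α`. Completions and power series
are not needed. It follows that `v_α` has trivial support, depends continuously on `α`, and
restricts to a monomial valuation along an injection of characteristic monoids
(`IsMaximalExtension.comap`).

Products. Everything is flat over `k`, so the fs product is the fibre product of schemes with the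
log structure generated by the two pullbacks, and characteristic monoids are products
(`isPullback_of_isProduct`, `charMap_bijective`). Over a pair `(x, y)` of Kato points there is
exactly one Kato point of the product, the generic point of the fibre over `(x, y)`. That fibre is
irreducible because a stratum is geometrically irreducible, and its local ring at the generic point
is a field: over a perfect field because the fibre is reduced, otherwise because a zero-dimensional
regular local ring is a field. Dimensions of local rings are superadditive, so independence of
monomials holds on the product as well. Each face of the product is therefore the product of two
faces. Separatedness makes centres unique, which yields injectivity across different faces and
closedness of faces; since there are finitely many, the inverse is continuous
(`IsToroidalProduct.homeomorph`).

Links. Rescaling turns a skeleton into a cone over the compact unit sphere of a homogeneous norm,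
and the link is that sphere. The unit sphere of a product of cones, for the sum of the norms, is the
join of the unit spheres (`Cone.joinHomeomorph`), and the homeomorphism of skeleta is equivariant.
-/

noncomputable section

namespace LogSkeleton

/-! ## Monomial orders on fine monoids -/

/-- In a torsion-free commutative group, a pointed submonoid is contained in the positive cone of
a linear order. -/
lemma exists_total_cone {G : Type*} [CommGroup G] (tf : ∀ (g : G) (n : ℕ), 0 < n → g ^ n = 1 → g = 1)
    (S : Submonoid G) (hS : ∀ g, g ∈ S → g⁻¹ ∈ S → g = 1) :
    ∃ T : Submonoid G, S ≤ T ∧ (∀ g, g ∈ T → g⁻¹ ∈ T → g = 1) ∧ ∀ g, g ∈ T ∨ g⁻¹ ∈ T := by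
  obtain ⟨T, hST, hT⟩ := zorn_le_nonempty₀ {T : Submonoid G | ∀ g, g ∈ T → g⁻¹ ∈ T → g = 1} (by
    intro c hc hcc y hy
    refine ⟨sSup c, ?_, fun z hz => le_sSup hz⟩
    intro g hg hg'
    rw [Submonoid.mem_sSup_of_directedOn ⟨y, hy⟩ hcc.directedOn] at hg hg'
    obtain ⟨A, hA, hgA⟩ := hg
    obtain ⟨B, hB, hgB⟩ := hg'
    rcases hcc.total hA hB with h | h
    · exact hc hB g (h hgA) hgB
    · exact hc hA g hgA (h hgB)) S hS
  have hTp : ∀ g, g ∈ T → g⁻¹ ∈ T → g = 1 := hT.prop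
  refine ⟨T, hST, hTp, ?_⟩
  -- a power of any element outside of `T` has its inverse in `T`
  have key : ∀ g : G, g ∉ T → ∃ n : ℕ, 0 < n ∧ (g ^ n)⁻¹ ∈ T := by
    intro g hg
    by_contra! hcon
    apply hg
    -- If no positive power of `g` is inverse to an element of `T`, then `T` stays pointed after
    -- adjoining `g`, and maximality puts `g` into `T`.
    have hle : T ≤ T ⊔ Submonoid.powers g := le_sup_left
    refine hT.le_of_ge (y := T ⊔ Submonoid.powers g) ?_ hle
      (Submonoid.mem_sup_right (Submonoid.mem_powers g))
    intro a ha ha'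
    obtain ⟨s, hs, _, ⟨n, rfl⟩, rfl⟩ := Submonoid.mem_sup.1 ha
    obtain ⟨t, ht, _, ⟨m, rfl⟩, h⟩ := Submonoid.mem_sup.1 ha'
    have h1 : (g ^ (n + m))⁻¹ = s * t := by
      rw [inv_eq_iff_mul_eq_one, pow_add]
      simp only at h
      have : s * g ^ n * (t * g ^ m) = 1 := by rw [h]; simp
      rw [← this]; ac_rfl
    have h2 : n + m = 0 := by
      by_contra hne
      exact hcon (n + m) (Nat.pos_of_ne_zero hne) (h1 ▸ mul_mem hs ht)
    obtain ⟨rfl, rfl⟩ : n = 0 ∧ m = 0 := by omega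
    simp only [pow_zero, mul_one] at h ⊢
    exact hTp s hs (h ▸ ht)
  intro g
  by_contra! hg
  obtain ⟨n, hn, hn'⟩ := key g hg.1
  obtain ⟨m, hm, hm'⟩ := key g⁻¹ hg.2
  -- Negative powers of both `g` and `g⁻¹` lie in `T`, hence so do `g ^ (n * m)` and its inverse.
  -- Pointedness trivialises this power, and torsion-freeness then trivialises `g`.
  have e1 : g ^ (n * m) = 1 := by
    refine hTp _ ?_ ?_
    · have := pow_mem hm' n
      simpa [← pow_mul, mul_comm] using this
    · have := pow_mem hn' m
      simpa [← pow_mul] using this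
  exact hg.1 (tf g _ (Nat.mul_pos hn hm) e1 ▸ one_mem _)

/-- A monomial order: a well-founded strict linear order on a commutative monoid which is
compatible with the multiplication and has `1` as its smallest element. -/
structure MonomialWellOrder (C : Type*) [CommMonoid C] where
  /-- The strict order relation. -/
  lt : C → C → Prop
  trans : ∀ {a b c}, lt a b → lt b c → lt a c
  wf : WellFounded lt
  tri : ∀ a b, lt a b ∨ a = b ∨ lt b a
  one_lt : ∀ a, a ≠ 1 → lt 1 a
  mul_lt : ∀ {a b} (c), lt a b → lt (a * c) (b * c)

namespace MonomialWellOrder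

variable {C : Type*} [CommMonoid C] (o : MonomialWellOrder C)

lemma irrefl (a : C) : ¬ o.lt a a := fun h => o.wf.asymm.asymm _ _ h h

lemma asymm {a b : C} (h : o.lt a b) : ¬ o.lt b a := o.wf.asymm.asymm _ _ h

/-- The non-strict order relation. -/
def le (a b : C) : Prop := ¬ o.lt b a

lemma le_iff {a b : C} : o.le a b ↔ o.lt a b ∨ a = b := by
  constructor
  · intro h
    rcases o.tri a b with h' | h' | h'
    exacts [.inl h', .inr h', absurd h' h]
  · rintro (h | rfl)
    exacts [o.asymm h, o.irrefl a]

lemma le_rfl {a : C} : o.le a a := o.irrefl a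

lemma le_of_lt {a b : C} (h : o.lt a b) : o.le a b := o.asymm h

lemma lt_of_lt_of_le {a b c : C} (h : o.lt a b) (h' : o.le b c) : o.lt a c := by
  rcases o.le_iff.1 h' with h' | rfl
  exacts [o.trans h h', h]

lemma lt_of_le_of_lt {a b c : C} (h : o.le a b) (h' : o.lt b c) : o.lt a c := by
  rcases o.le_iff.1 h with h | rfl
  exacts [o.trans h h', h']

lemma le_trans {a b c : C} (h : o.le a b) (h' : o.le b c) : o.le a c :=
  fun h'' => h (o.lt_of_le_of_lt h' h'')

lemma le_total (a b : C) : o.le a b ∨ o.le b a := by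
  by_contra! h
  exact o.asymm (not_not.1 h.1) (not_not.1 h.2)

lemma le_mul (a b : C) : o.le a (a * b) := by
  rw [o.le_iff]
  by_cases hb : b = 1
  · right; simp [hb]
  · left; simpa [mul_comm] using o.mul_lt a (o.one_lt b hb)

lemma lt_mul (a : C) {b : C} (hb : b ≠ 1) : o.lt a (a * b) := by
  simpa [mul_comm] using o.mul_lt a (o.one_lt b hb)

lemma mul_le {a b : C} (c : C) (h : o.le a b) : o.le (a * c) (b * c) := by
  rcases o.le_iff.1 h with h | rfl
  exacts [o.le_of_lt (o.mul_lt c h), o.le_rfl]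

lemma lt_mul_mul_of_lt_of_le {a b c d : C} (h : o.lt a b) (h' : o.le c d) :
    o.lt (a * c) (b * d) := by
  refine o.lt_of_lt_of_le (o.mul_lt c h) ?_
  rw [mul_comm b, mul_comm b]
  exact o.mul_le b h'

/-- The pullback of a monomial order under an injective homomorphism. -/
def comap {D : Type*} [CommMonoid D] (f : D →* C) (hf : Function.Injective f) :
    MonomialWellOrder D where
  lt a b := o.lt (f a) (f b)
  trans := o.trans
  wf := InvImage.wf f o.wf
  tri a b := by
    rcases o.tri (f a) (f b) with h | h | h
    exacts [.inl h, .inr (.inl (hf h)), .inr (.inr h)]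
  one_lt a ha := by
    rw [map_one]
    exact o.one_lt _ fun h => ha (hf (h.trans (map_one f).symm))
  mul_lt c h := by
    rw [map_mul, map_mul]
    exact o.mul_lt _ h

end MonomialWellOrder

/-- **Dickson's lemma** for relations on a finitely generated commutative monoid. -/
lemma wellFounded_of_fg {C : Type*} [CommMonoid C] (fg : Monoid.FG C) (lt : C → C → Prop)
    (trans : ∀ a b c, lt a b → lt b c → lt a c) (h : ∀ a b, ¬ lt (a * b) a) :
    WellFounded lt := by
  obtain ⟨s, hs⟩ := fg.fg_top
  rw [wellFounded_iff_isEmpty_descending_chain]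
  refine ⟨fun ⟨f, hf⟩ => ?_⟩
  have hrep : ∀ c : C, ∃ e : s → ℕ, c = ∏ i : s, i.1 ^ e i := fun c =>
    Submonoid.mem_closure_finset'.1 (hs ▸ Submonoid.mem_top c)
  choose e he using hrep
  have hdesc : ∀ m n, m < n → lt (f n) (f m) := by
    intro m n hmn
    induction n, hmn using Nat.le_induction with
    | base => exact hf m
    | succ n _ ih => exact trans _ _ _ (hf n) ih
  -- Exponent vectors are well-quasi-ordered, so in a descending chain a later term would be a
  -- multiple of an earlier one.
  obtain ⟨m, n, hmn, hle⟩ := wellQuasiOrdered_le (α := s → ℕ) (fun n => e (f n))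
  have : f n = f m * ∏ i : s, i.1 ^ (e (f n) i - e (f m) i) := by
    conv_lhs => rw [he (f n)]
    nth_rw 1 [he (f m)]
    rw [← Finset.prod_mul_distrib]
    refine Finset.prod_congr rfl fun i _ => ?_
    rw [← pow_add, Nat.add_sub_cancel' (hle i)]
  exact h _ _ (this ▸ hdesc m n hmn)

variable {C : Type u} [CommMonoid C]

/-- The only invertible element is `1`. -/
def IsSharp (C : Type*) [CommMonoid C] : Prop := ∀ a b : C, a * b = 1 → a = 1

/-- Saturation gives divisibility in both directions, and sharpness makes the quotient trivial. This
is what makes the group of fractions torsion-free. -/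
lemma IsFsMonoid.eq_of_pow_eq (hC : IsFsMonoid C) (hs : IsSharp C) {a b : C} {n : ℕ} (hn : 0 < n)
    (h : a ^ n = b ^ n) : a = b := by
  obtain ⟨c, rfl⟩ := hC.saturated a b n hn (by rw [h])
  obtain ⟨d, hd⟩ := hC.saturated b (b * c) n hn (by rw [h])
  have := hC.cancel
  rw [mul_assoc, left_eq_mul] at hd
  rw [hs c d hd, mul_one]

lemma IsFsMonoid.group_torsionFree (hC : IsFsMonoid C) (hs : IsSharp C)
    (g : Algebra.GrothendieckGroup C) (n : ℕ) (hn : 0 < n) (h : g ^ n = 1) : g = 1 := by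
  have := hC.cancel
  obtain ⟨⟨a, b⟩, hab⟩ := (Localization.monoidOf (⊤ : Submonoid C)).surj g
  have inj := Algebra.GrothendieckGroup.of_injective (M := C)
  have e : a = (b : C) := by
    refine hC.eq_of_pow_eq hs hn (inj ?_)
    have := congrArg (· ^ n) hab
    simp only [mul_pow, h, one_mul] at this
    rw [map_pow, map_pow]
    exact this.symm
  rw [e] at hab
  simpa using hab

/-- Every homomorphism to the nonnegative reals is monotone for some monomial order. -/
theorem exists_monomialOrder (hC : IsFsMonoid C) (hs : IsSharp C) (α : C →* Multiplicative ℝ≥0) :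
    ∃ o : MonomialWellOrder C, ∀ a b, o.le a b → (α a).toAdd ≤ (α b).toAdd := by
  have := hC.cancel
  let ι : C →* Algebra.GrothendieckGroup C := Algebra.GrothendieckGroup.of
  have inj : Function.Injective ι := Algebra.GrothendieckGroup.of_injective
  let α' : C →* Multiplicative ℝ := (AddMonoidHom.toMultiplicative (NNReal.toRealHom : ℝ≥0 →+ ℝ)).comp α
  let β : Algebra.GrothendieckGroup C →* Multiplicative ℝ := Algebra.GrothendieckGroup.lift α'
  have hβ : ∀ c, (β (ι c)).toAdd = ((α c).toAdd : ℝ) := fun c => by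
    have : β (ι c) = α' c := DFunLike.congr_fun (Algebra.GrothendieckGroup.lift.symm_apply_apply α') c
    rw [this]; rfl
  -- The order has to compare by `α` first and to make every element of `C` nonnegative. Both
  -- demands are encoded in this submonoid, which is pointed since `C` is sharp; any total cone
  -- containing it gives the order.
  let S : Submonoid (Algebra.GrothendieckGroup C) :=
    { carrier := {g | 0 < (β g).toAdd ∨ ((β g).toAdd = 0 ∧ ∃ c, ι c = g)}
      one_mem' := .inr ⟨by simp, 1, by simp⟩
      mul_mem' := by
        rintro a b (ha | ⟨ha, c, rfl⟩) (hb | ⟨hb, d, rfl⟩)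
        · left; rw [map_mul, toAdd_mul]; positivity
        · left; rw [map_mul, toAdd_mul, hb, add_zero]; exact ha
        · left; rw [map_mul, toAdd_mul, ha, zero_add]; exact hb
        · right; exact ⟨by rw [map_mul, toAdd_mul, ha, hb, add_zero], c * d, by simp⟩ }
  obtain ⟨T, hST, hT, hT'⟩ := exists_total_cone (hC.group_torsionFree hs) S (by
    rintro g (h | ⟨h, c, rfl⟩) (h' | ⟨h', d, hd⟩)
    · rw [map_inv, toAdd_inv] at h'; linarith
    · rw [map_inv, toAdd_inv] at h'; linarith
    · rw [map_inv, toAdd_inv] at h'; linarith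
    · have : ι (c * d) = ι 1 := by rw [map_mul, hd, mul_inv_cancel, map_one]
      rw [hs c d (inj this), map_one])
  have hCT : ∀ c, ι c ∈ T := fun c => hST (by
    rcases (α c).toAdd.2.lt_or_eq with h | h
    · exact .inl (by rw [hβ]; exact h)
    · exact .inr ⟨by rw [hβ]; exact h.symm, c, rfl⟩)
  let lt : C → C → Prop := fun a b => a ≠ b ∧ ι b / ι a ∈ T
  have ltrans : ∀ a b c, lt a b → lt b c → lt a c := by
    rintro a b c ⟨h1, h2⟩ ⟨h3, h4⟩
    have h5 : ι c / ι a ∈ T := by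
      have := mul_mem h4 h2
      rwa [div_mul_div_cancel] at this
    refine ⟨?_, h5⟩
    rintro rfl
    have : ι b / ι a = 1 := hT _ h2 (by rwa [inv_div])
    exact h1 (inj (div_eq_one.1 this)).symm
  have lirr : ∀ a b, ¬ lt (a * b) a := by
    rintro a b ⟨h1, h2⟩
    rw [map_mul, div_mul_cancel_left] at h2
    have := hT _ (hCT b) h2
    exact h1 (by rw [inj (this.trans (map_one ι).symm), mul_one])
  have tri : ∀ a b, lt a b ∨ a = b ∨ lt b a := by
    intro a b
    by_cases h : a = b
    · exact .inr (.inl h)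
    rcases hT' (ι b / ι a) with h' | h'
    · exact .inl ⟨h, h'⟩
    · exact .inr (.inr ⟨Ne.symm h, by rwa [inv_div] at h'⟩)
  refine ⟨⟨lt, fun {a b c} => ltrans a b c, wellFounded_of_fg hC.fg lt ltrans lirr, tri, ?_, ?_⟩, ?_⟩
  · intro a ha
    exact ⟨Ne.symm ha, by simpa using hCT a⟩
  · rintro a b c ⟨h1, h2⟩
    exact ⟨fun h => h1 (mul_right_cancel h), by rwa [map_mul, map_mul, mul_div_mul_right_eq_div]⟩
  · intro a b hab
    by_contra! hlt
    refine hab ⟨?_, hST (.inl ?_)⟩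
    · rintro rfl; exact lt_irrefl _ hlt
    · rw [map_div, toAdd_div, hβ, hβ, sub_pos]
      exact_mod_cast hlt

/-! ## Growth of lengths in Noetherian local rings -/

section Length

variable {R : Type*} [CommRing R]

/-- Multiplication by `x` gives the exact sequence `0 → R / (a : x) → R / a → R / (a + x) → 0`; the
comap in the last term is the colon ideal. -/
lemma length_quotient_eq_add (a : Ideal R) (x : R) :
    Module.length R (R ⧸ a) = Module.length R (R ⧸ (a ⊔ Ideal.span {x})) +
      Module.length R (R ⧸ (Submodule.comap (LinearMap.mulRight R x) a : Ideal R)) := by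
  have h1 : a ≤ a ⊔ Ideal.span {x} := le_sup_left
  rw [add_comm]
  refine Module.length_eq_add_of_exact
    (Submodule.mapQ _ a (LinearMap.mulRight R x) le_rfl) (Submodule.factor h1) ?_
    (Submodule.factor_surjective h1) ?_
  · rw [← LinearMap.ker_eq_bot, Submodule.ker_mapQ]
    ext y
    simp
  · intro y
    obtain ⟨y, rfl⟩ := Submodule.Quotient.mk_surjective _ y
    rw [show Submodule.factor h1 (Submodule.Quotient.mk y) = Submodule.Quotient.mk y from rfl,
      Submodule.Quotient.mk_eq_zero, Submodule.mem_sup]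
    constructor
    · rintro ⟨s, hs, t, ht, rfl⟩
      obtain ⟨u, rfl⟩ := Ideal.mem_span_singleton'.1 ht
      refine ⟨Submodule.Quotient.mk u, ?_⟩
      rw [Submodule.mapQ_apply, Submodule.Quotient.eq]
      simpa using hs
    · rintro ⟨u, hu⟩
      obtain ⟨u, rfl⟩ := Submodule.Quotient.mk_surjective _ u
      rw [Submodule.mapQ_apply, Submodule.Quotient.eq] at hu
      refine ⟨y - u * x, ?_, u * x, Ideal.mem_span_singleton'.2 ⟨u, rfl⟩, by ring⟩
      rw [← neg_mem_iff]
      simpa using hu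

lemma length_quotient_anti {a b : Ideal R} (h : a ≤ b) :
    Module.length R (R ⧸ b) ≤ Module.length R (R ⧸ a) :=
  Module.length_le_of_surjective (Submodule.factor h) (Submodule.factor_surjective h)

/-- A discrete mean value inequality, used to add up length increments of order `n ^ d` to a total
of order `n ^ (d + 1)`. -/
lemma pow_succ_le_sub_pow_add (n k d : ℕ) (h : k ≤ n) :
    n ^ (d + 1) ≤ (n - k) ^ (d + 1) + (d + 1) * k * n ^ d := by
  obtain ⟨m, rfl⟩ := Nat.exists_eq_add_of_le' h
  rw [Nat.add_sub_cancel]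
  induction d with
  | zero => simp
  | succ d ih =>
    calc (m + k) ^ (d + 1 + 1) = (m + k) * (m + k) ^ (d + 1) := by ring
      _ ≤ (m + k) * (m ^ (d + 1) + (d + 1) * k * (m + k) ^ d) := by gcongr
      _ = m ^ (d + 1 + 1) + k * m ^ (d + 1) + (d + 1) * k * (m + k) ^ (d + 1) := by ring
      _ ≤ m ^ (d + 1 + 1) + k * (m + k) ^ (d + 1) + (d + 1) * k * (m + k) ^ (d + 1) := by
        gcongr; omega
      _ = _ := by ring

variable [IsLocalRing R] [IsNoetherianRing R]

open IsLocalRing in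
-- Induction on the chain `p = p₀ < p₁ < ⋯`. For `x ∈ p₁ ∖ p`, Artin–Rees bounds the colon ideal of
-- `p + 𝔪 ^ n` by `x`, so the length modulo `p + 𝔪 ^ n` exceeds that modulo `p + 𝔪 ^ (n - (k + 1))`
-- by at least the length modulo `p + (x) + 𝔪 ^ n`, to which the shorter chain applies.
lemma exists_pow_le_mul_length_of_ltSeries (d : ℕ) (a : Ideal R) (l : LTSeries (PrimeSpectrum R))
    (hl : l.length = d) (ha : a ≤ l.head.asIdeal) :
    ∃ c : ℕ, ∀ n : ℕ, 1 ≤ n →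
      ((n ^ d : ℕ) : ℕ∞) ≤ c * Module.length R (R ⧸ (a ⊔ maximalIdeal R ^ n)) := by
  induction d generalizing a l with
  | zero =>
    refine ⟨1, fun n hn => ?_⟩
    have : Nontrivial (R ⧸ (a ⊔ maximalIdeal R ^ n)) := by
      refine Ideal.Quotient.nontrivial_iff.2 (ne_top_of_le_ne_top (maximalIdeal.isMaximal R).ne_top
        (sup_le (ha.trans (le_maximalIdeal l.head.2.ne_top)) (Ideal.pow_le_self (by omega))))
    have h := (Module.length_pos_iff (R := R)).2 this
    simpa using Order.one_le_iff_pos.2 h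
  | succ d ih =>
    have hl0 : l.length ≠ 0 := by omega
    have hlt : l.head < (l.tail hl0).head := by
      have := l.step ⟨0, by omega⟩
      have h2 : (l.tail hl0).head = l.toFun (Fin.succ ⟨0, by omega⟩) := by
        rw [RelSeries.head_tail]
        congr 1
        ext
        simp [Nat.mod_eq_of_lt (show 1 < l.length + 1 by omega)]
      rw [h2]
      exact this
    obtain ⟨x, hx1, hx0⟩ := SetLike.exists_of_lt
      (show l.head.asIdeal < (l.tail hl0).head.asIdeal from hlt)
    set p := l.head.asIdeal with hp
    have hpp : p.IsPrime := l.head.2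
    obtain ⟨c', hc'⟩ := ih (p ⊔ Ideal.span {x}) (l.tail hl0) (by simp [hl])
      (sup_le hlt.le (by simpa using hx1))
    -- Artin–Rees
    obtain ⟨k, hk⟩ := (maximalIdeal R).exists_pow_inf_eq_pow_smul
      (Submodule.span R {(Ideal.Quotient.mk p x : R ⧸ p)})
    -- The shift is `k + 1` instead of the Artin–Rees number `k`, so that the later recursion on `n`
    -- strictly decreases even if `k = 0`.
    have hAR : ∀ n, k + 1 ≤ n → (Submodule.comap (LinearMap.mulRight R x) (p ⊔ maximalIdeal R ^ n) : Ideal R) ≤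
        p ⊔ maximalIdeal R ^ (n - (k + 1)) := by
      intro n hn f hf
      have hf' : f * x ∈ p ⊔ maximalIdeal R ^ n := hf
      obtain ⟨s, hs, t, ht, hst⟩ := Submodule.mem_sup.1 hf'
      have h1 : (Ideal.Quotient.mk p (f * x) : R ⧸ p) ∈ maximalIdeal R ^ n • (⊤ : Submodule R (R ⧸ p)) ⊓
          Submodule.span R {(Ideal.Quotient.mk p x : R ⧸ p)} := by
        refine ⟨?_, Submodule.mem_span_singleton.2 ⟨f, by rw [map_mul]; rfl⟩⟩
        have h2 : (Ideal.Quotient.mk p (f * x) : R ⧸ p) = t • (1 : R ⧸ p) := by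
          rw [← hst, map_add, Ideal.Quotient.eq_zero_iff_mem.2 hs, zero_add, Algebra.smul_def,
            mul_one]
          rfl
        rw [h2]
        exact Submodule.smul_mem_smul ht trivial
      rw [hk n (by omega)] at h1
      have h3 := Submodule.smul_mono (le_refl (maximalIdeal R ^ (n - k))) inf_le_right h1
      obtain ⟨g, hg, hgx⟩ := Submodule.mem_smul_span_singleton.1 h3
      have h4 : g * x - f * x ∈ p := by
        rw [← Ideal.Quotient.mk_eq_mk_iff_sub_mem, ← hgx, map_mul]
        rfl
      rw [← sub_mul] at h4
      have h5 := (hpp.mem_or_mem h4).resolve_right hx0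
      have h6 : g ∈ maximalIdeal R ^ (n - (k + 1)) := Ideal.pow_le_pow_right (by omega) hg
      have : f = -(g - f) + g := by ring
      rw [this]
      exact add_mem (Ideal.mem_sup_left (neg_mem h5)) (Ideal.mem_sup_right h6)
    -- The factor `(d + 1) * (k + 1)` is the one from `pow_succ_le_sub_pow_add` with step `k + 1`;
    -- it also absorbs the initial range `n ≤ k + 1`, where `n ^ (d + 1) ≤ (k + 1) * n ^ d`.
    refine ⟨c' * ((d + 1) * (k + 1)), fun n hn => ?_⟩
    refine le_trans ?_ (mul_le_mul_right (length_quotient_anti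
      (show a ⊔ maximalIdeal R ^ n ≤ p ⊔ maximalIdeal R ^ n from sup_le_sup_right ha _)) _)
    induction n using Nat.strong_induction_on with
    | _ n ihn =>
      have hsup : p ⊔ maximalIdeal R ^ n ⊔ Ideal.span {x} =
          p ⊔ Ideal.span {x} ⊔ maximalIdeal R ^ n := by
        rw [sup_assoc, sup_comm (maximalIdeal R ^ n), sup_assoc]
      rcases lt_or_ge (k + 1) n with hkn | hkn
      · have h1 := hc' n hn
        have h2 := ihn (n - (k + 1)) (by omega) (by omega)
        rw [length_quotient_eq_add _ x, hsup, mul_add]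
        calc ((n ^ (d + 1) : ℕ) : ℕ∞)
            ≤ (((n - (k + 1)) ^ (d + 1) + (d + 1) * (k + 1) * n ^ d : ℕ) : ℕ∞) := by
              exact_mod_cast pow_succ_le_sub_pow_add n (k + 1) d hkn.le
          _ = ((d + 1) * (k + 1) : ℕ) * ((n ^ d : ℕ) : ℕ∞) +
              (((n - (k + 1)) ^ (d + 1) : ℕ) : ℕ∞) := by push_cast; ring
          _ ≤ ((d + 1) * (k + 1) : ℕ) *
                (c' * Module.length R (R ⧸ (p ⊔ Ideal.span {x} ⊔ maximalIdeal R ^ n))) +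
              (c' * ((d + 1) * (k + 1)) : ℕ) *
                Module.length R (R ⧸ (p ⊔ maximalIdeal R ^ (n - (k + 1)))) := by gcongr
          _ ≤ _ := by
            refine add_le_add (le_of_eq ?_) (mul_le_mul_right (length_quotient_anti (hAR n hkn.le)) _)
            push_cast; ring
      · have h1 := hc' n hn
        rw [← hsup] at h1
        calc ((n ^ (d + 1) : ℕ) : ℕ∞) = ((n ^ d : ℕ) : ℕ∞) * (n : ℕ∞) := by push_cast; ring
          _ ≤ (c' * Module.length R (R ⧸ (p ⊔ maximalIdeal R ^ n))) *
              (((d + 1) * (k + 1) : ℕ) : ℕ∞) := by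
            refine mul_le_mul' (h1.trans ?_) ?_
            · gcongr
              exact length_quotient_anti le_sup_left
            · exact_mod_cast hkn.trans (Nat.le_mul_of_pos_left _ (by omega))
          _ = _ := by push_cast; ring

open IsLocalRing in
/-- The length of `R / 𝔪 ^ n` grows at least like `n ^ dim R`. -/
theorem exists_pow_le_mul_length (d : ℕ) (hd : (d : WithBot ℕ∞) ≤ ringKrullDim R) :
    ∃ c : ℕ, ∀ n : ℕ, 1 ≤ n →
      ((n ^ d : ℕ) : ℕ∞) ≤ c * Module.length R (R ⧸ (maximalIdeal R ^ n)) := by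
  obtain ⟨l, hl⟩ := Order.le_krullDim_iff.1 hd
  have h := exists_pow_le_mul_length_of_ltSeries d ⊥ l hl bot_le
  refine h.imp fun c hc n hn => (hc n hn).trans ?_
  gcongr
  exact length_quotient_anti le_sup_right

end Length

/-! ## Independence of monomials -/

lemma MonomialWellOrder.exists_max {C : Type*} [CommMonoid C] (o : MonomialWellOrder C) (s : Set C)
    (hs : s.Finite) (hne : s.Nonempty) : ∃ m ∈ s, ∀ a ∈ s, o.le a m := by
  induction s, hs using Set.Finite.induction_on with
  | empty => exact absurd hne Set.not_nonempty_empty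
  | @insert b s _ _ ih =>
    rcases s.eq_empty_or_nonempty with rfl | hne'
    · exact ⟨b, by simp, by simpa using o.le_rfl⟩
    · obtain ⟨m, hm, hmax⟩ := ih hne'
      rcases o.le_total b m with h | h
      · exact ⟨m, .inr hm, by rintro a (rfl | ha); exacts [h, hmax a ha]⟩
      · exact ⟨b, .inl rfl, by rintro a (rfl | ha); exacts [o.le_rfl, o.le_trans (hmax a ha) h]⟩

/-- Representatives `r c ∈ R` of the elements of a monoid `C`, multiplicative up to units, the
noninvertible ones of which generate the maximal ideal. -/
structure IsMonomialSystem {R C : Type*} [CommRing R] [IsLocalRing R] [CommMonoid C]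
    (r : C → R) : Prop where
  map_one : IsUnit (r 1)
  map_mul : ∀ a b, Associated (r (a * b)) (r a * r b)
  span_eq : Ideal.span (r '' {1}ᶜ) = IsLocalRing.maximalIdeal R

namespace IsMonomialSystem

open IsLocalRing

variable {R C : Type*} [CommRing R] [IsLocalRing R] [CommMonoid C] {r : C → R}

lemma mem_mul_left (hr : IsMonomialSystem r) {I : Ideal R} {a : C} (h : r a ∈ I) (b : C) :
    r (a * b) ∈ I := by
  obtain ⟨u, hu⟩ := (hr.map_mul a b).symm
  rw [← hu]
  exact I.mul_mem_right _ (I.mul_mem_right _ h)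

lemma mem_maximalIdeal (hr : IsMonomialSystem r) {a : C} (ha : a ≠ 1) : r a ∈ maximalIdeal R :=
  hr.span_eq ▸ Ideal.subset_span ⟨a, ha, rfl⟩

lemma mem_pow_mul (hr : IsMonomialSystem r) {a b : C} {m n : ℕ} (ha : r a ∈ maximalIdeal R ^ m)
    (hb : r b ∈ maximalIdeal R ^ n) : r (a * b) ∈ maximalIdeal R ^ (m + n) := by
  obtain ⟨u, hu⟩ := (hr.map_mul a b).symm
  rw [← hu, pow_add]
  exact Ideal.mul_mem_right _ _ (Ideal.mul_mem_mul ha hb)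

lemma prod_mem_pow (hr : IsMonomialSystem r) {ι : Type*} (s : Finset ι) (g : ι → C)
    (hg : ∀ i ∈ s, g i ≠ 1) (e : ι → ℕ) :
    r (∏ i ∈ s, g i ^ e i) ∈ maximalIdeal R ^ (∑ i ∈ s, e i) := by
  classical
  induction s using Finset.induction_on with
  | empty => simp
  | insert a s ha ih =>
    rw [Finset.prod_insert ha, Finset.sum_insert ha]
    refine hr.mem_pow_mul ?_ (ih fun i hi => hg i (Finset.mem_insert_of_mem hi))
    generalize e a = n
    induction n with
    | zero => simp
    | succ n ih =>
      rw [pow_succ (g a)]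
      refine hr.mem_pow_mul ih ?_
      rw [pow_one]
      exact hr.mem_maximalIdeal (hg a (Finset.mem_insert_self _ _))

/-- Enlarge `K` by its largest missing element `q`, one at a time. All monomials beyond `q` are
already in `K`, so `𝔪 * r q` lies in the ideal of `K` and the length drops by at most one. If `p`
divides `q`, multiplying the relation for `p` by `q / p` shows that `r q` is itself in the ideal,
and nothing is lost. -/
lemma length_quotient_le (hr : IsMonomialSystem r) (o : MonomialWellOrder C) (p : C)
    (hp : r p ∈ Ideal.span (r '' {q | o.lt p q})) (K : Set C) (hK : ∀ a ∈ K, ∀ b, a * b ∈ K)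
    (hfin : Kᶜ.Finite) :
    Module.length R (R ⧸ Ideal.span (r '' K)) ≤ ({a | a ∉ K ∧ ¬ p ∣ a} : Set C).encard := by
  induction hn : Kᶜ.ncard using Nat.strong_induction_on generalizing K with
  | _ n ih =>
  rcases Kᶜ.eq_empty_or_nonempty with hem | hne
  · have h1 : r 1 ∈ Ideal.span (r '' K) :=
      Ideal.subset_span ⟨1, by rw [Set.compl_empty_iff.1 hem]; trivial, rfl⟩
    have := Ideal.Quotient.subsingleton_iff.2 (Ideal.eq_top_of_isUnit_mem _ h1 hr.map_one)
    rw [Module.length_eq_zero]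
    exact zero_le
  obtain ⟨q, hq, hmax⟩ := o.exists_max _ hfin hne
  have hgt : ∀ a, o.lt q a → a ∈ K := fun a ha => by
    by_contra h
    exact hmax a h ha
  have hcompl : (insert q K)ᶜ = Kᶜ \ {q} := by ext; simp; tauto
  have hlt : (insert q K)ᶜ.ncard < n := by
    rw [hcompl, ← hn]
    exact Set.ncard_sdiff_singleton_lt_of_mem hq hfin
  have ih' := ih _ hlt (insert q K) (by
      rintro a (rfl | ha) b
      · by_cases hb : b = 1
        · simp [hb]
        · exact .inr (hgt _ (o.lt_mul a hb))
      · exact .inr (hK a ha b)) (hfin.subset (by simp)) rfl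
  have hsup : Ideal.span (r '' insert q K) = Ideal.span (r '' K) ⊔ Ideal.span {r q} := by
    rw [Set.image_insert_eq, Ideal.span_insert, sup_comm]
  by_cases hpq : p ∣ q
  · obtain ⟨c, rfl⟩ := hpq
    have hmem : r (p * c) ∈ Ideal.span (r '' K) := by
      have h1 : r p * r c ∈ Ideal.span (r '' K) := by
        have h2 : Ideal.span (r '' {q | o.lt p q}) ≤
            (Submodule.comap (LinearMap.mulRight R (r c)) (Ideal.span (r '' K)) : Ideal R) := by
          rw [Ideal.span_le]
          rintro _ ⟨d, hd, rfl⟩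
          show r d * r c ∈ Ideal.span (r '' K)
          obtain ⟨u, hu⟩ := hr.map_mul d c
          rw [← hu]
          exact Ideal.mul_mem_right _ _ (Ideal.subset_span ⟨_, hgt _ (o.mul_lt c hd), rfl⟩)
        exact h2 hp
      obtain ⟨u, hu⟩ := (hr.map_mul p c).symm
      rw [← hu]
      exact Ideal.mul_mem_right _ _ h1
    have heq : Ideal.span (r '' insert (p * c) K) = Ideal.span (r '' K) := by
      rw [hsup, sup_eq_left, Ideal.span_singleton_le_iff_mem]
      exact hmem
    rw [heq] at ih'
    refine ih'.trans (Set.encard_le_encard ?_)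
    rintro a ⟨h1, h2⟩
    exact ⟨fun h => h1 (.inr h), h2⟩
  · rw [length_quotient_eq_add _ (r q), ← hsup]
    have hset : ({a | a ∉ K ∧ ¬ p ∣ a} : Set C) = insert q {a | a ∉ insert q K ∧ ¬ p ∣ a} := by
      ext a
      simp only [Set.mem_ofPred_eq, Set.mem_insert_iff, not_or]
      constructor
      · rintro ⟨h1, h2⟩
        by_cases h : a = q
        exacts [.inl h, .inr ⟨⟨h, h1⟩, h2⟩]
      · rintro (rfl | ⟨⟨-, h1⟩, h2⟩)
        exacts [⟨hq, hpq⟩, ⟨h1, h2⟩]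
    rw [hset, Set.encard_insert_of_notMem (by simp)]
    refine add_le_add ih' ?_
    have hle : maximalIdeal R ≤
        (Submodule.comap (LinearMap.mulRight R (r q)) (Ideal.span (r '' K)) : Ideal R) := by
      rw [← hr.span_eq, Ideal.span_le]
      rintro _ ⟨b, hb, rfl⟩
      show r b * r q ∈ Ideal.span (r '' K)
      obtain ⟨u, hu⟩ := hr.map_mul b q
      rw [← hu, mul_comm b]
      exact Ideal.mul_mem_right _ _ (Ideal.subset_span ⟨_, hgt _ (o.lt_mul q hb), rfl⟩)
    refine (length_quotient_anti hle).trans (le_of_eq ?_)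
    rw [Module.length_eq_one_iff]
    exact (isSimpleModule_iff_isCoatom).2 (maximalIdeal.isMaximal R).out

end IsMonomialSystem

/-- In a submonoid of `ℤ ^ d` generated by a finite set `s`, the number of products of fewer than
`n` elements of `s` that are not divisible by `p ≠ 1` is `O(n ^ (d - 1))`. -/
lemma exists_encard_le {C σ : Type*} [CommMonoid C] [Fintype σ]
    (ι : C →* Multiplicative (σ → ℤ)) (hι : Function.Injective ι) (s : Finset C) (p : C)
    (hp : p ≠ 1) :
    0 < Fintype.card σ ∧ ∃ D : ℕ, ∀ n : ℕ, 1 ≤ n →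
      ({a | ¬ p ∣ a ∧ ∃ e : s → ℕ, ∑ i, e i < n ∧ a = ∏ i : s, i.1 ^ e i} : Set C).encard ≤
        (D * n ^ (Fintype.card σ - 1) : ℕ) := by
  classical
  let x : C → σ → ℤ := fun c => (ι c).toAdd
  have hxmul : ∀ a b i, x (a * b) i = x a i + x b i := fun a b i => by simp [x]
  have hxinj : ∀ a b, (∀ i, x a i = x b i) → a = b := fun a b h => hι (by
    apply Multiplicative.toAdd.injective
    exact funext h)
  have hx1 : ∀ i, x 1 i = 0 := fun i => by simp [x]
  have hxpow : ∀ a (m : ℕ) i, x (a ^ m) i = m * x a i := fun a m i => by simp [x]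
  obtain ⟨j, hj⟩ : ∃ j, x p j ≠ 0 := by
    by_contra! h
    exact hp (hxinj _ _ fun i => by rw [h, hx1])
  refine ⟨Fintype.card_pos_iff.2 ⟨j⟩, ?_⟩
  let B : ℕ := ∑ g ∈ s, ∑ i, (x g i).natAbs
  let V : ℕ := ∑ i, (x p i).natAbs
  have hB : ∀ g ∈ s, ∀ i, |x g i| ≤ B := fun g hg i => by
    rw [Int.abs_eq_natAbs]
    have h1 : (x g i).natAbs ≤ ∑ i, (x g i).natAbs :=
      Finset.single_le_sum (f := fun i => (x g i).natAbs) (fun _ _ => Nat.zero_le _) (Finset.mem_univ i)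
    have h2 : ∑ i, (x g i).natAbs ≤ B :=
      Finset.single_le_sum (f := fun g => ∑ i, (x g i).natAbs) (fun _ _ => Nat.zero_le _) hg
    exact_mod_cast h1.trans h2
  have hV : ∀ i, |x p i| ≤ V := fun i => by
    rw [Int.abs_eq_natAbs]
    exact_mod_cast Finset.single_le_sum (f := fun i => (x p i).natAbs)
      (fun _ _ => Nat.zero_le _) (Finset.mem_univ i)
  have hbound : ∀ (n : ℕ) (e : s → ℕ), ∑ i, e i < n → ∀ i, |x (∏ g : s, g.1 ^ e g) i| ≤ B * n := by
    intro n e he i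
    have h1 : x (∏ g : s, g.1 ^ e g) i = ∑ g : s, (e g : ℤ) * x g.1 i := by
      have : ∀ t : Finset s, x (∏ g ∈ t, g.1 ^ e g) i = ∑ g ∈ t, (e g : ℤ) * x g.1 i := by
        intro t
        induction t using Finset.induction_on with
        | empty => simp [hx1]
        | insert a t ha ih => rw [Finset.prod_insert ha, Finset.sum_insert ha, hxmul, hxpow, ih]
      exact this _
    rw [h1]
    calc |∑ g : s, (e g : ℤ) * x g.1 i| ≤ ∑ g : s, |(e g : ℤ) * x g.1 i| :=
          Finset.abs_sum_le_sum_abs _ _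
      _ ≤ ∑ g : s, (e g : ℤ) * B := by
        refine Finset.sum_le_sum fun g _ => ?_
        rw [abs_mul, Nat.abs_cast]
        exact mul_le_mul_of_nonneg_left (hB _ g.2 i) (by positivity)
      _ = B * ((∑ g, e g : ℕ) : ℤ) := by rw [← Finset.sum_mul]; push_cast; ring
      _ ≤ B * n := by
        have : ((∑ g, e g : ℕ) : ℤ) ≤ n := by exact_mod_cast he.le
        exact mul_le_mul_of_nonneg_left this (by positivity)
  -- The first component is the projection along the direction of `p`, with denominators cleared;
  -- the residue modulo `x p j` then fixes the position on the line up to integral multiples of `p`.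
  -- Elements with the same image differ by a power of `p`, so `f` is injective on elements not
  -- divisible by `p`.
  let f : C → ({i // i ≠ j} → ℤ) × ℤ :=
    fun a => (fun i => x p j * x a i - x a j * x p i, x a j % x p j)
  -- There are `|x p j|` residues, and each of the other `d - 1` coordinates lies in `[-M, M]` with
  -- `M = 2 V B n`, leaving `4 V B n + 1 ≤ (4 V B + 1) n` values since `n ≥ 1`.
  refine ⟨(x p j).natAbs * (4 * V * B + 1) ^ (Fintype.card σ - 1), fun n hn => ?_⟩
  let M : ℤ := 2 * V * (B * n)
  let T : Finset (({i // i ≠ j} → ℤ) × ℤ) :=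
    (Fintype.piFinset fun _ => Finset.Icc (-M) M) ×ˢ (Finset.Ico 0 ((x p j).natAbs : ℤ))
  have hT : T.card ≤ (x p j).natAbs * (4 * V * B + 1) ^ (Fintype.card σ - 1) *
      n ^ (Fintype.card σ - 1) := by
    rw [Finset.card_product, Fintype.card_piFinset, Finset.prod_const, Finset.card_univ, Int.card_Icc, Int.card_Ico, sub_zero,
      Int.toNat_natCast, mul_comm, mul_assoc, ← mul_pow]
    have hcard : Fintype.card {i // i ≠ j} = Fintype.card σ - 1 := Set.card_ne_eq j
    rw [hcard]
    gcongr
    have : (M + 1 - -M) = ((4 * V * B * n + 1 : ℕ) : ℤ) := by simp only [M]; push_cast; ring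
    rw [this, Int.toNat_natCast, add_mul, one_mul]
    omega
  refine le_trans ?_ (Nat.cast_le.2 hT)
  rw [← Set.encard_coe_eq_coe_finsetCard]
  refine Set.encard_le_encard_of_injOn (f := f) ?_ ?_
  · rintro _ ⟨-, e, he, rfl⟩
    have hb := hbound n e he
    set a := ∏ g : s, g.1 ^ e g
    simp only [T, f, Finset.coe_product, Set.mem_prod, Finset.mem_coe, Fintype.mem_piFinset,
      Finset.mem_Icc, Finset.mem_Ico]
    refine ⟨fun i => abs_le.1 ?_, Int.emod_nonneg _ hj, ?_⟩
    · calc |x p j * x a i - x a j * x p i| ≤ |x p j * x a i| + |x a j * x p i| := abs_sub _ _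
        _ = |x p j| * |x a i| + |x a j| * |x p i| := by rw [abs_mul, abs_mul]
        _ ≤ V * (B * n) + (B * n) * V := by
          gcongr
          exacts [hV j, hb i, hb j, hV i]
        _ = M := by simp only [M]; ring
    · rw [← Int.abs_eq_natAbs]
      exact Int.emod_lt_abs _ hj
  · have aux : ∀ a b : C, f a = f b → x b j ≤ x a j → 0 < x p j → ∃ c : ℕ, a = b * p ^ c := by
      intro a b hab hle hpos
      have h1 : ∀ i, x p j * x a i - x a j * x p i = x p j * x b i - x b j * x p i := by
        intro i
        by_cases hi : i = j
        · subst hi; ring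
        · exact congrFun (congrArg Prod.fst hab) ⟨i, hi⟩
      have h2 : x p j ∣ x a j - x b j := Int.ModEq.dvd (congrArg Prod.snd hab).symm
      obtain ⟨c, hc⟩ := h2
      have hc0 : 0 ≤ c := by
        by_contra h
        nlinarith
      lift c to ℕ using hc0
      refine ⟨c, hxinj _ _ fun i => ?_⟩
      rw [hxmul, hxpow]
      have h3 := h1 i
      have h4 : x p j * (x a i - (x b i + c * x p i)) = 0 := by
        linear_combination h3 + x p i * hc
      exact sub_eq_zero.1 ((mul_eq_zero.1 h4).resolve_left hj)
    -- For negative `x p j`, multiplication by `p` lowers the `j`-th coordinate, so the roles of `a`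
    -- and `b` are exchanged.
    have aux' : ∀ a b : C, f a = f b → x b j ≤ x a j → x p j < 0 → ∃ c : ℕ, b = a * p ^ c := by
      intro a b hab hle hpos
      have h1 : ∀ i, x p j * x a i - x a j * x p i = x p j * x b i - x b j * x p i := by
        intro i
        by_cases hi : i = j
        · subst hi; ring
        · exact congrFun (congrArg Prod.fst hab) ⟨i, hi⟩
      have h2 : x p j ∣ x b j - x a j := Int.ModEq.dvd (congrArg Prod.snd hab)
      obtain ⟨c, hc⟩ := h2
      have hc0 : 0 ≤ c := by
        by_contra h
        nlinarith
      lift c to ℕ using hc0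
      refine ⟨c, hxinj _ _ fun i => ?_⟩
      rw [hxmul, hxpow]
      have h3 := h1 i
      have h4 : x p j * (x b i - (x a i + c * x p i)) = 0 := by
        linear_combination -h3 + x p i * hc
      exact sub_eq_zero.1 ((mul_eq_zero.1 h4).resolve_left hj)
    have fin : ∀ a b : C, ¬ p ∣ a → (∃ c : ℕ, a = b * p ^ c) → a = b := by
      rintro a b ha ⟨c, rfl⟩
      rcases c with _ | c
      · simp
      · exact absurd ⟨b * p ^ c, by rw [pow_succ]; ac_rfl⟩ ha
    rintro a ⟨ha, -⟩ b ⟨hb, -⟩ hab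
    rcases lt_or_gt_of_ne hj with hneg | hpos
    · rcases le_total (x b j) (x a j) with h | h
      · exact (fin b a hb (aux' a b hab h hneg)).symm
      · exact fin a b ha (aux' b a hab.symm h hneg)
    · rcases le_total (x b j) (x a j) with h | h
      · exact fin a b ha (aux a b hab h hpos)
      · exact (fin b a hb (aux b a hab.symm h hpos)).symm

open IsLocalRing in
/-- If the dimension of `R` is at least the rank of `C`, no monomial lies in the ideal generated by
the larger monomials. -/
theorem IsMonomialSystem.notMem_span {R C σ : Type*} [CommRing R] [IsLocalRing R]
    [IsNoetherianRing R] [CommMonoid C] [Fintype σ] {r : C → R} (hr : IsMonomialSystem r)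
    (fg : Monoid.FG C) (ι : C →* Multiplicative (σ → ℤ)) (hι : Function.Injective ι)
    (hdim : (Fintype.card σ : WithBot ℕ∞) ≤ ringKrullDim R) (o : MonomialWellOrder C) (p : C) :
    r p ∉ Ideal.span (r '' {q | o.lt p q}) := by
  classical
  intro hp
  have hp1 : p ≠ 1 := by
    rintro rfl
    have : Ideal.span (r '' {q | o.lt 1 q}) ≤ maximalIdeal R := by
      rw [Ideal.span_le]
      rintro _ ⟨q, hq, rfl⟩
      exact hr.mem_maximalIdeal fun h => o.irrefl 1 (h ▸ hq)
    exact (maximalIdeal R).ne_top_iff_one.1 (maximalIdeal.isMaximal R).ne_top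
      (((maximalIdeal R).eq_top_of_isUnit_mem (this hp) hr.map_one) ▸ trivial)
  obtain ⟨s', hs'⟩ := fg.fg_top
  -- Without the trivial generator, a product of at least `n` generators is represented in `𝔪 ^ n`.
  let s := s'.erase 1
  have hs : Submonoid.closure (s : Set C) = ⊤ := by
    rw [← hs', Finset.coe_erase, Submonoid.closure_sdiff_singleton_one]
  have hrep : ∀ c : C, ∃ e : s → ℕ, c = ∏ i : s, i.1 ^ e i := fun c =>
    Submonoid.mem_closure_finset'.1 (hs ▸ Submonoid.mem_top c)
  obtain ⟨hσ, D, hD⟩ := exists_encard_le ι hι s p hp1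
  obtain ⟨c, hc⟩ := exists_pow_le_mul_length (R := R) _ hdim
  -- With `d` the rank, `n ^ d ≤ c * length (R / 𝔪 ^ n) ≤ c * D * n ^ (d - 1)` for all `n ≥ 1`,
  -- which fails at `n = c * D + 1`.
  have key : ∀ n : ℕ, 1 ≤ n → n ≤ c * D := by
    intro n hn
    let K : Set C := {a | r a ∈ maximalIdeal R ^ n}
    have hKe : ∀ a ∉ K, ∀ e : s → ℕ, a = ∏ i : s, i.1 ^ e i → ∑ i, e i < n := by
      rintro _ ha e rfl
      by_contra! hle
      exact ha (Ideal.pow_le_pow_right hle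
        (hr.prod_mem_pow Finset.univ (fun i : s => i.1) (fun i _ => (Finset.mem_erase.1 i.2).1) e))
    have hfin : Kᶜ.Finite := by
      refine (Set.Finite.image (fun e : s → ℕ => ∏ i : s, i.1 ^ e i)
        (Set.finite_Iic (fun _ : s => n))).subset ?_
      intro a ha
      obtain ⟨e, rfl⟩ := hrep a
      refine ⟨e, fun i => ?_, rfl⟩
      have h1 := hKe _ ha e rfl
      exact (Finset.single_le_sum (f := e) (fun _ _ => Nat.zero_le _) (Finset.mem_univ i)).trans h1.le
    have h1 := hr.length_quotient_le o p hp K (fun a ha b => hr.mem_mul_left ha b) hfin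
    have h2 : Module.length R (R ⧸ maximalIdeal R ^ n) ≤
        Module.length R (R ⧸ Ideal.span (r '' K)) := by
      refine length_quotient_anti ?_
      rw [Ideal.span_le]
      rintro _ ⟨a, ha, rfl⟩
      exact ha
    have h3 : ({a | a ∉ K ∧ ¬ p ∣ a} : Set C).encard ≤ (D * n ^ (Fintype.card σ - 1) : ℕ) := by
      refine (Set.encard_le_encard ?_).trans (hD n hn)
      rintro a ⟨h1, h2⟩
      obtain ⟨e, he⟩ := hrep a
      exact ⟨h2, e, hKe a h1 e he, he⟩
    have h4 : ((n ^ Fintype.card σ : ℕ) : ℕ∞) ≤ ((c * (D * n ^ (Fintype.card σ - 1)) : ℕ) : ℕ∞) := by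
      refine (hc n hn).trans ?_
      rw [Nat.cast_mul c]
      gcongr
      exact h2.trans (h1.trans h3)
    have h5 : n ^ Fintype.card σ ≤ c * (D * n ^ (Fintype.card σ - 1)) := by exact_mod_cast h4
    obtain ⟨m, hm⟩ := Nat.exists_eq_add_of_le' hσ
    rw [hm, Nat.add_sub_cancel, pow_succ, mul_comm, ← mul_assoc] at h5
    exact Nat.le_of_mul_le_mul_right h5 (by positivity)
  have := key (c * D + 1) (by omega)
  omega

/-! ## Initial monomials and monomial valuations -/

namespace IsMonomialSystem

open IsLocalRing

variable {R C : Type*} [CommRing R] [IsLocalRing R] [CommMonoid C] {r : C → R}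

lemma finite_compl (hr : IsMonomialSystem r) (fg : Monoid.FG C) (n : ℕ) :
    {a | r a ∈ maximalIdeal R ^ n}ᶜ.Finite := by
  classical
  obtain ⟨s', hs'⟩ := fg.fg_top
  let s := s'.erase 1
  have hs : Submonoid.closure (s : Set C) = ⊤ := by
    rw [← hs', Finset.coe_erase, Submonoid.closure_sdiff_singleton_one]
  refine (Set.Finite.image (fun e : s → ℕ => ∏ i : s, i.1 ^ e i)
    (Set.finite_Iic (fun _ : s => n))).subset ?_
  intro a ha
  obtain ⟨e, rfl⟩ : ∃ e : s → ℕ, a = ∏ i : s, i.1 ^ e i :=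
    Submonoid.mem_closure_finset'.1 (hs ▸ Submonoid.mem_top a)
  refine ⟨e, fun i => ?_, rfl⟩
  by_contra! hlt
  refine ha (Ideal.pow_le_pow_right (hlt.le.trans ?_)
    (hr.prod_mem_pow Finset.univ (fun i : s => i.1) (fun i _ => (Finset.mem_erase.1 i.2).1) e))
  exact Finset.single_le_sum (f := e) (fun _ _ => Nat.zero_le _) (Finset.mem_univ i)

end IsMonomialSystem

/-- Krull's intersection theorem for the module `R / I`. -/
lemma mem_of_forall_mem_sup_pow {R : Type*} [CommRing R] [IsLocalRing R] [IsNoetherianRing R]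
    {I : Ideal R} {f : R} (h : ∀ n, f ∈ I ⊔ IsLocalRing.maximalIdeal R ^ n) : f ∈ I := by
  rw [← Ideal.Quotient.eq_zero_iff_mem]
  have h1 := Ideal.iInf_pow_smul_eq_bot_of_isLocalRing (M := R ⧸ I) (IsLocalRing.maximalIdeal R)
    (IsLocalRing.maximalIdeal.isMaximal R).ne_top
  rw [← Submodule.mem_bot R, ← h1, Submodule.mem_iInf]
  intro n
  obtain ⟨s, hs, t, ht, rfl⟩ := Submodule.mem_sup.1 (h n)
  have h2 : (Ideal.Quotient.mk I (s + t) : R ⧸ I) = t • (1 : R ⧸ I) := by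
    rw [map_add, Ideal.Quotient.eq_zero_iff_mem.2 hs, zero_add, Algebra.smul_def, mul_one]
    rfl
  rw [h2]
  exact Submodule.smul_mem_smul ht trivial

/-- `p` is the smallest monomial occurring in `f`. -/
def IsInitial {R C : Type*} [CommRing R] [CommMonoid C] (r : C → R) (o : MonomialWellOrder C)
    (f : R) (p : C) : Prop :=
  f ∈ Ideal.span (r '' {q | o.le p q}) ∧ f ∉ Ideal.span (r '' {q | o.lt p q})

/-- A system of monomials in a Noetherian local ring, no monomial of which lies in the ideal
generated by the monomials that are larger in some monomial order. -/
structure IsIndependentSystem {R C : Type*} [CommRing R] [IsLocalRing R] [CommMonoid C]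
    (r : C → R) : Prop extends IsMonomialSystem r where
  noetherian : IsNoetherianRing R
  fg : Monoid.FG C
  notMem : ∀ (o : MonomialWellOrder C) (p : C), r p ∉ Ideal.span (r '' {q | o.lt p q})

namespace IsIndependentSystem

open IsLocalRing

variable {R C : Type*} [CommRing R] [IsLocalRing R] [CommMonoid C] {r : C → R}

/-- A passage to the limit, needed because `p` may have no predecessor. Modulo `𝔪 ^ n` only finitely
many monomials below `p` survive; applying the hypothesis to the largest of them removes all of
them, and Krull's theorem concludes. -/
lemma mem_span_of_forall_lt (hr : IsIndependentSystem r) (o : MonomialWellOrder C) {K : Set C}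
    {f : R} (hf : f ∈ Ideal.span (r '' K)) {p : C}
    (h : ∀ q, o.lt q p → f ∈ Ideal.span (r '' {a | a ∈ K ∧ o.lt q a})) :
    f ∈ Ideal.span (r '' {a | a ∈ K ∧ o.le p a}) := by
  have := hr.noetherian
  refine mem_of_forall_mem_sup_pow fun n => ?_
  have key : ∀ L : Set C, L ⊆ K → f ∈ Ideal.span (r '' L) →
      (∀ a ∈ L, o.lt a p → r a ∈ maximalIdeal R ^ n) →
      f ∈ Ideal.span (r '' {a | a ∈ K ∧ o.le p a}) ⊔ maximalIdeal R ^ n := by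
    intro L hLK hfL hL
    refine (Ideal.span_le.2 ?_ : Ideal.span (r '' L) ≤ _) hfL
    rintro _ ⟨a, ha, rfl⟩
    by_cases hap : o.lt a p
    · exact Ideal.mem_sup_right (hL a ha hap)
    · exact Ideal.mem_sup_left (Ideal.subset_span ⟨a, ⟨hLK ha, hap⟩, rfl⟩)
  rcases ({a | r a ∈ maximalIdeal R ^ n}ᶜ ∩ {a | o.lt a p}).eq_empty_or_nonempty with hem | hne
  · refine key K subset_rfl hf fun a _ hap => ?_
    by_contra hcon
    exact (Set.eq_empty_iff_forall_notMem.1 hem a) ⟨hcon, hap⟩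
  · obtain ⟨q, hq, hmax⟩ := o.exists_max _ ((hr.finite_compl hr.fg n).inter_of_left _) hne
    refine key _ (fun a ha => ha.1) (h q hq.2) fun a ha hap => ?_
    by_contra hcon
    exact hmax a ⟨hcon, hap⟩ ha.2

/-- The initial monomial is the least `p` with `f` outside the ideal of monomials beyond `p`. Such
`p` exist because `f ∉ 𝔪 ^ n` for some `n`, and minimality puts `f` into the ideal of monomials from
`p` on. -/
lemma exists_isInitial (hr : IsIndependentSystem r) (o : MonomialWellOrder C) {f : R} (hf : f ≠ 0) :
    ∃ p, IsInitial r o f p := by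
  have := hr.noetherian
  have hne : {p | f ∉ Ideal.span (r '' {q | o.lt p q})}.Nonempty := by
    obtain ⟨n, hn⟩ : ∃ n, f ∉ maximalIdeal R ^ n := by
      by_contra! h
      exact hf (by simpa using mem_of_forall_mem_sup_pow (I := ⊥) fun n => Ideal.mem_sup_right (h n))
    rcases ({a | r a ∈ maximalIdeal R ^ n}ᶜ).eq_empty_or_nonempty with hem | hne
    · exfalso
      have h1 : r 1 ∈ maximalIdeal R ^ n := by
        by_contra h
        exact (Set.eq_empty_iff_forall_notMem.1 hem 1) h
      rw [Ideal.eq_top_of_isUnit_mem _ h1 hr.map_one] at hn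
      exact hn trivial
    · obtain ⟨p, -, hmax⟩ := o.exists_max _ (hr.finite_compl hr.fg n) hne
      refine ⟨p, fun h => hn ((Ideal.span_le.2 ?_ : Ideal.span _ ≤ maximalIdeal R ^ n) h)⟩
      rintro _ ⟨q, hq, rfl⟩
      by_contra hcon
      exact hmax q hcon hq
  let p := o.wf.min _ hne
  have hp : f ∉ Ideal.span (r '' {q | o.lt p q}) := o.wf.min_mem _ hne
  have h1 := hr.mem_span_of_forall_lt o (K := Set.univ) (f := f) (p := p) (by
      rw [Ideal.eq_top_of_isUnit_mem (Ideal.span (r '' Set.univ))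
        (Ideal.subset_span (Set.mem_image_of_mem r (Set.mem_univ 1))) hr.map_one]
      trivial) fun q hq => by
    by_contra hcon
    refine o.wf.not_lt_min _ (x := q) ?_ hq
    simpa using hcon
  exact ⟨p, by simpa using h1, hp⟩

omit [IsLocalRing R] in
lemma mem_span_le_iff (o : MonomialWellOrder C) (p : C) {f : R} :
    f ∈ Ideal.span (r '' {q | o.le p q}) ↔
      ∃ c, ∃ g ∈ Ideal.span (r '' {q | o.lt p q}), f = c * r p + g := by
  have : {q | o.le p q} = insert p {q | o.lt p q} := by
    ext q
    simp only [Set.mem_ofPred_eq, Set.mem_insert_iff, o.le_iff]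
    tauto
  rw [this, Set.image_insert_eq, Ideal.mem_span_insert]

lemma mul_mem_span (hr : IsIndependentSystem r) {K : Set C} (q : C)
    (hK : ∀ b, b ≠ 1 → q * b ∈ K) {c : R} (hc : c ∈ maximalIdeal R) :
    c * r q ∈ Ideal.span (r '' K) := by
  have hle : maximalIdeal R ≤
      (Submodule.comap (LinearMap.mulRight R (r q)) (Ideal.span (r '' K)) : Ideal R) := by
    rw [← hr.span_eq, Ideal.span_le]
    rintro _ ⟨b, hb, rfl⟩
    show r b * r q ∈ Ideal.span (r '' K)
    obtain ⟨u, hu⟩ := hr.map_mul b q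
    rw [← hu, mul_comm b]
    exact Ideal.mul_mem_right _ _ (Ideal.subset_span ⟨_, hK b hb, rfl⟩)
  exact hle hc

/-- Leading coefficients are units: a nonunit coefficient pushes its monomial into the ideal of
larger ones. Conversely, independence prevents a monomial with unit coefficient from being absorbed.
-/
lemma isInitial_iff (hr : IsIndependentSystem r) (o : MonomialWellOrder C) {f : R} {p : C} :
    IsInitial r o f p ↔
      ∃ c, IsUnit c ∧ ∃ g ∈ Ideal.span (r '' {q | o.lt p q}), f = c * r p + g := by
  rw [IsInitial, mem_span_le_iff o]
  constructor
  · rintro ⟨⟨c, g, hg, rfl⟩, h⟩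
    refine ⟨c, ?_, g, hg, rfl⟩
    by_contra hc
    exact h (add_mem (hr.mul_mem_span p (fun b hb => o.lt_mul p hb)
      ((mem_maximalIdeal c).2 hc)) hg)
  · rintro ⟨c, hc, g, hg, rfl⟩
    refine ⟨⟨c, g, hg, rfl⟩, fun h => hr.notMem o p ?_⟩
    have h1 := sub_mem h hg
    rw [add_sub_cancel_right] at h1
    exact (Ideal.unit_mul_mem_iff_mem _ hc).1 h1

lemma isInitial_rep (hr : IsIndependentSystem r) (o : MonomialWellOrder C) (p : C) :
    IsInitial r o (r p) p :=
  (hr.isInitial_iff o).2 ⟨1, isUnit_one, 0, zero_mem _, by simp⟩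

omit [IsLocalRing R] in
lemma IsInitial.le {o : MonomialWellOrder C} {f : R} {p q : C} (hf : IsInitial r o f p)
    (h : f ∈ Ideal.span (r '' {a | o.le q a})) : o.le q p := fun hlt =>
  hf.2 (Ideal.span_mono (Set.image_mono fun _ ha => o.lt_of_lt_of_le hlt ha) h)

/-- The initial monomial of an element of a monomial ideal lies in this ideal. -/
lemma isInitial_mem (hr : IsIndependentSystem r) (o : MonomialWellOrder C) {f : R} {p : C}
    (hf : IsInitial r o f p) {K : Set C} (hK : ∀ a ∈ K, ∀ b, a * b ∈ K)
    (hfK : f ∈ Ideal.span (r '' K)) : p ∈ K := by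
  by_contra hpK
  -- Adding the tail of `f` to the monomial ideal reduces the claim to the single monomial `r p`,
  -- which lies in the ideal of `L`.
  let L : Set C := K ∪ {a | o.lt p a}
  have hL : ∀ a ∈ L, ∀ b, a * b ∈ L := by
    rintro a (ha | ha) b
    · exact .inl (hK a ha b)
    · exact .inr (o.lt_of_lt_of_le ha (o.le_mul a b))
  have hpL : r p ∈ Ideal.span (r '' L) := by
    obtain ⟨c, hc, g, hg, rfl⟩ := (hr.isInitial_iff o).1 hf
    have h1 : c * r p + g ∈ Ideal.span (r '' L) :=
      Ideal.span_mono (Set.image_mono Set.subset_union_left) hfK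
    have h2 : g ∈ Ideal.span (r '' L) :=
      Ideal.span_mono (Set.image_mono Set.subset_union_right) hg
    have h3 := sub_mem h1 h2
    rw [add_sub_cancel_right] at h3
    exact (Ideal.unit_mul_mem_iff_mem _ hc).1 h3
  -- Well-founded induction removes all elements of `L` below `p` from the expression of `r p`. At
  -- `q = p` only monomials strictly beyond `p` are left, as `p ∉ K`, against independence.
  have key : ∀ q, o.le q p → r p ∈ Ideal.span (r '' {a | a ∈ L ∧ o.le q a}) := by
    intro q
    induction q using o.wf.induction with
    | _ q ih =>
    intro hqp
    refine hr.mem_span_of_forall_lt o hpL fun q' hq' => ?_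
    have hq'p := o.lt_of_lt_of_le hq' hqp
    have h1 := ih q' hq' (o.le_of_lt hq'p)
    by_cases hq'L : q' ∈ L
    · have h2 : {a | a ∈ L ∧ o.le q' a} = insert q' {a | a ∈ L ∧ o.lt q' a} := by
        ext a
        simp only [Set.mem_ofPred_eq, Set.mem_insert_iff, o.le_iff]
        constructor
        · rintro ⟨h, h' | rfl⟩
          exacts [.inr ⟨h, h'⟩, .inl rfl]
        · rintro (rfl | h)
          exacts [⟨hq'L, .inr rfl⟩, ⟨h.1, .inl h.2⟩]
      rw [h2, Set.image_insert_eq, Ideal.mem_span_insert] at h1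
      obtain ⟨c, g, hg, hcg⟩ := h1
      rw [hcg]
      -- The coefficient of `r q'` is not a unit: otherwise `r q'` would lie in the ideal of
      -- monomials beyond `q'`, since `r p` and all remaining terms do. A nonunit coefficient moves
      -- this term into that ideal too.
      refine add_mem (hr.mul_mem_span (K := {a | a ∈ L ∧ o.lt q' a}) q'
        (fun b hb => ⟨hL _ hq'L b, o.lt_mul q' hb⟩) ?_) hg
      rw [mem_maximalIdeal]
      intro hc
      refine hr.notMem o q' ((Ideal.unit_mul_mem_iff_mem (Ideal.span (r '' {a | o.lt q' a})) hc).1 ?_)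
      rw [← sub_eq_iff_eq_add] at hcg
      rw [← hcg]
      exact sub_mem (Ideal.subset_span (Set.mem_image_of_mem r hq'p))
        (Ideal.span_mono (Set.image_mono fun a ha => ha.2) hg)
    · refine Ideal.span_mono (Set.image_mono ?_) h1
      rintro a ⟨ha, ha'⟩
      refine ⟨ha, ?_⟩
      rcases o.le_iff.1 ha' with h | rfl
      exacts [h, absurd ha hq'L]
  refine hr.notMem o p (Ideal.span_mono (Set.image_mono ?_) (key p o.le_rfl))
  rintro a ⟨ha | ha, ha'⟩
  · rcases o.le_iff.1 ha' with h | rfl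
    exacts [h, absurd ha hpK]
  · exact ha

lemma span_mul_mem (hr : IsIndependentSystem r) {K L N : Set C} (h : ∀ a ∈ K, ∀ b ∈ L, a * b ∈ N)
    {f g : R} (hf : f ∈ Ideal.span (r '' K)) (hg : g ∈ Ideal.span (r '' L)) :
    f * g ∈ Ideal.span (r '' N) := by
  have h1 : f * g ∈ Ideal.span (r '' K) * Ideal.span (r '' L) := Ideal.mul_mem_mul hf hg
  refine (?_ : Ideal.span (r '' K) * Ideal.span (r '' L) ≤ _) h1
  rw [Ideal.span_mul_span', Ideal.span_le]
  rintro _ ⟨_, ⟨a, ha, rfl⟩, _, ⟨b, hb, rfl⟩, rfl⟩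
  obtain ⟨u, hu⟩ := hr.map_mul a b
  show r a * r b ∈ Ideal.span (r '' N)
  rw [← hu]
  exact Ideal.mul_mem_right _ _ (Ideal.subset_span ⟨_, h a ha b hb, rfl⟩)

/-- The leading terms multiply to a unit times the monomial of `p * q`, and every other product is
strictly larger by cancellation in the order. This is the multiplicativity of the monomial
valuation. -/
lemma isInitial_mul (hr : IsIndependentSystem r) (o : MonomialWellOrder C) {f g : R} {p q : C}
    (hf : IsInitial r o f p) (hg : IsInitial r o g q) : IsInitial r o (f * g) (p * q) := by
  obtain ⟨c, hc, f', hf', rfl⟩ := (hr.isInitial_iff o).1 hf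
  obtain ⟨d, hd, g', hg', rfl⟩ := (hr.isInitial_iff o).1 hg
  obtain ⟨u, hu⟩ := hr.map_mul p q
  refine (hr.isInitial_iff o).2 ⟨c * d * u, (hc.mul hd).mul u.isUnit,
    c * r p * g' + f' * (d * r q + g'), ?_, ?_⟩
  · refine add_mem (hr.span_mul_mem (K := {a | o.le p a}) (L := {a | o.lt q a}) ?_ ?_ hg')
      (hr.span_mul_mem (L := {a | o.le q a}) (K := {a | o.lt p a}) ?_ hf' hg.1)
    · intro a ha b hb
      rw [mul_comm p, mul_comm a]
      exact o.lt_mul_mul_of_lt_of_le hb ha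
    · exact Ideal.mul_mem_left _ _ (Ideal.subset_span ⟨p, o.le_rfl, rfl⟩)
    · exact fun a ha b hb => o.lt_mul_mul_of_lt_of_le ha hb
  · linear_combination (-c * d) * hu

omit [IsLocalRing R] in
lemma isInitial_ne_zero {o : MonomialWellOrder C} {f : R} {p : C}
    (hf : IsInitial r o f p) : f ≠ 0 := by
  rintro rfl
  exact hf.2 (zero_mem _)

omit [IsLocalRing R] in
lemma isInitial_unique {o : MonomialWellOrder C} {f : R} {p q : C}
    (hf : IsInitial r o f p) (hf' : IsInitial r o f q) : p = q := by
  have h1 := IsInitial.le hf hf'.1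
  have h2 := IsInitial.le hf' hf.1
  rcases o.le_iff.1 h2 with h | h
  exacts [absurd h h1, h]

end IsIndependentSystem

/-- The function `t ↦ exp (-t)`. -/
def expNeg (t : ℝ≥0) : ℝ≥0 := ⟨Real.exp (-t), (Real.exp_pos _).le⟩

lemma coe_expNeg (t : ℝ≥0) : (expNeg t : ℝ) = Real.exp (-t) := rfl

lemma expNeg_zero : expNeg 0 = 1 := by ext; simp [coe_expNeg]

lemma expNeg_add (s t : ℝ≥0) : expNeg (s + t) = expNeg s * expNeg t := by
  ext
  rw [NNReal.coe_mul, coe_expNeg, coe_expNeg, coe_expNeg, ← Real.exp_add, NNReal.coe_add, neg_add]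

lemma expNeg_le {s t : ℝ≥0} : expNeg s ≤ expNeg t ↔ t ≤ s := by
  rw [← NNReal.coe_le_coe]
  simp [coe_expNeg]

lemma expNeg_injective : Function.Injective expNeg := fun _ _ h =>
  le_antisymm (expNeg_le.1 h.ge) (expNeg_le.1 h.le)

lemma expNeg_pos (t : ℝ≥0) : 0 < expNeg t := Real.exp_pos _

lemma expNeg_le_one (t : ℝ≥0) : expNeg t ≤ 1 := by
  rw [← expNeg_zero, expNeg_le]
  exact zero_le

lemma continuous_expNeg : Continuous expNeg :=
  Continuous.subtype_mk (Real.continuous_exp.comp NNReal.continuous_coe.neg) _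

/-- `w` is bounded by `1` and given by `exp (-α)` on the monomials. -/
def IsMonomialExtension {R C : Type*} [CommRing R] [CommMonoid C] (r : C → R)
    (α : C →* Multiplicative ℝ≥0) (w : Valuation R ℝ≥0) : Prop :=
  (∀ f, w f ≤ 1) ∧ ∀ c, w (r c) = expNeg (α c).toAdd

lemma IsMonomialExtension.le_of_mem_span {R C : Type*} [CommRing R] [CommMonoid C] {r : C → R}
    {α : C →* Multiplicative ℝ≥0} {w : Valuation R ℝ≥0} (hw : IsMonomialExtension r α w)
    {K : Set C} {t : ℝ≥0} (hK : ∀ c ∈ K, expNeg (α c).toAdd ≤ t) {f : R}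
    (hf : f ∈ Ideal.span (r '' K)) : w f ≤ t := by
  induction hf using Submodule.span_induction with
  | mem x h =>
    obtain ⟨c, hc, rfl⟩ := h
    rw [hw.2]
    exact hK c hc
  | zero => simp
  | add x y _ _ hx hy => exact (w.map_add x y).trans (max_le hx hy)
  | smul a x _ hx =>
    rw [smul_eq_mul, map_mul]
    exact (mul_le_of_le_one_left zero_le (hw.1 a)).trans hx

namespace IsIndependentSystem

open IsLocalRing

variable {R C : Type*} [CommRing R] [IsLocalRing R] [CommMonoid C] {r : C → R}

lemma isInitial_one (hr : IsIndependentSystem r) (o : MonomialWellOrder C) :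
    IsInitial r o 1 1 := by
  obtain ⟨u, hu⟩ := hr.map_one
  exact (hr.isInitial_iff o).2 ⟨↑u⁻¹, u⁻¹.isUnit, 0, zero_mem _, by rw [← hu]; simp⟩

open Classical in
/-- The monomial valuation `f ↦ exp (-α (in f))`. -/
def valuation (hr : IsIndependentSystem r) (o : MonomialWellOrder C)
    (α : C →* Multiplicative ℝ≥0) (hα : ∀ a b, o.le a b → (α a).toAdd ≤ (α b).toAdd) :
    Valuation R ℝ≥0 where
  toFun f := if hf : f = 0 then 0 else expNeg (α (hr.exists_isInitial o hf).choose).toAdd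
  map_zero' := by simp
  map_one' := by
    have h0 : (1 : R) ≠ 0 := one_ne_zero
    rw [dif_neg h0, isInitial_unique (hr.exists_isInitial o h0).choose_spec (hr.isInitial_one o)]
    simp [expNeg_zero]
  map_mul' f g := by
    by_cases hf : f = 0
    · simp [hf]
    by_cases hg : g = 0
    · simp [hg]
    have h1 := (hr.exists_isInitial o hf).choose_spec
    have h2 := (hr.exists_isInitial o hg).choose_spec
    have h3 := hr.isInitial_mul o h1 h2
    have hfg := isInitial_ne_zero h3
    rw [dif_neg hf, dif_neg hg, dif_neg hfg,
      isInitial_unique (hr.exists_isInitial o hfg).choose_spec h3, map_mul, toAdd_mul, expNeg_add]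
  map_add_le_max' f g := by
    by_cases hf : f = 0
    · simp [hf]
    by_cases hg : g = 0
    · simp [hg]
    by_cases hfg : f + g = 0
    · simp [hfg]
    rw [dif_neg hf, dif_neg hg, dif_neg hfg]
    have h1 := (hr.exists_isInitial o hf).choose_spec
    have h2 := (hr.exists_isInitial o hg).choose_spec
    have h3 := (hr.exists_isInitial o hfg).choose_spec
    have mono : ∀ {a b}, o.le a b → Ideal.span (r '' {q | o.le b q}) ≤
      Ideal.span (r '' {q | o.le a q}) := fun h =>
        Ideal.span_mono (Set.image_mono fun _ hq => o.le_trans h hq)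
    rw [le_max_iff, expNeg_le, expNeg_le]
    rcases o.le_total (hr.exists_isInitial o hf).choose (hr.exists_isInitial o hg).choose with h | h
    · exact .inl (hα _ _ (IsInitial.le h3 (add_mem h1.1 (mono h h2.1))))
    · exact .inr (hα _ _ (IsInitial.le h3 (add_mem (mono h h1.1) h2.1)))

lemma valuation_of_isInitial (hr : IsIndependentSystem r) (o : MonomialWellOrder C)
    (α : C →* Multiplicative ℝ≥0) (hα : ∀ a b, o.le a b → (α a).toAdd ≤ (α b).toAdd)
    {f : R} {p : C} (hf : IsInitial r o f p) : hr.valuation o α hα f = expNeg (α p).toAdd := by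
  have h0 := isInitial_ne_zero hf
  classical
  show (if hf : f = 0 then 0 else expNeg (α (hr.exists_isInitial o hf).choose).toAdd) = _
  rw [dif_neg h0, isInitial_unique (hr.exists_isInitial o h0).choose_spec hf]

lemma isMonomialExtension_valuation (hr : IsIndependentSystem r) (o : MonomialWellOrder C)
    (α : C →* Multiplicative ℝ≥0) (hα : ∀ a b, o.le a b → (α a).toAdd ≤ (α b).toAdd) :
    IsMonomialExtension r α (hr.valuation o α hα) := by
  refine ⟨fun f => ?_, fun c => hr.valuation_of_isInitial o α hα (hr.isInitial_rep o c)⟩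
  by_cases hf : f = 0
  · simp [hf]
  · obtain ⟨p, hp⟩ := hr.exists_isInitial o hf
    rw [hr.valuation_of_isInitial o α hα hp]
    exact expNeg_le_one _

/-- `f` lies in the ideal of monomials from `in f` on; any extension is at most `exp (-α (in f))` on
those, hence on `f` by the ultrametric inequality. So the monomial valuation is maximal, and in
particular independent of the chosen order. -/
lemma le_valuation (hr : IsIndependentSystem r) (o : MonomialWellOrder C)
    (α : C →* Multiplicative ℝ≥0) (hα : ∀ a b, o.le a b → (α a).toAdd ≤ (α b).toAdd)
    {w : Valuation R ℝ≥0} (hw : IsMonomialExtension r α w) (f : R) : w f ≤ hr.valuation o α hα f := by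
  by_cases hf : f = 0
  · simp [hf]
  · obtain ⟨p, hp⟩ := hr.exists_isInitial o hf
    rw [hr.valuation_of_isInitial o α hα hp]
    exact hw.le_of_mem_span (fun c hc => expNeg_le.2 (hα _ _ hc)) hp.1

/-- The maximal extension of `exp (-α)`. -/
def IsMaximalExtension (r : C → R) (α : C →* Multiplicative ℝ≥0) (w : Valuation R ℝ≥0) : Prop :=
  IsMonomialExtension r α w ∧ ∀ w', IsMonomialExtension r α w' → ∀ f, w' f ≤ w f

omit [IsLocalRing R] in
lemma IsMaximalExtension.unique {α : C →* Multiplicative ℝ≥0} {w w' : Valuation R ℝ≥0}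
    (h : IsMaximalExtension r α w) (h' : IsMaximalExtension r α w') : w = w' :=
  Valuation.ext fun f => le_antisymm (h'.2 w h.1 f) (h.2 w' h'.1 f)

lemma isMaximalExtension_valuation (hr : IsIndependentSystem r) (o : MonomialWellOrder C)
    (α : C →* Multiplicative ℝ≥0) (hα : ∀ a b, o.le a b → (α a).toAdd ≤ (α b).toAdd) :
    IsMaximalExtension r α (hr.valuation o α hα) :=
  ⟨hr.isMonomialExtension_valuation o α hα, fun _ hw f => hr.le_valuation o α hα hw f⟩

/-- By uniqueness of the maximal extension, the formula by initial monomials is available for every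
order along which `α` is monotone, not just for one used in the construction. -/
lemma IsMaximalExtension.apply_of_isInitial (hr : IsIndependentSystem r) {o : MonomialWellOrder C}
    {α : C →* Multiplicative ℝ≥0} (hα : ∀ a b, o.le a b → (α a).toAdd ≤ (α b).toAdd)
    {w : Valuation R ℝ≥0} (h : IsMaximalExtension r α w) {f : R} {p : C}
    (hf : IsInitial r o f p) : w f = expNeg (α p).toAdd := by
  rw [h.unique (hr.isMaximalExtension_valuation o α hα), hr.valuation_of_isInitial o α hα hf]

end IsIndependentSystem

/-! ### Positivity and continuity of monomial valuations. -/

section Continuity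

open IsLocalRing IsIndependentSystem Filter Topology

variable {R : Type*} {C : Type u} [CommRing R] [IsLocalRing R] [CommMonoid C] {r : C → R}

lemma IsIndependentSystem.pos_of_ne_zero (hr : IsIndependentSystem r) (hC : IsFsMonoid C)
    (hs : IsSharp C) {α : C →* Multiplicative ℝ≥0} {w : Valuation R ℝ≥0}
    (h : IsMaximalExtension r α w) {f : R} (hf : f ≠ 0) : 0 < w f := by
  obtain ⟨o, ho⟩ := exists_monomialOrder hC hs α
  obtain ⟨p, hp⟩ := hr.exists_isInitial o hf
  rw [h.apply_of_isInitial hr ho hp]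
  exact expNeg_pos _

/-- `{w < 1}` is generated by monomials. -/
lemma IsIndependentSystem.mem_span_of_lt_one (hr : IsIndependentSystem r) (hC : IsFsMonoid C)
    (hs : IsSharp C) {α : C →* Multiplicative ℝ≥0} {w : Valuation R ℝ≥0}
    (h : IsMaximalExtension r α w) {f : R} (hf : w f < 1) :
    f ∈ Ideal.span (r '' {c | w (r c) < 1}) := by
  by_cases h0 : f = 0
  · rw [h0]; exact zero_mem _
  obtain ⟨o, ho⟩ := exists_monomialOrder hC hs α
  obtain ⟨p, hp⟩ := hr.exists_isInitial o h0
  rw [h.apply_of_isInitial hr ho hp] at hf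
  refine Ideal.span_mono (Set.image_mono fun c hc => ?_) hp.1
  show w (r c) < 1
  rw [h.1.2]
  exact (expNeg_le.2 (ho _ _ hc)).trans_lt hf

/-- The monomial valuations depend continuously on the weights. -/
theorem IsIndependentSystem.continuous_apply (hr : IsIndependentSystem r) (hC : IsFsMonoid C)
    (hs : IsSharp C) {A : Type*} [TopologicalSpace A] (α : A → C →* Multiplicative ℝ≥0)
    (hα : ∀ c, Continuous fun a => (α a c).toAdd) (w : A → Valuation R ℝ≥0)
    (hw : ∀ a, IsMaximalExtension r (α a) (w a)) (f : R) : Continuous fun a => w a f := by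
  by_cases h0 : f = 0
  · simpa [h0] using continuous_const
  rw [continuous_iff_continuousAt]
  intro a₀
  obtain ⟨o, ho⟩ := exists_monomialOrder hC hs (α a₀)
  obtain ⟨p, hp⟩ := hr.exists_isInitial o h0
  have hw₀ := (hw a₀).apply_of_isInitial hr ho hp
  -- For a nearby weight the order, and with it the initial monomial `p'`, may change. Still `f`
  -- lies in the monomial ideal of elements from `p'` on in the new order, hence so does its old
  -- initial monomial `p`, and the new weight of `p` is at least that of `p'`.
  have lower : ∀ a, expNeg (α a p).toAdd ≤ w a f := by
    intro a
    obtain ⟨o', ho'⟩ := exists_monomialOrder hC hs (α a)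
    obtain ⟨p', hp'⟩ := hr.exists_isInitial o' h0
    rw [(hw a).apply_of_isInitial hr ho' hp', expNeg_le]
    refine ho' _ _ (hr.isInitial_mem o hp (K := {q | o'.le p' q}) ?_ hp'.1)
    exact fun a ha b => o'.le_trans ha (o'.le_mul a b)
  -- Finitely many monomials suffice to express `f`, which gives an upper bound by a finite
  -- supremum. At `a₀` both bounds equal the value for `p`, so the value at `f` is squeezed.
  obtain ⟨S, hS, hfS⟩ : ∃ S : Finset C, (∀ q ∈ S, o.le p q) ∧ f ∈ Ideal.span (r '' (S : Set C)) := by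
    classical
    obtain ⟨T, hT, hfT⟩ := Submodule.mem_span_finite_of_mem_span hp.1
    obtain ⟨S, hS, rfl⟩ := Finset.subset_set_image_iff.1 hT
    exact ⟨S, fun q hq => hS hq, by rwa [Finset.coe_image] at hfT⟩
  have cont : ∀ q, Continuous fun a => expNeg (α a q).toAdd := fun q => continuous_expNeg.comp (hα q)
  refine tendsto_of_tendsto_of_tendsto_of_le_of_le
    (g := fun a => expNeg (α a p).toAdd)
    (h := fun a => max (expNeg (α a p).toAdd) (S.sup fun q => expNeg (α a q).toAdd))
    ?_ ?_ lower ?_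
  · show Tendsto _ _ (𝓝 (w a₀ f))
    rw [hw₀]
    exact (cont p).tendsto a₀
  · have h1 : w a₀ f = max (expNeg (α a₀ p).toAdd) (S.sup fun q => expNeg (α a₀ q).toAdd) := by
      rw [hw₀]
      refine (max_eq_left (Finset.sup_le fun q hq => expNeg_le.2 (ho _ _ (hS q hq)))).symm
    show Tendsto _ _ (𝓝 (w a₀ f))
    rw [h1]
    exact ((cont p).max (Continuous.finset_sup_apply fun q _ => cont q)).tendsto a₀
  · intro a
    refine le_max_of_le_right ((hw a).1.le_of_mem_span (fun c hc => ?_) hfS)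
    exact Finset.le_sup (f := fun q => expNeg (α a q).toAdd) hc

end Continuity

/-! ## Generizations and stalks -/

section Generization

variable {X : Scheme.{u}}

lemma exists_section_fraction {U : X.Opens} (hU : IsAffineOpen U) {y : X} (hy : y ∈ U)
    (f : X.presheaf.stalk y) : ∃ a s : Γ(X, U), IsUnit (X.presheaf.germ U y hy s) ∧
      f * X.presheaf.germ U y hy s = X.presheaf.germ U y hy a := by
  let := X.presheaf.algebra_section_stalk ⟨y, hy⟩
  have := hU.isLocalization_stalk ⟨y, hy⟩
  obtain ⟨⟨a, s⟩, h⟩ := IsLocalization.surj (hU.primeIdealOf ⟨y, hy⟩).asIdeal.primeCompl f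
  exact ⟨a, s, IsLocalization.map_units (X.presheaf.stalk y) s, h⟩

lemma exists_mul_eq_zero_of_germ_eq_zero {U : X.Opens} (hU : IsAffineOpen U) {y : X} (hy : y ∈ U)
    {a : Γ(X, U)} (ha : X.presheaf.germ U y hy a = 0) :
    ∃ s : Γ(X, U), IsUnit (X.presheaf.germ U y hy s) ∧ s * a = 0 := by
  let := X.presheaf.algebra_section_stalk ⟨y, hy⟩
  have := hU.isLocalization_stalk ⟨y, hy⟩
  obtain ⟨s, hs⟩ := (IsLocalization.map_eq_zero_iff (hU.primeIdealOf ⟨y, hy⟩).asIdeal.primeCompl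
    (X.presheaf.stalk y) a).1 ha
  exact ⟨s, IsLocalization.map_units (X.presheaf.stalk y) s, hs⟩

/-- The local ring at a generization `y` is a localization of the local ring at `x`; elements of the
prime are recognised as those that do not become units at `y`. -/
lemma exists_fraction {x y : X} (h : y ⤳ x) (f : X.presheaf.stalk y) :
    ∃ a s : X.presheaf.stalk x, IsUnit (X.presheaf.stalkSpecializes h s) ∧
      f * X.presheaf.stalkSpecializes h s = X.presheaf.stalkSpecializes h a := by
  obtain ⟨U, hU, hx, -⟩ := exists_isAffineOpen_mem_and_subset (X := X) (x := x) (U := ⊤) trivial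
  obtain ⟨a, s, hs, e⟩ := exists_section_fraction hU (h.mem_open U.isOpen hx) f
  refine ⟨X.presheaf.germ U x hx a, X.presheaf.germ U x hx s, ?_, ?_⟩
  · rwa [X.presheaf.germ_stalkSpecializes_apply hx h]
  · rwa [X.presheaf.germ_stalkSpecializes_apply hx h, X.presheaf.germ_stalkSpecializes_apply hx h]

lemma exists_mul_eq_zero {x y : X} (h : y ⤳ x) {f : X.presheaf.stalk x}
    (hf : X.presheaf.stalkSpecializes h f = 0) :
    ∃ s : X.presheaf.stalk x, IsUnit (X.presheaf.stalkSpecializes h s) ∧ s * f = 0 := by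
  obtain ⟨U, hU, hx, -⟩ := exists_isAffineOpen_mem_and_subset (X := X) (x := x) (U := ⊤) trivial
  obtain ⟨a, s, hs, e⟩ := exists_section_fraction hU hx f
  have ha : X.presheaf.germ U y (h.mem_open U.isOpen hx) a = 0 := by
    rw [← X.presheaf.germ_stalkSpecializes_apply hx h, ← e, map_mul, hf, zero_mul]
  obtain ⟨t, ht, e'⟩ := exists_mul_eq_zero_of_germ_eq_zero hU _ ha
  refine ⟨X.presheaf.germ U x hx t, by rwa [X.presheaf.germ_stalkSpecializes_apply hx h], ?_⟩
  refine hs.mul_right_cancel ?_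
  rw [mul_assoc, e, ← map_mul, e', map_zero, zero_mul]

lemma fromSpecStalk_comap_closedPoint {x y : X} (h : y ⤳ x) :
    X.fromSpecStalk x (PrimeSpectrum.comap (X.presheaf.stalkSpecializes h).hom
      (IsLocalRing.closedPoint (X.presheaf.stalk y))) = y := by
  have h1 := congr($(Scheme.SpecMap_stalkSpecializes_fromSpecStalk h)
    (IsLocalRing.closedPoint (X.presheaf.stalk y)))
  rw [Scheme.fromSpecStalk_closedPoint] at h1
  exact h1

/-- The primes of a local ring are the generizations of the point. Describing the prime by nonunits
avoids identifying residue fields or localizations. -/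
lemma exists_generization {x : X} (p : Ideal (X.presheaf.stalk x)) [hp : p.IsPrime] :
    ∃ (y : X) (h : y ⤳ x), ∀ f, f ∈ p ↔ ¬ IsUnit (X.presheaf.stalkSpecializes h f) := by
  have hy : X.fromSpecStalk x ⟨p, hp⟩ ⤳ x := by
    have : X.fromSpecStalk x ⟨p, hp⟩ ∈ Set.range (X.fromSpecStalk x) := ⟨_, rfl⟩
    rwa [Scheme.range_fromSpecStalk] at this
  refine ⟨_, hy, fun f => ?_⟩
  have h1 := fromSpecStalk_comap_closedPoint hy
  have h2 := (X.fromSpecStalk x).isEmbedding.injective h1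
  have h3 : f ∈ p ↔ f ∈ (PrimeSpectrum.comap (X.presheaf.stalkSpecializes hy).hom
      (IsLocalRing.closedPoint _)).asIdeal := by rw [h2]
  rw [h3]
  exact IsLocalRing.mem_maximalIdeal _

lemma specializes_of_forall_not_isUnit {x y z : X} (hy : y ⤳ x) (hz : z ⤳ x)
    (h : ∀ f, ¬ IsUnit (X.presheaf.stalkSpecializes hz f) →
      ¬ IsUnit (X.presheaf.stalkSpecializes hy f)) : z ⤳ y := by
  rw [← fromSpecStalk_comap_closedPoint hy, ← fromSpecStalk_comap_closedPoint hz]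
  refine Specializes.map ?_ (X.fromSpecStalk x).continuous
  refine (PrimeSpectrum.le_iff_specializes _ _).1 ?_
  intro f hf
  exact (IsLocalRing.mem_maximalIdeal _).2 (h f ((IsLocalRing.mem_maximalIdeal _).1 hf))

end Generization

/-! ## Stalks of log structures -/

/-- The group of fractions is finitely generated and, by saturation and sharpness, torsion-free;
hence it is free of finite rank. -/
lemma IsFsMonoid.exists_embedding {C : Type u} [CommMonoid C] (hC : IsFsMonoid C) (hs : IsSharp C) :
    ∃ ι : C →* Multiplicative (Fin (Module.finrank ℤ (Additive (Algebra.GrothendieckGroup C))) → ℤ),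
      Function.Injective ι := by
  have := hC.cancel
  have := hC.fg
  let G := Algebra.GrothendieckGroup C
  have hfg : Monoid.FG G := inferInstance
  have : IsMulTorsionFree G := ⟨fun n hn a b hab => by
    have h : (a / b) ^ n = 1 := by
      simp only at hab
      rw [div_pow, hab, div_self']
    exact div_eq_one.1 (hC.group_torsionFree hs _ n (Nat.pos_of_ne_zero hn) h)⟩
  have : AddMonoid.FG (Additive G) := AddMonoid.fg_iff_mul_fg.2 hfg
  have : Module.Finite ℤ (Additive G) :=
    Module.Finite.iff_addGroup_fg.2 (AddGroup.fg_iff_addMonoid_fg.2 this)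
  have : Module.Free ℤ (Additive G) := inferInstance
  let b := Module.finBasis ℤ (Additive G)
  refine ⟨(AddMonoidHom.toMultiplicativeRight b.equivFun.toLinearMap.toAddMonoidHom).comp
    Algebra.GrothendieckGroup.of, ?_⟩
  intro x y hxy
  refine Algebra.GrothendieckGroup.of_injective ?_
  have := b.equivFun.injective (Multiplicative.ofAdd.injective hxy)
  exact Additive.ofMul.injective this

lemma isSharp_associates (M : Type*) [CommMonoid M] : IsSharp (Associates M) := by
  intro a b h
  have := IsUnit.of_mul_eq_one b h
  obtain ⟨u, rfl⟩ := this
  exact congrArg Units.val (Subsingleton.elim u 1)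

/-- A chart-independent criterion for an independent system. -/
lemma IsMonomialSystem.isIndependentSystem {R : Type*} {C : Type u} [CommRing R] [IsLocalRing R]
    [IsNoetherianRing R] [CommMonoid C] {r : C → R} (hr : IsMonomialSystem r) (hC : IsFsMonoid C)
    (hs : IsSharp C)
    (hdim : ((Module.finrank ℤ (Additive (Algebra.GrothendieckGroup C)) : ℕ) : WithBot ℕ∞) ≤
      ringKrullDim R) : IsIndependentSystem r where
  toIsMonomialSystem := hr
  noetherian := inferInstance
  fg := hC.fg
  notMem o p := by
    obtain ⟨ι, hι⟩ := hC.exists_embedding hs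
    exact hr.notMem_span hC.fg ι hι (by simpa using hdim) o p

namespace LogStructure

variable {X : Scheme.{u}} (M : LogStructure X)

lemma germ_mem_stalk {U : X.Opens} {s : Γ(X, U)} (hs : s ∈ M.sections U) {x : X} (hx : x ∈ U) :
    X.presheaf.germ U x hx s ∈ M.stalk x :=
  ⟨U, hx, s, hs, rfl⟩

lemma mem_sections_iff {U : X.Opens} {s : Γ(X, U)} :
    s ∈ M.sections U ↔ ∀ (x : X) (hx : x ∈ U), X.presheaf.germ U x hx s ∈ M.stalk x := by
  refine ⟨fun hs x hx => M.germ_mem_stalk hs hx, fun h => M.mem_of_local U s fun x hx => ?_⟩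
  obtain ⟨V, hV, t, ht, e⟩ := h x hx
  obtain ⟨W, hW, iV, iU, e'⟩ := X.presheaf.germ_eq x hV hx t s e
  refine ⟨W, iU.le, hW, ?_⟩
  rw [show (homOfLE iU.le) = iU from rfl, ← e']
  exact M.res_mem _ _ iV.le _ ht

lemma mem_stalk_of_isUnit {x : X} {f : X.presheaf.stalk x} (hf : IsUnit f) : f ∈ M.stalk x := by
  obtain ⟨U, hx, s, rfl⟩ := X.presheaf.exists_germ_eq f
  obtain ⟨V, i, hV, h⟩ := X.toLocallyRingedSpace.toRingedSpace.isUnit_res_of_isUnit_germ U s x hx hf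
  exact ⟨V, hV, X.presheaf.map i.op s, M.unit_mem _ _ h, X.presheaf.germ_res_apply i x hV s⟩

lemma isUnit_iff {x : X} {m : M.stalk x} : IsUnit m ↔ IsUnit (m : X.presheaf.stalk x) := by
  refine ⟨fun h => h.map (M.stalk x).subtype, fun h => ?_⟩
  obtain ⟨u, hu⟩ := h
  refine IsUnit.of_mul_eq_one ⟨↑u⁻¹, M.mem_stalk_of_isUnit u⁻¹.isUnit⟩ (Subtype.ext ?_)
  simp [← hu]

lemma associated_iff {x : X} {m n : M.stalk x} :
    Associated m n ↔ Associated (m : X.presheaf.stalk x) n := by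
  refine ⟨fun h => h.map (M.stalk x).subtype, fun ⟨u, hu⟩ => ?_⟩
  obtain ⟨v, hv⟩ := (M.isUnit_iff (m := (⟨u, M.mem_stalk_of_isUnit u.isUnit⟩ : M.stalk x))).2 u.isUnit
  refine ⟨v, Subtype.ext ?_⟩
  rw [← hu, hv]
  rfl

lemma mk_eq_mk_iff {x : X} {m n : M.stalk x} :
    (Associates.mk m : M.Char x) = Associates.mk n ↔ Associated (m : X.presheaf.stalk x) n := by
  rw [Associates.mk_eq_mk_iff_associated, associated_iff]

lemma mk_eq_one_iff {x : X} {m : M.stalk x} :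
    (Associates.mk m : M.Char x) = 1 ↔ IsUnit (m : X.presheaf.stalk x) := by
  rw [Associates.mk_eq_one, isUnit_iff]

lemma stalkSpecializes_mem {x y : X} (h : y ⤳ x) {f : X.presheaf.stalk x} (hf : f ∈ M.stalk x) :
    X.presheaf.stalkSpecializes h f ∈ M.stalk y := by
  obtain ⟨U, hx, s, hs, rfl⟩ := hf
  refine ⟨U, h.mem_open U.isOpen hx, s, hs, ?_⟩
  exact (X.presheaf.germ_stalkSpecializes_apply hx h s).symm

/-- A representative in `𝒪_{X,x}` of an element of the characteristic monoid. -/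
def rep {x : X} (c : M.Char x) : X.presheaf.stalk x := ((Quot.out c : M.stalk x) : X.presheaf.stalk x)

lemma rep_mem {x : X} (c : M.Char x) : M.rep c ∈ M.stalk x := (Quot.out c : M.stalk x).2

lemma mk_rep {x : X} (c : M.Char x) :
    (Associates.mk ⟨M.rep c, M.rep_mem c⟩ : M.Char x) = c := Associates.quot_out c

lemma rep_mk {x : X} (m : M.stalk x) :
    Associated (M.rep (Associates.mk m : M.Char x)) (m : X.presheaf.stalk x) := by
  have := M.mk_rep (Associates.mk m : M.Char x)
  rwa [M.mk_eq_mk_iff] at this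

lemma isMonomialSystem_rep {x : X} (hx : x ∈ M.katoFan) :
    IsMonomialSystem (M.rep : M.Char x → X.presheaf.stalk x) where
  map_one := M.mk_eq_one_iff.1 (M.mk_rep 1)
  map_mul a b := by
    have h1 := M.mk_rep (a * b)
    conv_rhs at h1 => rw [← M.mk_rep a, ← M.mk_rep b, Associates.mk_mul_mk]
    exact M.mk_eq_mk_iff.1 h1
  span_eq := by
    rw [← (show M.ideal x = _ from hx)]
    refine le_antisymm (Ideal.span_mono ?_) (Ideal.span_le.2 ?_)
    · rintro _ ⟨c, hc, rfl⟩
      refine ⟨M.rep_mem c, fun h => hc ?_⟩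
      rw [← M.mk_rep c]
      exact M.mk_eq_one_iff.2 h
    · rintro f ⟨hf, hf'⟩
      obtain ⟨u, hu⟩ := M.rep_mk ⟨f, hf⟩
      show f ∈ Ideal.span _
      have hu' : M.rep (Associates.mk ⟨f, hf⟩) * u = f := hu
      rw [← hu']
      refine Ideal.mul_mem_right _ _ (Ideal.subset_span ⟨_, fun h => hf' ?_, rfl⟩)
      exact M.mk_eq_one_iff.1 h

namespace IsChart

variable {M} {U : X.Opens} {P : Type u} [CommMonoid P] {φ : P →* Γ(X, U)}

/-- The induced map from the chart to the characteristic monoid. -/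
def toChar (h : M.IsChart U φ) (x : X) (hx : x ∈ U) : P →* M.Char x where
  toFun p := Associates.mk ⟨X.presheaf.germ U x hx (φ p), M.germ_mem_stalk (h.mem p) hx⟩
  map_one' := by
    rw [M.mk_eq_one_iff]
    simp
  map_mul' p q := by
    rw [Associates.mk_mul_mk]
    congr 1
    exact Subtype.ext (by simp)

lemma toChar_surjective (h : M.IsChart U φ) (x : X) (hx : x ∈ U) :
    Function.Surjective (h.toChar x hx) := by
  intro c
  obtain ⟨p, a, ha, e⟩ := h.surj x hx _ (M.rep_mem c)
  refine ⟨p, ?_⟩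
  rw [← M.mk_rep c]
  refine M.mk_eq_mk_iff.2 ?_
  obtain ⟨u, rfl⟩ := ha
  exact ⟨u, e.symm⟩

lemma toChar_eq_iff (h : M.IsChart U φ) (x : X) (hx : x ∈ U) (p q : P) :
    h.toChar x hx p = h.toChar x hx q ↔ ∃ s t : P,
      IsUnit (X.presheaf.germ U x hx (φ s)) ∧ IsUnit (X.presheaf.germ U x hx (φ t)) ∧
        p * s = q * t := by
  constructor
  · intro e
    obtain ⟨u, hu⟩ := M.mk_eq_mk_iff.1 e
    obtain ⟨s, t, hs, ht, e', -⟩ := h.inj x hx q p u u.isUnit hu.symm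
    exact ⟨t, s, ht, hs, e'.symm⟩
  · rintro ⟨s, t, hs, ht, e⟩
    have h1 : ∀ s, IsUnit (X.presheaf.germ U x hx (φ s)) → h.toChar x hx s = 1 := fun s hs =>
      M.mk_eq_one_iff.2 hs
    have := congrArg (h.toChar x hx) e
    rwa [map_mul, map_mul, h1 s hs, h1 t ht, mul_one, mul_one] at this

end IsChart

variable {M}

/-- The characteristic monoid is the chart monoid modulo the elements that become units at `x`, so
finiteness, cancellation and saturation descend after multiplying by such elements. -/
lemma IsFs.isFsMonoid_char (hM : M.IsFs) (x : X) : IsFsMonoid (M.Char x) := by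
  obtain ⟨U, hx, P, _, φ, hP, h⟩ := hM x
  have := hP.cancel
  have surj := h.toChar_surjective x hx
  have unit_mul : ∀ s t : P, IsUnit (X.presheaf.germ U x hx (φ s)) →
      IsUnit (X.presheaf.germ U x hx (φ t)) → IsUnit (X.presheaf.germ U x hx (φ (s * t))) := by
    intro s t hs ht
    rw [map_mul, map_mul]
    exact hs.mul ht
  refine ⟨?_, ?_, ?_⟩
  · have := hP.fg
    exact Monoid.fg_of_surjective _ surj
  · have : ∀ a b c : M.Char x, a * b = a * c → b = c := by
      intro a b c e
      obtain ⟨a, rfl⟩ := surj a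
      obtain ⟨b, rfl⟩ := surj b
      obtain ⟨c, rfl⟩ := surj c
      rw [← map_mul, ← map_mul, h.toChar_eq_iff] at e
      obtain ⟨s, t, hs, ht, e⟩ := e
      rw [h.toChar_eq_iff]
      refine ⟨s, t, hs, ht, ?_⟩
      rw [mul_assoc, mul_assoc] at e
      exact mul_left_cancel e
    have hl : IsLeftCancelMul (M.Char x) := ⟨fun a b c e => this a b c e⟩
    have hr : IsRightCancelMul (M.Char x) :=
      ⟨fun a b c e => this a b c (by simpa [mul_comm] using e)⟩
    exact { mul_left_cancel := hl.mul_left_cancel, mul_right_cancel := hr.mul_right_cancel }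
  · intro a b n hn hdvd
    obtain ⟨a, rfl⟩ := surj a
    obtain ⟨b, rfl⟩ := surj b
    obtain ⟨c, hc⟩ := hdvd
    obtain ⟨c, rfl⟩ := surj c
    rw [← map_pow, ← map_pow, ← map_mul, h.toChar_eq_iff] at hc
    obtain ⟨s, t, hs, ht, e⟩ := hc
    obtain ⟨m, rfl⟩ := Nat.exists_eq_succ_of_ne_zero hn.ne'
    -- The relation only contains `a ^ n * s`; multiplying by `s ^ (n - 1)` completes it to an
    -- `n`-th power, to which saturation applies.
    have h1 : b ∣ a * s := by
      refine hP.saturated _ _ (m + 1) hn ⟨c * t * s ^ m, ?_⟩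
      calc (a * s) ^ (m + 1) = (a ^ (m + 1) * s) * s ^ m := by rw [mul_pow, pow_succ s]; ac_rfl
        _ = _ := by rw [e]; ac_rfl
    obtain ⟨d, hd⟩ := h1
    refine ⟨h.toChar x hx d, ?_⟩
    rw [← map_mul, h.toChar_eq_iff]
    exact ⟨s, 1, hs, by simp, by rw [mul_one]; exact hd⟩

lemma IsFs.isCancelMul_stalk (hM : M.IsFs) (x : X) {f g h : X.presheaf.stalk x} (hf : f ∈ M.stalk x)
    (hg : g ∈ M.stalk x) (hh : h ∈ M.stalk x) (e : f * h = g * h) : f = g := by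
  obtain ⟨U, hx, P, _, φ, hP, hc⟩ := hM x
  have := hP.cancel
  obtain ⟨p, a, ha, rfl⟩ := hc.surj x hx f hf
  obtain ⟨q, b, hb, rfl⟩ := hc.surj x hx g hg
  obtain ⟨l, c, hcu, rfl⟩ := hc.surj x hx h hh
  obtain ⟨a, rfl⟩ := ha
  obtain ⟨c, rfl⟩ := hcu
  obtain ⟨b, rfl⟩ := hb
  obtain ⟨s, t, hs, ht, e1, e2⟩ := hc.inj x hx (p * l) (q * l) ↑(b * a⁻¹) (b * a⁻¹).isUnit (by
    rw [map_mul, map_mul, map_mul, map_mul]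
    have ha : (a : X.presheaf.stalk x) * ↑a⁻¹ = 1 := a.mul_inv
    have hc' : (c : X.presheaf.stalk x) * ↑c⁻¹ = 1 := c.mul_inv
    rw [Units.val_mul]
    linear_combination (↑a⁻¹ * ↑c⁻¹ : X.presheaf.stalk x) * e -
      X.presheaf.germ U x hx (φ p) * X.presheaf.germ U x hx (φ l) * (ha * c * ↑c⁻¹ + hc') +
      X.presheaf.germ U x hx (φ q) * X.presheaf.germ U x hx (φ l) * b * ↑a⁻¹ * hc')
  have e3 : p * s = q * t := by
    have : l * (p * s) = l * (q * t) := by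
      calc _ = p * l * s := by ac_rfl
        _ = _ := by rw [e1]; ac_rfl
    exact mul_left_cancel this
  have e4 := congrArg (fun z => X.presheaf.germ U x hx (φ z)) e3
  simp only [map_mul] at e4
  rw [e2, Units.val_mul] at e4
  refine hs.mul_right_cancel ?_
  calc _ = X.presheaf.germ U x hx (φ p) * X.presheaf.germ U x hx (φ s) * a := by ring
    _ = X.presheaf.germ U x hx (φ q) * b * X.presheaf.germ U x hx (φ s) * (↑a⁻¹ * a) := by
      rw [e4]; ring
    _ = _ := by simp

/-- If `0` were in `M_x`, cancelling it from `1 * 0 = 0 * 0` would give `1 = 0`. -/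
lemma IsFs.ne_zero (hM : M.IsFs) (x : X) {f : X.presheaf.stalk x} (hf : f ∈ M.stalk x) : f ≠ 0 := by
  rintro rfl
  exact one_ne_zero (hM.isCancelMul_stalk x (one_mem _) hf hf (by simp))

/-- Up to units, `M_x → M_y` is surjective for a generization `y` of `x`. -/
lemma IsFs.exists_associated (hM : M.IsFs) {x y : X} (h : y ⤳ x) {f : X.presheaf.stalk y}
    (hf : f ∈ M.stalk y) :
    ∃ m ∈ M.stalk x, Associated (X.presheaf.stalkSpecializes h m) f := by
  obtain ⟨U, hx, P, _, φ, hP, hc⟩ := hM x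
  obtain ⟨p, a, ⟨u, rfl⟩, rfl⟩ := hc.surj y (h.mem_open U.isOpen hx) f hf
  refine ⟨X.presheaf.germ U x hx (φ p), M.germ_mem_stalk (hc.mem p) hx, u, ?_⟩
  rw [X.presheaf.germ_stalkSpecializes_apply hx h]

/-- A point `x` of the Kato fan has no proper generization at which all noninvertible elements of
`M_x` vanish. -/
lemma eq_of_specializes_of_mem_katoFan {x y : X} (hx : x ∈ M.katoFan) (h : y ⤳ x)
    (hy : ∀ m ∈ M.stalk x, ¬ IsUnit m → ¬ IsUnit (X.presheaf.stalkSpecializes h m)) : y = x := by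
  have hle : IsLocalRing.maximalIdeal (X.presheaf.stalk x) ≤
      (IsLocalRing.maximalIdeal (X.presheaf.stalk y)).comap (X.presheaf.stalkSpecializes h).hom := by
    rw [← (show M.ideal x = _ from hx), ideal, Ideal.span_le]
    rintro f ⟨hf, hf'⟩
    exact (IsLocalRing.mem_maximalIdeal _).2 (hy f hf hf')
  refine (h.antisymm (specializes_of_forall_not_isUnit h specializes_rfl fun f hf => ?_)).eq
  exact (IsLocalRing.mem_maximalIdeal _).1 (hle ((IsLocalRing.mem_maximalIdeal _).2
    (by simpa using hf)))

/-- A point `x` of the fan is the generic point of an irreducible piece of the locus where those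
chart generators that are nonunits at `x` vanish. There are finitely many sets of generators, and
each locus is a finite union of irreducible closed sets. -/
lemma IsChart.finite_katoFan_inter {U : X.Opens} {P : Type u} [CommMonoid P] {φ : P →* Γ(X, U)}
    (hc : M.IsChart U φ) (fg : Monoid.FG P) [NoetherianSpace X] : (M.katoFan ∩ U).Finite := by
  classical
  obtain ⟨G, hG⟩ := fg.fg_top
  let Z : Finset P → Set X := fun N => ⋂ g ∈ N, ((X.basicOpen (φ g) : Set X))ᶜ
  have hZ : ∀ N, IsClosed (Z N) := fun N =>
    isClosed_biInter fun g _ => (X.basicOpen (φ g)).isOpen.isClosed_compl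
  choose S hSfin hScl hSirr hSZ using fun N =>
    NoetherianSpace.exists_finite_set_isClosed_irreducible (hZ N)
  refine Set.Finite.of_finite_image (f := fun x : X => closure {x}) ?_ ?_
  · refine ((G.powerset.finite_toSet).biUnion fun N _ => hSfin N).subset ?_
    rintro _ ⟨x, ⟨hxF, hxU⟩, rfl⟩
    let N := G.filter fun g => ¬ IsUnit (X.presheaf.germ U x hxU (φ g))
    have hxN : x ∈ Z N := by
      simp only [Z, Set.mem_iInter]
      intro g hg hgx
      exact (Finset.mem_filter.1 hg).2 ((X.mem_basicOpen _ x hxU).1 hgx)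
    rw [hSZ N] at hxN
    obtain ⟨t, ht, hxt⟩ := hxN
    obtain ⟨y, hy⟩ := QuasiSober.sober (hSirr N t ht) (hScl N t ht)
    have hyx : y ⤳ x := hy.specializes hxt
    have hyU : y ∈ U := hyx.mem_open U.isOpen hxU
    have hyZ : y ∈ Z N := by rw [hSZ N]; exact ⟨t, ht, hy.mem⟩
    simp only [Z, Set.mem_iInter] at hyZ
    have key : ∀ p : P, IsUnit (X.presheaf.germ U x hxU (φ p)) ∨
        ¬ IsUnit (X.presheaf.germ U y hyU (φ p)) := by
      intro p
      have hp : p ∈ Submonoid.closure (G : Set P) := hG ▸ Submonoid.mem_top p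
      induction hp using Submonoid.closure_induction with
      | mem g hg =>
        by_cases h : IsUnit (X.presheaf.germ U x hxU (φ g))
        · exact .inl h
        · exact .inr fun h' => hyZ g (Finset.mem_filter.2 ⟨hg, h⟩) ((X.mem_basicOpen _ y hyU).2 h')
      | one => left; simp
      | mul p q _ _ hp hq =>
        rw [map_mul, map_mul, map_mul]
        rcases hp with hp | hp
        · rcases hq with hq | hq
          · exact .inl (hp.mul hq)
          · exact .inr fun h => hq (isUnit_of_mul_isUnit_right h)
        · exact .inr fun h => hp (isUnit_of_mul_isUnit_left h)
    have hyx' : y = x := eq_of_specializes_of_mem_katoFan hxF hyx fun m hm hmu hmy => by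
      obtain ⟨p, a, ha, rfl⟩ := hc.surj x hxU m hm
      rcases key p with h | h
      · exact hmu (h.mul ha)
      · rw [map_mul, X.presheaf.germ_stalkSpecializes_apply hxU hyx] at hmy
        exact h (isUnit_of_mul_isUnit_left hmy)
    refine Set.mem_iUnion₂.2 ⟨N, Finset.mem_coe.2 (Finset.mem_powerset.2 (Finset.filter_subset _ _)), ?_⟩
    show closure {x} ∈ S N
    rw [← hyx', hy.def]
    exact ht
  · intro x _ y _ h
    exact (inseparable_iff_closure_eq.2 h).eq

/-- The Kato fan of a fine log structure on a Noetherian space is finite. -/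
theorem IsFs.finite_katoFan (hM : M.IsFs) [NoetherianSpace X] : M.katoFan.Finite := by
  choose U hxU P _ φ hP hc using hM
  obtain ⟨T, hT⟩ := (NoetherianSpace.isCompact (Set.univ : Set X)).elim_finite_subcover
    (fun x => (U x : Set X)) (fun x => (U x).isOpen) (fun x _ => Set.mem_iUnion.2 ⟨x, hxU x⟩)
  refine (T.finite_toSet.biUnion fun x _ => (hc x).finite_katoFan_inter (hP x).fg).subset ?_
  intro y hy
  obtain ⟨x, hx, hy'⟩ := Set.mem_iUnion₂.1 (hT (Set.mem_univ y))
  exact Set.mem_iUnion₂.2 ⟨x, hx, hy, hy'⟩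

end LogStructure

/-! ## Points of the analytification -/

/-- A valuation on `R` extends along a homomorphism to a field all of whose elements are fractions
of elements of the image, if its support is the kernel. -/
lemma exists_valuation_comap_eq {R K : Type*} [CommRing R] [Field K] (φ : R →+* K)
    (hφ : ∀ y : K, ∃ a s : R, φ s ≠ 0 ∧ y * φ s = φ a) (w : Valuation R ℝ≥0)
    (hw : ∀ f, w f = 0 ↔ φ f = 0) : ∃ v : Valuation K ℝ≥0, ∀ f, v (φ f) = w f := by
  choose num den hden hnum using hφ
  -- As the support of `w` is the kernel of `φ`, the value `w f` depends on `φ f` only; the next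
  -- claim then makes the value of a fraction well defined.
  have eq_of : ∀ f g, φ f = φ g → w f = w g := by
    intro f g h
    have h0 : w (f - g) = 0 := (hw _).2 (by rw [map_sub, h, sub_self])
    refine le_antisymm ?_ ?_
    · calc w f = w ((f - g) + g) := by ring_nf
        _ ≤ max (w (f - g)) (w g) := w.map_add _ _
        _ = w g := by rw [h0]; exact max_eq_right zero_le
    · calc w g = w (f - (f - g)) := by ring_nf
        _ ≤ max (w f) (w (f - g)) := w.map_sub _ _
        _ = w f := by rw [h0]; exact max_eq_left zero_le
  have hden' : ∀ s, φ s ≠ 0 → w s ≠ 0 := fun s hs h => hs ((hw s).1 h)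
  have key : ∀ y a s, φ s ≠ 0 → y * φ s = φ a → w (num y) / w (den y) = w a / w s := by
    intro y a s hs h
    rw [div_eq_div_iff (hden' _ (hden y)) (hden' _ hs), ← map_mul, ← map_mul]
    refine eq_of _ _ ?_
    rw [map_mul, map_mul, ← h, ← hnum]
    ring
  refine ⟨⟨⟨⟨fun y => w (num y) / w (den y), ?_⟩, ?_, ?_⟩, ?_⟩, fun f => ?_⟩
  · rw [key 0 0 1 (by simp) (by simp)]; simp
  · show w (num 1) / w (den 1) = 1
    rw [key 1 1 1 (by simp) (by simp)]; simp
  · intro x y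
    show w (num (x * y)) / w (den (x * y)) = w (num x) / w (den x) * (w (num y) / w (den y))
    rw [key (x * y) (num x * num y) (den x * den y) (by simp [hden])
      (by rw [map_mul, map_mul, ← hnum, ← hnum]; ring), map_mul, map_mul, div_mul_div_comm]
  · intro x y
    show w (num (x + y)) / w (den (x + y)) ≤ max (w (num x) / w (den x)) (w (num y) / w (den y))
    have hd : φ (den x * den y) ≠ 0 := by simp [hden]
    rw [key (x + y) (num x * den y + num y * den x) (den x * den y) hd
      (by rw [map_mul, map_add, map_mul, map_mul, ← hnum, ← hnum]; ring),
      key x (num x * den y) (den x * den y) hd (by rw [map_mul, map_mul, ← hnum]; ring),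
      key y (num y * den x) (den x * den y) hd (by rw [map_mul, map_mul, ← hnum]; ring),
      le_max_iff]
    rcases le_max_iff.1 (w.map_add (num x * den y) (num y * den x)) with h | h
    · exact .inl (div_le_div_of_nonneg_right h zero_le)
    · exact .inr (div_le_div_of_nonneg_right h zero_le)
  · show w (num (φ f)) / w (den (φ f)) = w f
    rw [key (φ f) f 1 (by simp) (by simp), map_one, div_one]

namespace FsLogScheme

variable {k : Type u} [Field k] {X Y : FsLogScheme k}

lemma stalkSpecializes_toStalk {x y : X.X} (h : y ⤳ x) (c : k) :
    X.X.presheaf.stalkSpecializes h (X.toStalk x c) = X.toStalk y c :=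
  X.X.presheaf.germ_stalkSpecializes_apply (U := ⊤) trivial h _

namespace An

lemma seminorm_apply (p : X.An) {x : X.X} (h : p.ker ⤳ x) (f : X.X.presheaf.stalk x) :
    p.seminorm h f = p.val (X.X.residue p.ker (X.X.presheaf.stalkSpecializes h f)) := rfl

lemma seminorm_stalkSpecializes (p : X.An) {x y : X.X} (h : p.ker ⤳ y) (h' : y ⤳ x)
    (f : X.X.presheaf.stalk x) :
    p.seminorm h (X.X.presheaf.stalkSpecializes h' f) = p.seminorm (h.trans h') f := by
  rw [seminorm_apply, seminorm_apply, TopCat.Presheaf.stalkSpecializes_comp_apply]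

lemma residue_eq_zero_iff {x : X.X} {f : X.X.presheaf.stalk x} :
    X.X.residue x f = 0 ↔ ¬ IsUnit f := by
  rw [← mem_nonunits_iff, ← IsLocalRing.mem_maximalIdeal]
  exact Ideal.Quotient.eq_zero_iff_mem

lemma seminorm_eq_zero_iff (p : X.An) {x : X.X} (h : p.ker ⤳ x) {f : X.X.presheaf.stalk x} :
    p.seminorm h f = 0 ↔ ¬ IsUnit (X.X.presheaf.stalkSpecializes h f) := by
  rw [seminorm_apply, Valuation.zero_iff, residue_eq_zero_iff]

/-- A point of `X^an` is determined by its seminorm on a local ring. -/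
lemma ext_of_seminorm {p p' : X.An} {x : X.X} (h : p.ker ⤳ x) (h' : p'.ker ⤳ x)
    (e : ∀ f, p.seminorm h f = p'.seminorm h' f) : p = p' := by
  have hunit : ∀ f, IsUnit (X.X.presheaf.stalkSpecializes h f) ↔
      IsUnit (X.X.presheaf.stalkSpecializes h' f) := fun f => by
    rw [← not_iff_not, ← seminorm_eq_zero_iff, ← seminorm_eq_zero_iff, e]
  have hker : p.ker = p'.ker := by
    refine (Specializes.antisymm ?_ ?_).eq
    · exact specializes_of_forall_not_isUnit h' h fun f hf => by rwa [← hunit]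
    · exact specializes_of_forall_not_isUnit h h' fun f hf => by rwa [hunit]
  obtain ⟨ξ, v, hv⟩ := p
  obtain ⟨ξ', v', hv'⟩ := p'
  obtain rfl : ξ = ξ' := hker
  have : v = v' := by
    refine Valuation.ext fun y => ?_
    obtain ⟨y, rfl⟩ := X.X.residue_surjective ξ y
    obtain ⟨a, s, hs, e'⟩ := exists_fraction h y
    have h1 := e a
    have h2 := e s
    simp only [seminorm_apply] at h1 h2
    have h3 : v (X.X.residue ξ (X.X.presheaf.stalkSpecializes h s)) ≠ 0 := by
      rw [Ne, Valuation.zero_iff, residue_eq_zero_iff, not_not]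
      exact hs
    rw [← e', map_mul, map_mul, map_mul] at h1
    rw [← h2] at h1
    exact mul_right_cancel₀ h3 h1
  subst this
  rfl

/-- Every bounded multiplicative seminorm on a local ring comes from a point of `X^an`. -/
lemma exists_seminorm_eq {x : X.X} (w : Valuation (X.X.presheaf.stalk x) ℝ≥0)
    (hw : ∀ f, w f ≤ 1) : ∃ (p : X.An) (h : p.ker ⤳ x), ∀ f, p.seminorm h f = w f := by
  obtain ⟨ξ, hξ, hsupp⟩ := exists_generization w.supp
  obtain ⟨v, hv⟩ := exists_valuation_comap_eq
    (X.X.presheaf.stalkSpecializes hξ ≫ X.X.residue ξ).hom (by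
      intro y
      obtain ⟨y, rfl⟩ := X.X.residue_surjective ξ y
      obtain ⟨a, s, hs, e⟩ := exists_fraction hξ y
      refine ⟨a, s, ?_, ?_⟩
      · exact fun h => residue_eq_zero_iff.1 h hs
      · exact (map_mul (X.X.residue ξ).hom _ _).symm.trans (congrArg _ e)) w (by
      intro f
      rw [← Valuation.mem_supp_iff, hsupp]
      exact residue_eq_zero_iff.symm)
  refine ⟨⟨ξ, v, fun c hc => ?_⟩, hξ, hv⟩
  have h1 := hv (X.toStalk x c)
  have h2 : w (X.toStalk x c) = 1 := by
    refine le_antisymm (hw _) ?_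
    have h3 : w (X.toStalk x c) * w (X.toStalk x c⁻¹) = 1 := by
      rw [← map_mul, ← map_mul, mul_inv_cancel₀ hc, map_one, map_one]
    rw [← h3]
    exact mul_le_of_le_one_right zero_le (hw _)
  rw [← h2, ← h1, ← stalkSpecializes_toStalk hξ]
  rfl

/-- A bounded seminorm on `𝒪_{X,x}` has a centre among the generizations of `x`. -/
lemma exists_isCentre (p : X.An) {x : X.X} (h : p.ker ⤳ x) (hp : ∀ f, p.seminorm h f ≤ 1) :
    ∃ (y : X.X) (hy : y ⤳ x), p.IsCentre y ∧
      ∀ f, p.seminorm h f < 1 ↔ ¬ IsUnit (X.X.presheaf.stalkSpecializes hy f) := by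
  -- The elements of value less than `1` form a prime ideal, and the corresponding generization is
  -- the centre: elements outside this prime have value exactly `1`.
  let P : Ideal (X.X.presheaf.stalk x) :=
    { carrier := {f | p.seminorm h f < 1}
      add_mem' := fun {a b} ha hb =>
        show p.seminorm h (a + b) < 1 from ((p.seminorm h).map_add a b).trans_lt (max_lt ha hb)
      zero_mem' := by simp
      smul_mem' := fun c f hf => by
        show p.seminorm h (c * f) < 1
        rw [map_mul]
        exact (mul_le_of_le_one_left zero_le (hp c)).trans_lt hf }
  have hP : P.IsPrime := by
    refine ⟨fun h1 => ?_, fun {a b} hab => ?_⟩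
    · have : (1 : X.X.presheaf.stalk x) ∈ P := h1 ▸ trivial
      exact lt_irrefl _ ((map_one (p.seminorm h)).symm.trans_lt this)
    · by_contra! hcon
      have ha : p.seminorm h a = 1 := le_antisymm (hp a) (not_lt.1 hcon.1)
      have hb : p.seminorm h b = 1 := le_antisymm (hp b) (not_lt.1 hcon.2)
      have : p.seminorm h (a * b) < 1 := hab
      rw [map_mul, ha, hb, mul_one] at this
      exact lt_irrefl _ this
  obtain ⟨y, hy, hyP⟩ := exists_generization P
  have hky : p.ker ⤳ y := by
    refine specializes_of_forall_not_isUnit hy h fun f hf => ?_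
    rw [← seminorm_eq_zero_iff] at hf
    rw [← hyP]
    show p.seminorm h f < 1
    rw [hf]
    exact one_pos
  refine ⟨y, hy, ⟨hky, fun f => ?_⟩, hyP⟩
  obtain ⟨a, s, hs, e⟩ := exists_fraction hy f
  have hs1 : p.seminorm h s = 1 := by
    have : ¬ p.seminorm h s < 1 := fun hlt => (hyP s).1 hlt hs
    exact le_antisymm (hp s) (not_lt.1 this)
  have e' : p.seminorm hky f = p.seminorm h a := by
    have := congrArg (p.seminorm hky) e
    rwa [map_mul, seminorm_stalkSpecializes, seminorm_stalkSpecializes, hs1, mul_one] at this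
  rw [e']
  refine ⟨hp a, ?_⟩
  have h1 : p.seminorm h a < 1 ↔ ¬ IsUnit (X.X.presheaf.stalkSpecializes hy a) := hyP a
  rw [h1, ← e, IsLocalRing.mem_maximalIdeal, mem_nonunits_iff, IsUnit.mul_iff]
  simp [hs]

/-- On a separated scheme, centres are unique. -/
lemma IsCentre.unique [IsSeparated X.str] {p : X.An} {x y : X.X} (hx : p.IsCentre x)
    (hy : p.IsCentre y) : x = y := by
  obtain ⟨hx, hx'⟩ := hx
  obtain ⟨hy, hy'⟩ := hy
  -- The uniqueness part of the valuative criterion. A centre gives a morphism from `Spec V` to the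
  -- scheme that maps the closed point to it; two such morphisms agree on the dense generic point
  -- and are therefore equal by separatedness.
  let V := p.val.valuationSubring
  let ψ : ∀ {x : X.X} (h : p.ker ⤳ x) (hb : ∀ f, p.seminorm h f ≤ 1), X.X.presheaf.stalk x →+* V :=
    fun h hb => (X.X.presheaf.stalkSpecializes h ≫ X.X.residue p.ker).hom.codRestrict V hb
  let i : Spec (X.X.residueField p.ker) ⟶ Spec (.of V) := Spec.map (CommRingCat.ofHom V.subtype)
  let g : ∀ {x : X.X} (h : p.ker ⤳ x) (hb : ∀ f, p.seminorm h f ≤ 1), Spec (.of V) ⟶ X.X :=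
    fun {x} h hb => Spec.map (CommRingCat.ofHom (ψ h hb)) ≫ X.X.fromSpecStalk x
  have hcl : ∀ {x : X.X} (h : p.ker ⤳ x) (hb : ∀ f, p.seminorm h f ≤ 1 ∧
      (p.seminorm h f < 1 ↔ f ∈ IsLocalRing.maximalIdeal _)),
      g h (fun f => (hb f).1) (IsLocalRing.closedPoint V) = x := by
    intro x h hb
    have hloc : IsLocalHom (ψ h (fun f => (hb f).1)) := by
      refine ⟨fun f hf => ?_⟩
      by_contra hcon
      have h1 := (hb f).2.2 ((IsLocalRing.mem_maximalIdeal f).2 hcon)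
      have h2 : (p.val : _ → ℝ≥0) (ψ h (fun f => (hb f).1) f) = 1 := by
        obtain ⟨u, hu⟩ := hf
        refine le_antisymm (ψ h (fun f => (hb f).1) f).2 ?_
        have h3 : p.val (u : V) * p.val ((u⁻¹ : Vˣ) : V) = 1 := by
          rw [← map_mul, ← V.coe_mul, Units.mul_inv]
          simp
        rw [← hu, ← h3]
        exact mul_le_of_le_one_right zero_le ((u⁻¹ : Vˣ) : V).2
      exact h1.ne h2
    show X.X.fromSpecStalk x (PrimeSpectrum.comap (ψ h _) (IsLocalRing.closedPoint V)) = x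
    rw [IsLocalRing.comap_closedPoint]
    exact Scheme.fromSpecStalk_closedPoint
  have hi : ∀ {x : X.X} (h : p.ker ⤳ x) (hb : ∀ f, p.seminorm h f ≤ 1),
      i ≫ g h hb = X.X.fromSpecResidueField p.ker := by
    intro x h hb
    rw [Scheme.fromSpecResidueField, ← Scheme.SpecMap_stalkSpecializes_fromSpecStalk h,
      ← Spec.map_comp_assoc]
    exact (Category.assoc _ _ _).symm.trans
      (congrArg (· ≫ X.X.fromSpecStalk x) (Spec.map_comp _ _).symm)
  have hdom : IsDominant i := by
    rw [isDominant_iff]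
    exact (PrimeSpectrum.denseRange_comap_iff_ker_le_nilRadical _).2 (by
      intro f hf
      have : f = 0 := Subtype.ext hf
      rw [this]
      exact zero_mem _)
  have hgg : g hx (fun f => (hx' f).1) = g hy (fun f => (hy' f).1) := by
    refine ext_of_isDominant_of_isSeparated X.str ?_ i ((hi _ _).trans (hi _ _).symm)
    have h1 : i ≫ g hx (fun f => (hx' f).1) ≫ X.str = i ≫ g hy (fun f => (hy' f).1) ≫ X.str :=
      (Category.assoc _ _ _).symm.trans ((congrArg (· ≫ X.str) ((hi _ _).trans (hi _ _).symm)).trans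
        (Category.assoc _ _ _))
    obtain ⟨a, ha⟩ := Spec.map_surjective (g hx (fun f => (hx' f).1) ≫ X.str)
    obtain ⟨b, hb⟩ := Spec.map_surjective (g hy (fun f => (hy' f).1) ≫ X.str)
    rw [← ha, ← hb] at h1 ⊢
    have h2 : a ≫ CommRingCat.ofHom V.subtype = b ≫ CommRingCat.ofHom V.subtype := by
      refine Spec.map_injective ?_
      rw [Spec.map_comp, Spec.map_comp]
      exact h1
    have h3 : a = b := by
      ext c
      exact congr($(h2).hom c)
    rw [h3]
  rw [← hcl hx hx', ← hcl hy hy', hgg]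

lemma seminorm_map (f : X ⟶ Y) (p : X.An) {x : X.X} (h : p.ker ⤳ x)
    (h' : (An.map f p).ker ⤳ f.f x) (g : Y.X.presheaf.stalk (f.f x)) :
    (An.map f p).seminorm h' g = p.seminorm h (f.f.stalkMap x g) := by
  show p.val (f.f.residueFieldMap p.ker (Y.X.residue _ (Y.X.presheaf.stalkSpecializes h' g))) =
    p.val (X.X.residue p.ker (X.X.presheaf.stalkSpecializes h (f.f.stalkMap x g)))
  congr 1
  have h1 := congr($(Scheme.residue_residueFieldMap f.f p.ker).hom
    (Y.X.presheaf.stalkSpecializes h' g))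
  refine Eq.trans h1 ?_
  exact congrArg (X.X.residue p.ker) (Scheme.Hom.stalkSpecializes_stalkMap_apply f.f p.ker x h g)

lemma map_ker_specializes (f : X ⟶ Y) (p : X.An) {x : X.X} (h : p.ker ⤳ x) :
    (An.map f p).ker ⤳ f.f x := h.map f.f.continuous

lemma IsCentre.map (f : X ⟶ Y) {p : X.An} {x : X.X} (h : p.IsCentre x) :
    (An.map f p).IsCentre (f.f x) := by
  obtain ⟨h, h'⟩ := h
  refine ⟨map_ker_specializes f p h, fun g => ?_⟩
  rw [seminorm_map f p h]
  refine ⟨(h' _).1, (h' _).2.trans ?_⟩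
  rw [IsLocalRing.mem_maximalIdeal, IsLocalRing.mem_maximalIdeal, mem_nonunits_iff,
    mem_nonunits_iff, not_iff_not]
  exact isUnit_map_iff (f.f.stalkMap x).hom g

lemma continuous_map (f : X ⟶ Y) : Continuous (An.map f) := by
  refine continuous_generateFrom_iff.2 ?_
  rintro _ (⟨U, rfl⟩ | ⟨U, g, V, hV, rfl⟩)
  · exact isOpen_generateFrom_of_mem (.inl ⟨f.f ⁻¹ᵁ U, rfl⟩)
  · refine isOpen_generateFrom_of_mem (.inr ⟨f.f ⁻¹ᵁ U, f.f.app U g, V, hV, ?_⟩)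
    ext p
    show (∃ h : f.f p.ker ∈ U, p.val (f.f.residueFieldMap p.ker (Y.X.evaluation U _ h g)) ∈ V) ↔
      ∃ h : f.f p.ker ∈ U, p.val (X.X.evaluation (f.f ⁻¹ᵁ U) p.ker h (f.f.app U g)) ∈ V
    simp only [Scheme.evaluation_naturality_apply]

lemma map_scale (f : X ⟶ Y) (p : X.An) (a : ℝ) (ha : 0 < a) :
    An.map f (p.scale a ha) = (An.map f p).scale a ha := rfl

lemma seminorm_scale (p : X.An) (a : ℝ) (ha : 0 < a) {x : X.X} (h : p.ker ⤳ x)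
    (f : X.X.presheaf.stalk x) : (p.scale a ha).seminorm h f = p.seminorm h f ^ a := rfl

end An

/-- With constant kernel `η` the conditions on the kernel in the subbasis are always or never
satisfied, so only the values on functions near `η` matter. -/
lemma continuous_iff_seminorm {T : Type*} [TopologicalSpace T] (g : T → X.An) {η : X.X}
    (h : ∀ t, (g t).ker = η) :
    Continuous g ↔ ∀ f, Continuous fun t => (g t).seminorm (specializes_of_eq (h t)) f := by
  have eval : ∀ (U : X.X.Opens) (f : Γ(X.X, U)) (hη : η ∈ U) (t : T) (ht : (g t).ker ∈ U),
      (g t).val (X.X.evaluation U (g t).ker ht f) =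
        (g t).seminorm (specializes_of_eq (h t)) (X.X.presheaf.germ U η hη f) := by
    intro U f hη t ht
    rw [An.seminorm_apply, X.X.presheaf.germ_stalkSpecializes_apply hη]
    rfl
  constructor
  · intro hg f
    obtain ⟨U, hη, s, rfl⟩ := X.X.presheaf.exists_germ_eq f
    rw [continuous_def]
    intro V hV
    have h1 : IsOpen {p : X.An | ∃ h : p.ker ∈ U, p.val (X.X.evaluation U p.ker h s) ∈ V} :=
      isOpen_generateFrom_of_mem (.inr ⟨U, s, V, hV, rfl⟩)
    convert! h1.preimage hg using 1
    ext t
    have ht : (g t).ker ∈ U := by rwa [h t]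
    show (g t).seminorm _ _ ∈ V ↔ ∃ h : (g t).ker ∈ U, _
    rw [← eval U s hη t ht]
    exact ⟨fun h => ⟨ht, h⟩, fun ⟨_, h⟩ => h⟩
  · intro hf
    refine continuous_generateFrom_iff.2 ?_
    rintro _ (⟨U, rfl⟩ | ⟨U, s, V, hV, rfl⟩)
    · by_cases hη : η ∈ U
      · convert! isOpen_univ
        exact Set.eq_univ_of_forall fun t => by simpa [h t] using hη
      · convert! isOpen_empty
        exact Set.eq_empty_of_forall_notMem fun t ht => hη (by simpa [h t] using ht)
    · by_cases hη : η ∈ U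
      · convert! hV.preimage (hf (X.X.presheaf.germ U η hη s)) using 1
        ext t
        have ht : (g t).ker ∈ U := by rwa [h t]
        show (∃ h : (g t).ker ∈ U, _) ↔ (g t).seminorm _ _ ∈ V
        rw [← eval U s hη t ht]
        exact ⟨fun ⟨_, h⟩ => h, fun h => ⟨ht, h⟩⟩
      · convert! isOpen_empty
        exact Set.eq_empty_of_forall_notMem fun t ⟨ht, _⟩ => hη (by simpa [h t] using ht)

end FsLogScheme

/-- The function `t ↦ - log t` on `(0, 1]`, the inverse of `expNeg`. -/
def negLog (t : ℝ≥0) : ℝ≥0 := (-Real.log t).toNNReal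

lemma expNeg_negLog {t : ℝ≥0} (h0 : t ≠ 0) (h1 : t ≤ 1) : expNeg (negLog t) = t := by
  ext
  have h2 : 0 < (t : ℝ) := by positivity
  have h3 : Real.log t ≤ 0 := Real.log_nonpos h2.le (by exact_mod_cast h1)
  rw [coe_expNeg, negLog, Real.coe_toNNReal _ (by linarith), neg_neg, Real.exp_log h2]

lemma negLog_expNeg (t : ℝ≥0) : negLog (expNeg t) = t :=
  expNeg_injective (expNeg_negLog (expNeg_pos t).ne' (expNeg_le_one t))

lemma negLog_one : negLog 1 = 0 := by rw [← expNeg_zero, negLog_expNeg]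

lemma negLog_mul {s t : ℝ≥0} (hs : s ≠ 0) (hs' : s ≤ 1) (ht : t ≠ 0) (ht' : t ≤ 1) :
    negLog (s * t) = negLog s + negLog t := by
  apply expNeg_injective
  rw [expNeg_add, expNeg_negLog hs hs', expNeg_negLog ht ht',
    expNeg_negLog (mul_ne_zero hs ht) (mul_le_one₀ hs' zero_le ht')]

lemma continuousAt_negLog {t : ℝ≥0} (ht : t ≠ 0) : ContinuousAt negLog t := by
  have : ContinuousAt (fun s : ℝ≥0 => -Real.log s) t :=
    ((Real.continuousAt_log (by simpa using ht)).comp NNReal.continuous_coe.continuousAt).neg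
  exact continuous_real_toNNReal.continuousAt.comp this

lemma negLog_rpow {t : ℝ≥0} (a : ℝ≥0) : negLog (t ^ (a : ℝ)) = a * negLog t := by
  -- At `t = 0` both sides are `0`, by the conventions `Real.log 0 = 0` and `0 ^ 0 = 1`.
  by_cases ht : t = 0
  · subst ht
    by_cases ha : a = 0
    · simp [ha, negLog]
    · simp [negLog, NNReal.zero_rpow (x := (a : ℝ)) (by simpa using ha)]
  · rw [negLog, NNReal.coe_rpow, Real.log_rpow (by positivity), ← mul_neg,
      Real.toNNReal_mul (NNReal.coe_nonneg a), Real.toNNReal_coe, negLog]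

/-- A valuation which is at most `1` takes the value `1` on units. -/
lemma Valuation.eq_one_of_isUnit {R : Type*} [CommRing R] {w : Valuation R ℝ≥0}
    (hw : ∀ f, w f ≤ 1) {f : R} (hf : IsUnit f) : w f = 1 := by
  obtain ⟨u, rfl⟩ := hf
  refine le_antisymm (hw _) ?_
  have : w u * w ↑u⁻¹ = 1 := by rw [← map_mul, Units.mul_inv, map_one]
  rw [← this]
  exact mul_le_of_le_one_right zero_le (hw _)

lemma Valuation.eq_of_associated {R : Type*} [CommRing R] {w : Valuation R ℝ≥0}
    (hw : ∀ f, w f ≤ 1) {f g : R} (h : Associated f g) : w f = w g := by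
  obtain ⟨u, rfl⟩ := h
  rw [map_mul, Valuation.eq_one_of_isUnit hw u.isUnit, mul_one]

/-! ### Faces of the skeleton as spaces of weights. -/

namespace FsLogScheme

open IsIndependentSystem

variable {k : Type u} [Field k] {X : FsLogScheme k}

/-- Triviality on `k` is automatic: nonzero constants are units, and a valuation bounded by `1` is
`1` on units. For the same reason the values on `M_x` are determined by representatives. -/
lemma extends_iff {x : X.X} {α : X.M.Char x →* Multiplicative ℝ≥0}
    {w : Valuation (X.X.presheaf.stalk x) ℝ≥0} :
    Extends α w ↔ IsMonomialExtension X.M.rep α w := by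
  constructor
  · intro h
    refine ⟨h.le_one, fun c => ?_⟩
    have := h.apply_mem ⟨X.M.rep c, X.M.rep_mem c⟩
    rw [X.M.mk_rep] at this
    ext
    exact this
  · rintro ⟨h1, h2⟩
    refine ⟨h1, fun c hc => ?_, fun m => ?_⟩
    · exact Valuation.eq_one_of_isUnit h1 ((IsUnit.mk0 c hc).map (X.toStalk x))
    · rw [← Valuation.eq_of_associated h1 (X.M.rep_mk m), h2]
      rfl

lemma isMinimalExtension_iff {x : X.X} {α : X.M.Char x →* Multiplicative ℝ≥0}
    {w : Valuation (X.X.presheaf.stalk x) ℝ≥0} :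
    IsMinimalExtension α w ↔ IsMaximalExtension X.M.rep α w := by
  simp only [IsMinimalExtension, IsMaximalExtension, extends_iff]

lemma IsMonomialExtension.apply_mem {x : X.X} {α : X.M.Char x →* Multiplicative ℝ≥0}
    {w : Valuation (X.X.presheaf.stalk x) ℝ≥0} (h : IsMonomialExtension X.M.rep α w)
    (m : X.M.stalk x) : w m = expNeg (α (Associates.mk m)).toAdd := by
  rw [← Valuation.eq_of_associated h.1 (X.M.rep_mk m), h.2]

lemma exists_isMonomialExtension {x : X.X} {w : Valuation (X.X.presheaf.stalk x) ℝ≥0}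
    (h1 : ∀ f, w f ≤ 1) (h0 : ∀ c, w (X.M.rep c) ≠ 0) :
    ∃ α : X.M.Char x →* Multiplicative ℝ≥0, IsMonomialExtension X.M.rep α w := by
  refine ⟨⟨⟨fun c => .ofAdd (negLog (w (X.M.rep c))), ?_⟩, fun a b => ?_⟩, h1, fun c => ?_⟩
  · rw [Valuation.eq_one_of_isUnit h1 (X.M.mk_eq_one_iff.1 (X.M.mk_rep 1)), negLog_one]
    rfl
  · show Multiplicative.ofAdd (negLog (w (X.M.rep (a * b)))) = _
    have h2 := X.M.rep_mk (⟨X.M.rep a, X.M.rep_mem a⟩ * ⟨X.M.rep b, X.M.rep_mem b⟩)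
    rw [← Associates.mk_mul_mk, X.M.mk_rep, X.M.mk_rep] at h2
    rw [Valuation.eq_of_associated h1 h2, Submonoid.coe_mul, map_mul,
      negLog_mul (h0 a) (h1 _) (h0 b) (h1 _), ofAdd_add]
  · exact (expNeg_negLog (h0 c) (h1 _)).symm

variable (X) in
/-- The conditions on `X` under which the skeleton is described by monomial valuations: the
log structure is given by independent monomials at the points of the Kato fan, the Kato fan is
finite, and the underlying space is irreducible with generic point `η`. -/
structure IsToroidal (η : X.X) : Prop where
  independent : ∀ x ∈ X.M.katoFan, IsIndependentSystem (X.M.rep : X.M.Char x → _)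
  finite : X.M.katoFan.Finite
  specializes : ∀ x, η ⤳ x
  generic_mem : η ∈ X.M.katoFan

namespace IsToroidal

variable {η : X.X} (hX : X.IsToroidal η)

include hX

/-- The valuation `v_α` as a point of the face of `x`. -/
lemma exists_point {x : X.X} (hx : x ∈ X.M.katoFan) (α : X.M.Char x →* Multiplicative ℝ≥0) :
    ∃ (p : X.An) (h : p.ker ⤳ x), IsMaximalExtension X.M.rep α (p.seminorm h) := by
  obtain ⟨o, ho⟩ := exists_monomialOrder (X.fs.isFsMonoid_char x) (isSharp_associates _) α
  have hw := (hX.independent x hx).isMaximalExtension_valuation o α ho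
  obtain ⟨p, h, hp⟩ := An.exists_seminorm_eq _ hw.1.1
  have : p.seminorm h = (hX.independent x hx).valuation o α ho := Valuation.ext hp
  exact ⟨p, h, this ▸ hw⟩

omit hX in
-- A seminorm bounded by `1` on a local ring has a centre, so membership in `X^ℶ` comes for free.
lemma mem_face_iff {x : X.X} {p : X.An} :
    p ∈ X.face x ↔ ∃ (h : p.ker ⤳ x) (α : X.M.Char x →* Multiplicative ℝ≥0),
      IsMaximalExtension X.M.rep α (p.seminorm h) := by
  simp only [face, isMinimalExtension_iff]
  refine ⟨fun h => h.2, fun h => ⟨?_, h⟩⟩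
  obtain ⟨h, α, hα⟩ := h
  obtain ⟨y, -, hy, -⟩ := p.exists_isCentre h hα.1.1
  exact ⟨y, hy⟩

lemma seminorm_ne_zero {x : X.X} (hx : x ∈ X.M.katoFan) {p : X.An} {h : p.ker ⤳ x}
    {α : X.M.Char x →* Multiplicative ℝ≥0} (hα : IsMaximalExtension X.M.rep α (p.seminorm h))
    {f : X.X.presheaf.stalk x} (hf : f ≠ 0) : p.seminorm h f ≠ 0 :=
  ((hX.independent x hx).pos_of_ne_zero (X.fs.isFsMonoid_char x) (isSharp_associates _) hα hf).ne'

/-- Monomial valuations vanish only at `0`, so all points of the skeleton are valuations living at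
the generic point. -/
lemma ker_eq_of_isMaximalExtension {x : X.X} (hx : x ∈ X.M.katoFan) {p : X.An} {h : p.ker ⤳ x}
    {α : X.M.Char x →* Multiplicative ℝ≥0} (hα : IsMaximalExtension X.M.rep α (p.seminorm h)) :
    p.ker = η := by
  refine (Specializes.antisymm (specializes_of_forall_not_isUnit (hX.specializes x) h ?_)
    (hX.specializes _)).eq
  intro f hf
  rw [← An.seminorm_eq_zero_iff] at hf
  have : f = 0 := by
    by_contra h0
    exact hX.seminorm_ne_zero hx hα h0 hf
  rw [this, map_zero]
  exact not_isUnit_zero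

lemma ker_eq {p : X.An} (hp : p ∈ X.skeleton) : p.ker = η := by
  obtain ⟨x, hx, hp⟩ := Set.mem_iUnion₂.1 hp
  obtain ⟨h, α, hα⟩ := mem_face_iff.1 hp
  exact hX.ker_eq_of_isMaximalExtension hx hα

lemma ker_specializes {p : X.An} (hp : p ∈ X.skeleton) (x : X.X) : p.ker ⤳ x :=
  hX.ker_eq hp ▸ hX.specializes x

lemma isUnit_stalkSpecializes {x : X.X} (hx : x ∈ X.M.katoFan) {f : X.X.presheaf.stalk x}
    (hf : f ≠ 0) : IsUnit (X.X.presheaf.stalkSpecializes (hX.specializes x) f) := by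
  -- The trivial weight already gives a valuation on the local ring with zero support and kernel
  -- `η`. No integrality of the scheme is presupposed, which matters for the product.
  obtain ⟨p, h, hα⟩ := hX.exists_point hx 1
  have h1 := hX.seminorm_ne_zero hx hα hf
  rw [Ne, An.seminorm_eq_zero_iff, not_not] at h1
  have h2 := hX.ker_eq_of_isMaximalExtension hx hα
  subst h2
  exact h1

/-- The centre of a point of the skeleton is a point of the Kato fan, and the point lies in the
corresponding face. -/
lemma exists_isCentre {x : X.X} (hx : x ∈ X.M.katoFan) {p : X.An} (hp : p ∈ X.face x) :
    ∃ y ∈ X.M.katoFan, p.IsCentre y ∧ p ∈ X.face y := by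
  obtain ⟨h, α, hα⟩ := mem_face_iff.1 hp
  obtain ⟨y, hy, hc, hlt⟩ := p.exists_isCentre h hα.1.1
  have hc' := hc
  obtain ⟨hky, hc⟩ := hc
  have hpy1 : ∀ f, p.seminorm hky f ≤ 1 := fun f => (hc f).1
  refine ⟨y, ?_, hc', ?_⟩
  · refine le_antisymm (Ideal.span_le.2 fun f hf => (IsLocalRing.mem_maximalIdeal f).2 hf.2) ?_
    intro f hf
    -- The numerator of a nonunit at `y` has value less than `1`, hence lies in the ideal of
    -- monomials of value less than `1`, and these become nonunits at `y`. So monomials generate the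
    -- maximal ideal at `y`.
    obtain ⟨a, s, hs, e⟩ := exists_fraction hy f
    have ha : p.seminorm h a < 1 := by
      rw [hlt, ← e, IsUnit.mul_iff]
      exact fun h => (IsLocalRing.mem_maximalIdeal f).1 hf h.1
    have h1 := (hX.independent x hx).mem_span_of_lt_one (X.fs.isFsMonoid_char x)
      (isSharp_associates _) hα ha
    have h2 := Ideal.mem_map_of_mem (X.X.presheaf.stalkSpecializes hy).hom h1
    rw [Ideal.map_span] at h2
    have h3 : X.X.presheaf.stalkSpecializes hy a ∈ X.M.ideal y := by
      refine Ideal.span_mono ?_ h2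
      rintro _ ⟨_, ⟨c, hc, rfl⟩, rfl⟩
      exact ⟨X.M.stalkSpecializes_mem hy (X.M.rep_mem c), (hlt _).1 hc⟩
    rw [← e] at h3
    exact (Ideal.mul_unit_mem_iff_mem _ hs).1 h3
  · rw [mem_face_iff]
    have hne : ∀ c, p.seminorm hky (X.M.rep c) ≠ 0 := by
      intro c
      obtain ⟨m, hm, hmc⟩ := X.fs.exists_associated hy (X.M.rep_mem c)
      rw [← Valuation.eq_of_associated hpy1 hmc, An.seminorm_stalkSpecializes]
      exact hX.seminorm_ne_zero hx hα (X.fs.ne_zero x hm)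
    obtain ⟨β, hβ⟩ := exists_isMonomialExtension hpy1 hne
    refine ⟨hky, β, hβ, fun w hw f => ?_⟩
    obtain ⟨a, s, hs, e⟩ := exists_fraction hy f
    -- A competitor on the local ring at `y` restricts to a competitor at `x`, so maximality at `x`
    -- passes to numerators and thus to fractions.
    have h1 : IsMonomialExtension X.M.rep α (w.comap (X.X.presheaf.stalkSpecializes hy).hom) := by
      refine ⟨fun f => hw.1 _, fun c => ?_⟩
      have hm := X.M.stalkSpecializes_mem hy (X.M.rep_mem c)
      refine (IsMonomialExtension.apply_mem hw ⟨_, hm⟩).trans ?_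
      refine (IsMonomialExtension.apply_mem hβ ⟨_, hm⟩).symm.trans ?_
      rw [← hα.1.2 c]
      exact An.seminorm_stalkSpecializes p hky hy _
    have h2 := hα.2 _ h1 a
    have h3 : w (X.X.presheaf.stalkSpecializes hy a) ≤ p.seminorm hky
        (X.X.presheaf.stalkSpecializes hy a) := by
      rw [An.seminorm_stalkSpecializes]
      exact h2
    rwa [← e, map_mul, map_mul, Valuation.eq_one_of_isUnit hw.1 hs,
      Valuation.eq_one_of_isUnit hpy1 hs, mul_one, mul_one] at h3

/-- The face of a generization is contained in the face. -/
lemma face_subset_face {x y : X.X} (hx : x ∈ X.M.katoFan) (hy : y ∈ X.M.katoFan) (hyx : y ⤳ x) :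
    X.face y ⊆ X.face x := by
  intro p hp
  obtain ⟨hky, β, hβ⟩ := mem_face_iff.1 hp
  have hkx := hky.trans hyx
  have hsp : ∀ f, p.seminorm hkx f = p.seminorm hky (X.X.presheaf.stalkSpecializes hyx f) :=
    fun f => (An.seminorm_stalkSpecializes p hky hyx f).symm
  have h1 : ∀ f, p.seminorm hkx f ≤ 1 := fun f => by
    rw [hsp]; exact hβ.1.1 _
  have hmne : ∀ m ∈ X.M.stalk x, p.seminorm hkx m ≠ 0 := fun m hm => by
    rw [hsp]
    exact hX.seminorm_ne_zero hy hβ (X.fs.ne_zero y (X.M.stalkSpecializes_mem hyx hm))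
  obtain ⟨α, hα⟩ := exists_isMonomialExtension h1 fun c => hmne _ (X.M.rep_mem c)
  rw [mem_face_iff]
  refine ⟨hkx, α, hα, fun w' hw' f => ?_⟩
  -- The maximal extension `p'` at `x` dominates `p`, so it is `1` on elements that become units at
  -- `y` and extends to the local ring at `y`. There it is an extension of `β`, and maximality of
  -- `p` at `y` forces it below `p`.
  obtain ⟨p', hkx', hp'⟩ := hX.exists_point hx α
  refine (hp'.2 w' hw' f).trans ?_
  have hle := hp'.2 _ hα
  have hky' : p'.ker ⤳ y := by
    refine specializes_of_forall_not_isUnit hyx hkx' fun f hf hfy => ?_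
    rw [← An.seminorm_eq_zero_iff] at hf
    have := hle f
    rw [hf, hsp, Valuation.eq_one_of_isUnit hβ.1.1 hfy] at this
    exact absurd this (by simp)
  have hsp' : ∀ f, p'.seminorm hkx' f = p'.seminorm hky' (X.X.presheaf.stalkSpecializes hyx f) :=
    fun f => (An.seminorm_stalkSpecializes p' hky' hyx f).symm
  have h1' : ∀ f, p'.seminorm hky' f ≤ 1 := by
    intro f
    obtain ⟨a, s, hs, e⟩ := exists_fraction hyx f
    have hs1 : p'.seminorm hkx' s = 1 := by
      refine le_antisymm (hp'.1.1 s) ((le_of_eq ?_).trans (hle s))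
      rw [hsp, Valuation.eq_one_of_isUnit hβ.1.1 hs]
    have := congrArg (p'.seminorm hky') e
    rw [map_mul, ← hsp', ← hsp', hs1, mul_one] at this
    rw [this]
    exact hp'.1.1 a
  have hext : IsMonomialExtension X.M.rep β (p'.seminorm hky') := by
    refine ⟨h1', fun d => ?_⟩
    obtain ⟨m, hm, hmd⟩ := X.fs.exists_associated hyx (X.M.rep_mem d)
    rw [← Valuation.eq_of_associated h1' hmd, ← hsp', ← hβ.1.2,
      ← Valuation.eq_of_associated hβ.1.1 hmd, ← hsp]
    exact (IsMonomialExtension.apply_mem hp'.1 ⟨m, hm⟩).trans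
      (IsMonomialExtension.apply_mem hα ⟨m, hm⟩).symm
  rw [hsp', hsp]
  exact hβ.2 _ hext _

/-- Boundedness on the local ring at `x` puts a centre among the generizations of `x`; by
separatedness it is the centre lying in the Kato fan, whose face is contained in that of `x`. Faces
are thereby cut out by closed conditions. -/
lemma mem_face_of_le_one [IsSeparated X.str] {x : X.X} (hx : x ∈ X.M.katoFan) {p : X.An}
    (hp : p ∈ X.skeleton) (h : p.ker ⤳ x) (h1 : ∀ f, p.seminorm h f ≤ 1) : p ∈ X.face x := by
  obtain ⟨x', hx', hp'⟩ := Set.mem_iUnion₂.1 hp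
  obtain ⟨y, hy, hc, hpy⟩ := hX.exists_isCentre hx' hp'
  obtain ⟨y', hy'x, hc', -⟩ := p.exists_isCentre h h1
  obtain rfl := hc.unique hc'
  exact hX.face_subset_face hx hy hy'x hpy

/-- The valuation on `𝒪_{X,x}` defined by a point of the skeleton. -/
def valAt (v : X.skeleton) (x : X.X) : Valuation (X.X.presheaf.stalk x) ℝ≥0 :=
  v.1.seminorm (hX.ker_specializes v.2 x)

lemma valAt_stalkSpecializes (v : X.skeleton) {x y : X.X} (h : y ⤳ x) (f : X.X.presheaf.stalk x) :
    hX.valAt v y (X.X.presheaf.stalkSpecializes h f) = hX.valAt v x f :=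
  An.seminorm_stalkSpecializes _ _ _ _

lemma valAt_ne_zero (v : X.skeleton) {x : X.X} (hx : x ∈ X.M.katoFan) {f : X.X.presheaf.stalk x}
    (hf : f ≠ 0) : hX.valAt v x f ≠ 0 := by
  have h1 := hX.isUnit_stalkSpecializes hx hf
  have h2 := hX.ker_eq v.2
  rw [valAt, Ne, An.seminorm_eq_zero_iff, not_not]
  subst h2
  exact h1

lemma continuous_iff {T : Type*} [TopologicalSpace T] {g : T → X.skeleton} :
    Continuous g ↔ ∀ f, Continuous fun t => hX.valAt (g t) η f := by
  rw [continuous_induced_rng]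
  exact continuous_iff_seminorm _ fun t => hX.ker_eq (g t).2

lemma continuous_valAt (x : X.X) (f : X.X.presheaf.stalk x) :
    Continuous fun v => hX.valAt v x f := by
  have := hX.continuous_iff.1 continuous_id (X.X.presheaf.stalkSpecializes (hX.specializes x) f)
  simpa [valAt_stalkSpecializes] using this

lemma ext {v w : X.skeleton} (x : X.X) (h : ∀ f, hX.valAt v x f = hX.valAt w x f) : v = w :=
  Subtype.ext (An.ext_of_seminorm _ _ h)

lemma t2Space : T2Space X.skeleton := by
  refine T2Space.of_injective_continuous (f := fun v : X.skeleton => fun f => hX.valAt v η f) ?_ ?_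
  · intro v w h
    exact hX.ext η fun f => congrFun h f
  · exact continuous_pi fun f => hX.continuous_valAt η f

/-- A family of points of a face with continuously varying weights is continuous. -/
lemma continuous_of_isMaximalExtension {T : Type*} [TopologicalSpace T] {g : T → X.skeleton}
    {x : X.X} (hx : x ∈ X.M.katoFan) (α : T → X.M.Char x →* Multiplicative ℝ≥0)
    (hα : ∀ c, Continuous fun t => (α t c).toAdd)
    (hg : ∀ t, IsMaximalExtension X.M.rep (α t) (hX.valAt (g t) x)) : Continuous g := by
  have h1 := (hX.independent x hx).continuous_apply (X.fs.isFsMonoid_char x)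
    (isSharp_associates _) α hα _ hg
  rw [hX.continuous_iff]
  intro f
  obtain ⟨a, s, hs, e⟩ := exists_fraction (hX.specializes x) f
  have hs0 : s ≠ 0 := by
    rintro rfl
    rw [map_zero] at hs
    exact not_isUnit_zero hs
  -- The values at the generic point are quotients of values at `x` with nonvanishing denominator.
  have h2 : ∀ t, hX.valAt (g t) η f = hX.valAt (g t) x a / hX.valAt (g t) x s := by
    intro t
    rw [eq_div_iff (hX.valAt_ne_zero _ hx hs0), ← hX.valAt_stalkSpecializes _ (hX.specializes x) s,
      ← map_mul, e, hX.valAt_stalkSpecializes]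
  simp only [h2]
  exact (h1 a).div₀ (h1 s) fun t => hX.valAt_ne_zero _ hx hs0

lemma mem_face_iff_exists {v : X.skeleton} {x : X.X} :
    v.1 ∈ X.face x ↔ ∃ α : X.M.Char x →* Multiplicative ℝ≥0,
      IsMaximalExtension X.M.rep α (hX.valAt v x) := by
  rw [mem_face_iff]
  exact ⟨fun ⟨_, h⟩ => h, fun h => ⟨_, h⟩⟩

omit hX in
lemma exists_mem_face (v : X.skeleton) : ∃ x ∈ X.M.katoFan, v.1 ∈ X.face x := by
  simpa [skeleton] using v.2

lemma exists_skeleton {x : X.X} (hx : x ∈ X.M.katoFan) (α : X.M.Char x →* Multiplicative ℝ≥0) :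
    ∃ v : X.skeleton, IsMaximalExtension X.M.rep α (hX.valAt v x) := by
  obtain ⟨p, h, hα⟩ := hX.exists_point hx α
  exact ⟨⟨p, Set.mem_iUnion₂.2 ⟨x, hx, mem_face_iff.2 ⟨h, α, hα⟩⟩⟩, hα⟩

lemma isClosed_face [IsSeparated X.str] {x : X.X} (hx : x ∈ X.M.katoFan) :
    IsClosed {v : X.skeleton | v.1 ∈ X.face x} := by
  have : {v : X.skeleton | v.1 ∈ X.face x} = ⋂ f, {v | hX.valAt v x f ≤ 1} := by
    ext v
    simp only [Set.mem_iInter]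
    constructor
    · intro hv f
      obtain ⟨α, hα⟩ := hX.mem_face_iff_exists.1 hv
      exact hα.1.1 f
    · intro h
      exact hX.mem_face_of_le_one hx v.2 _ h
  rw [this]
  exact isClosed_iInter fun f => isClosed_le (hX.continuous_valAt x f) continuous_const

end IsToroidal

end FsLogScheme

/-! ## Local rings of products over a field -/

section Fibers

variable {S X Y Z : Scheme.{u}}

lemma flat_fromSpecStalk (x : X) : Flat (X.fromSpecStalk x) := by
  obtain ⟨U, hU, hx, -⟩ := exists_isAffineOpen_mem_and_subset (X := X) (x := x) (U := ⊤) trivial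
  rw [← hU.fromSpecStalk_eq_fromSpecStalk hx, IsAffineOpen.fromSpecStalk]
  have : Flat (Spec.map (X.presheaf.germ U x hx)) := by
    rw [Flat.SpecMap_iff]
    let := X.presheaf.algebra_section_stalk ⟨x, hx⟩
    have := hU.isLocalization_stalk ⟨x, hx⟩
    exact IsLocalization.flat (X.presheaf.stalk x) (hU.primeIdealOf ⟨x, hx⟩).asIdeal.primeCompl
  infer_instance

lemma specMap_comp_fromSpecStalk_injective {x : X} {R : CommRingCat.{u}}
    {φ ψ : X.presheaf.stalk x ⟶ R}
    (h : Spec.map φ ≫ X.fromSpecStalk x = Spec.map ψ ≫ X.fromSpecStalk x) : φ = ψ :=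
  Spec.map_injective ((cancel_mono (X.fromSpecStalk x)).1 h)

lemma mem_range_specMap_quotient {x : X} {I : Ideal (X.presheaf.stalk x)} (hI : I ≠ ⊤) :
    x ∈ Set.range (Spec.map (CommRingCat.ofHom (Ideal.Quotient.mk I)) ≫ X.fromSpecStalk x) := by
  have : Nontrivial (X.presheaf.stalk x ⧸ I) := Ideal.Quotient.nontrivial_iff.2 hI
  have : IsLocalHom (Ideal.Quotient.mk I) := .of_surjective _ Ideal.Quotient.mk_surjective
  have : IsLocalRing (X.presheaf.stalk x ⧸ I) :=
    .of_surjective' (Ideal.Quotient.mk I) Ideal.Quotient.mk_surjective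
  refine ⟨IsLocalRing.closedPoint (X.presheaf.stalk x ⧸ I), ?_⟩
  show X.fromSpecStalk _ (PrimeSpectrum.comap (Ideal.Quotient.mk I) _) = _
  rw [IsLocalRing.comap_closedPoint]
  exact Scheme.fromSpecStalk_closedPoint

variable {p : Z ⟶ X} {q : Z ⟶ Y} {a : X ⟶ S} {b : Y ⟶ S}

/-- An integral one-point scheme is the spectrum of a field, over which everything is flat; flatness
is stable under base change. -/
lemma flat_of_isPullback [Subsingleton S] [IsIntegral S] (h : IsPullback p q a b) : Flat p :=
  MorphismProperty.of_isPullback (P := @Flat) h.flip (inferInstanceAs (Flat b))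

/-- The base change of a preimmersion in one factor. -/
lemma exists_isPullback_left (h : IsPullback p q a b) {V : Scheme.{u}} (i : V ⟶ X)
    [IsPreimmersion i] : ∃ (W : Scheme.{u}) (g : W ⟶ Z) (s : W ⟶ V), IsPreimmersion g ∧
      IsPullback s (g ≫ q) (i ≫ a) b ∧ g ≫ p = s ≫ i ∧ Set.range g = {z | p z ∈ Set.range i} := by
  refine ⟨pullback p i, pullback.fst p i, pullback.snd p i, inferInstance, ?_, pullback.condition, ?_⟩
  · exact ((IsPullback.of_hasPullback p i).paste_horiz h.flip).flip
  · exact Scheme.Pullback.range_fst p i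

/-- The base change of preimmersions in both factors. -/
lemma exists_isPullback (h : IsPullback p q a b) {V V' : Scheme.{u}} (i : V ⟶ X) (j : V' ⟶ Y)
    [IsPreimmersion i] [IsPreimmersion j] :
    ∃ (T : Scheme.{u}) (g : T ⟶ Z) (s : T ⟶ V) (t : T ⟶ V'), IsPreimmersion g ∧
      IsPullback s t (i ≫ a) (j ≫ b) ∧ g ≫ p = s ≫ i ∧ g ≫ q = t ≫ j ∧
      Set.range g = {z | p z ∈ Set.range i ∧ q z ∈ Set.range j} := by
  obtain ⟨W, g, s, hg, hW, e, hr⟩ := exists_isPullback_left h i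
  obtain ⟨T, g', t, hg', hT, e', hr'⟩ := exists_isPullback_left hW.flip j
  refine ⟨T, g' ≫ g, g' ≫ s, t, inferInstance, hT.flip, ?_, ?_, ?_⟩
  · rw [Category.assoc, e, Category.assoc]
  · rw [Category.assoc, e']
  · ext z
    have hz : z ∈ Set.range g ↔ p z ∈ Set.range i := by rw [hr]; rfl
    constructor
    · rintro ⟨w, rfl⟩
      have hw : g' w ∈ {w | (g ≫ q) w ∈ Set.range j} := hr' ▸ ⟨w, rfl⟩
      exact ⟨hz.1 ⟨g' w, by simp⟩, by simpa using hw⟩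
    · rintro ⟨h1, h2⟩
      obtain ⟨w, rfl⟩ := hz.2 h1
      have hw : w ∈ Set.range g' := by rw [hr']; simpa using h2
      obtain ⟨w, rfl⟩ := hw
      exact ⟨w, by simp⟩

variable [Subsingleton S] [IsIntegral S]

/-- The fibre of `p` through `z` is the base change of `Spec κ(p z)` to `Y`, hence flat over `Y`,
and flat morphisms lift generizations. Working inside the fibre keeps `p z` fixed. -/
lemma exists_specializes_right (h : IsPullback p q a b) (z : Z) {y : Y} (hy : y ⤳ q z) :
    ∃ z', z' ⤳ z ∧ p z' = p z ∧ q z' = y := by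
  obtain ⟨W, g, s, hg, hW, e, hr⟩ := exists_isPullback_left h (X.fromSpecResidueField (p z))
  have hz : z ∈ Set.range g := by
    rw [hr]
    show p z ∈ Set.range _
    rw [Scheme.range_fromSpecResidueField]
    rfl
  obtain ⟨w, hw⟩ := hz
  have := flat_of_isPullback hW.flip
  have hy' : y ⤳ (g ≫ q) w := by simpa [hw] using hy
  obtain ⟨w', hw', hy'⟩ := Flat.generalizingMap (g ≫ q) hy'
  refine ⟨g w', hw ▸ hw'.map g.continuous, ?_, by simpa using hy'⟩
  have : g w' ∈ {z' | p z' ∈ Set.range (X.fromSpecResidueField (p z))} := hr ▸ ⟨w', rfl⟩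
  rw [Scheme.range_fromSpecResidueField] at this
  exact this

/-- Generizations lift to a product over a field, in both factors simultaneously. -/
lemma exists_specializes (h : IsPullback p q a b) (z : Z) {x : X} {y : Y} (hx : x ⤳ p z)
    (hy : y ⤳ q z) : ∃ z', z' ⤳ z ∧ p z' = x ∧ q z' = y := by
  obtain ⟨z₁, h1, h2, h3⟩ := exists_specializes_right h z hy
  obtain ⟨z₂, h4, h5, h6⟩ := exists_specializes_right h.flip z₁ (y := x) (h2 ▸ hx)
  exact ⟨z₂, h4.trans h1, h6, h5.trans h3⟩

/-- If the maximal ideal at a point of a product is generated by proper ideals of the local rings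
of the factors, then these ideals are the maximal ideals. -/
lemma maximalIdeal_le_of_le_sup (h : IsPullback p q a b) (z : Z)
    {I : Ideal (X.presheaf.stalk (p z))} {J : Ideal (Y.presheaf.stalk (q z))} (hI : I ≠ ⊤)
    (hJ : J ≠ ⊤) (hz : IsLocalRing.maximalIdeal (Z.presheaf.stalk z) ≤
      I.map (p.stalkMap z).hom ⊔ J.map (q.stalkMap z).hom) :
    IsLocalRing.maximalIdeal (X.presheaf.stalk (p z)) ≤ I := by
  have : Nontrivial (X.presheaf.stalk (p z) ⧸ I) := Ideal.Quotient.nontrivial_iff.2 hI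
  have : Nontrivial (Y.presheaf.stalk (q z) ⧸ J) := Ideal.Quotient.nontrivial_iff.2 hJ
  have hlI : IsLocalRing (X.presheaf.stalk (p z) ⧸ I) :=
    .of_surjective' (Ideal.Quotient.mk I) Ideal.Quotient.mk_surjective
  have hlJ : IsLocalRing (Y.presheaf.stalk (q z) ⧸ J) :=
    .of_surjective' (Ideal.Quotient.mk J) Ideal.Quotient.mk_surjective
  let i : Spec (.of (X.presheaf.stalk (p z) ⧸ I)) ⟶ X :=
    Spec.map (CommRingCat.ofHom (Ideal.Quotient.mk I)) ≫ X.fromSpecStalk (p z)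
  let j : Spec (.of (Y.presheaf.stalk (q z) ⧸ J)) ⟶ Y :=
    Spec.map (CommRingCat.ofHom (Ideal.Quotient.mk J)) ≫ Y.fromSpecStalk (q z)
  have : IsClosedImmersion (Spec.map (CommRingCat.ofHom (Ideal.Quotient.mk I))) :=
    IsClosedImmersion.spec_of_surjective _ Ideal.Quotient.mk_surjective
  have : IsClosedImmersion (Spec.map (CommRingCat.ofHom (Ideal.Quotient.mk J))) :=
    IsClosedImmersion.spec_of_surjective _ Ideal.Quotient.mk_surjective
  have hi : IsPreimmersion i := inferInstance
  have hj : IsPreimmersion j := inferInstance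
  obtain ⟨T, g, s, t, hg, hT, e, e', hr⟩ := exists_isPullback h i j
  have hx : p z ∈ Set.range i := mem_range_specMap_quotient hI
  have hy : q z ∈ Set.range j := mem_range_specMap_quotient hJ
  have hzr : z ∈ Set.range g := by rw [hr]; exact ⟨hx, hy⟩
  obtain ⟨v, rfl⟩ := hzr
  obtain ⟨ρ, hρ⟩ := Spec.map_surjective (T.fromSpecStalk v ≫ s)
  obtain ⟨σ, hσ⟩ := Spec.map_surjective (T.fromSpecStalk v ≫ t)
  have eρ : CommRingCat.ofHom (Ideal.Quotient.mk I) ≫ ρ = p.stalkMap (g v) ≫ g.stalkMap v := by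
    apply specMap_comp_fromSpecStalk_injective
    rw [Spec.map_comp, Spec.map_comp, hρ, Category.assoc, Category.assoc (Spec.map _),
      Scheme.SpecMap_stalkMap_fromSpecStalk, Scheme.SpecMap_stalkMap_fromSpecStalk_assoc, e,
      Category.assoc]
  have eσ : CommRingCat.ofHom (Ideal.Quotient.mk J) ≫ σ = q.stalkMap (g v) ≫ g.stalkMap v := by
    apply specMap_comp_fromSpecStalk_injective
    rw [Spec.map_comp, Spec.map_comp, hσ, Category.assoc, Category.assoc (Spec.map _),
      Scheme.SpecMap_stalkMap_fromSpecStalk, Scheme.SpecMap_stalkMap_fromSpecStalk_assoc, e',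
      Category.assoc]
  have eρ' : ∀ f, ρ.hom (Ideal.Quotient.mk I f) = g.stalkMap v (p.stalkMap (g v) f) := fun f =>
    congr($(eρ).hom f)
  have eσ' : ∀ f, σ.hom (Ideal.Quotient.mk J f) = g.stalkMap v (q.stalkMap (g v) f) := fun f =>
    congr($(eσ).hom f)
  have hloc : IsLocalHom ρ.hom := by
    refine ⟨fun f hf => ?_⟩
    obtain ⟨f, rfl⟩ := Ideal.Quotient.mk_surjective f
    rw [eρ'] at hf
    have h1 : IsUnit (p.stalkMap (g v) f) := isUnit_of_map_unit (g.stalkMap v).hom _ hf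
    exact (isUnit_of_map_unit (p.stalkMap (g v)).hom _ h1).map _
  have hflat : ρ.hom.Flat := by
    rw [← Flat.SpecMap_iff, hρ]
    have := flat_of_isPullback hT
    have := flat_fromSpecStalk v
    infer_instance
  -- The local ring of the product of the two quotient spectra is faithfully flat over `𝒪 / I`. The
  -- maximal ideal at the point dies in it, since `I` and `J` do, so the maximal ideal of the first
  -- factor dies in `𝒪 / I`.
  have hinj : Function.Injective ρ.hom := by
    algebraize [ρ.hom]
    have : IsLocalHom (algebraMap (X.presheaf.stalk (p (g v)) ⧸ I) (T.presheaf.stalk v)) := hloc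
    have : Module.FaithfullyFlat (X.presheaf.stalk (p (g v)) ⧸ I) (T.presheaf.stalk v) :=
      Module.FaithfullyFlat.of_flat_of_isLocalHom
    exact FaithfulSMul.algebraMap_injective _ _
  intro f hf
  rw [← Ideal.Quotient.eq_zero_iff_mem]
  refine hinj ?_
  rw [map_zero, eρ']
  have h1 : p.stalkMap (g v) f ∈ IsLocalRing.maximalIdeal (Z.presheaf.stalk (g v)) := by
    rw [IsLocalRing.mem_maximalIdeal, mem_nonunits_iff] at hf ⊢
    exact fun h => hf (isUnit_of_map_unit (p.stalkMap (g v)).hom _ h)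
  have h2 : I.map (p.stalkMap (g v)).hom ⊔ J.map (q.stalkMap (g v)).hom ≤
      RingHom.ker (g.stalkMap v).hom := by
    refine sup_le (Ideal.map_le_iff_le_comap.2 fun c hc => ?_)
      (Ideal.map_le_iff_le_comap.2 fun c hc => ?_)
    · show g.stalkMap v (p.stalkMap (g v) c) = 0
      rw [← eρ', Ideal.Quotient.eq_zero_iff_mem.2 hc, map_zero]
    · show g.stalkMap v (q.stalkMap (g v) c) = 0
      rw [← eσ', Ideal.Quotient.eq_zero_iff_mem.2 hc, map_zero]
  exact h2 (hz h1)

end Fibers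

/-! ### Generic points of the fibres over pairs of points. -/

section FiberPoints

variable {S X Y Z : Scheme.{u}} {p : Z ⟶ X} {q : Z ⟶ Y} {a : X ⟶ S} {b : Y ⟶ S}

/-- The points of a product over a given pair of points have a common generization if one of the
two is geometrically irreducible. -/
lemma exists_generic_point (h : IsPullback p q a b) (x : X) (y : Y)
    [GeometricallyIrreducible (X.fromSpecResidueField x ≫ a)] :
    ∃ z, p z = x ∧ q z = y ∧ ∀ z', p z' = x → q z' = y → z ⤳ z' := by
  obtain ⟨T, g, s, t, hg, hT, e, e', hr⟩ :=
    exists_isPullback h (X.fromSpecResidueField x) (Y.fromSpecResidueField y)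
  have : IrreducibleSpace T :=
    GeometricallyIrreducible.geometrically_irreducibleSpace (f := X.fromSpecResidueField x ≫ a)
      (K := Y.residueField y) (Y.fromSpecResidueField y ≫ b) s t hT
  rw [Scheme.range_fromSpecResidueField, Scheme.range_fromSpecResidueField] at hr
  have hη : g (genericPoint T) ∈ {z | p z ∈ ({x} : Set X) ∧ q z ∈ ({y} : Set Y)} := hr ▸ ⟨_, rfl⟩
  refine ⟨g (genericPoint T), hη.1, hη.2, fun z' hx hy => ?_⟩
  have hz' : z' ∈ Set.range g := by rw [hr]; exact ⟨hx, hy⟩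
  obtain ⟨v, rfl⟩ := hz'
  exact (genericPoint_specializes v).map g.continuous

/-- The ideal generated by the maximal ideals of the local rings of the factors. -/
def fiberIdeal (p : Z ⟶ X) (q : Z ⟶ Y) (z : Z) : Ideal (Z.presheaf.stalk z) :=
  (IsLocalRing.maximalIdeal (X.presheaf.stalk (p z))).map (p.stalkMap z).hom ⊔
    (IsLocalRing.maximalIdeal (Y.presheaf.stalk (q z))).map (q.stalkMap z).hom

lemma fiberIdeal_le (p : Z ⟶ X) (q : Z ⟶ Y) (z : Z) :
    fiberIdeal p q z ≤ IsLocalRing.maximalIdeal (Z.presheaf.stalk z) :=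
  sup_le (IsLocalRing.map_maximalIdeal_le (p.stalkMap z).hom)
    (IsLocalRing.map_maximalIdeal_le (q.stalkMap z).hom)

lemma eq_of_map_le_of_specializes {z z' : Z} (h : z' ⤳ z)
    (h' : ∀ f, f ∈ IsLocalRing.maximalIdeal (X.presheaf.stalk (p z)) →
      ¬ IsUnit (Z.presheaf.stalkSpecializes h (p.stalkMap z f))) : p z' = p z := by
  have h1 : p z' ⤳ p z := h.map p.continuous
  refine (h1.antisymm (specializes_of_forall_not_isUnit h1 specializes_rfl fun f hf hf' => ?_)).eq
  rw [TopCat.Presheaf.stalkSpecializes_refl] at hf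
  refine h' f ((IsLocalRing.mem_maximalIdeal f).2 hf) ?_
  rw [← Scheme.Hom.stalkSpecializes_stalkMap_apply p _ _ h]
  exact hf'.map (p.stalkMap z').hom

/-- At the generic point of the fibre over `(x, y)`, the ideal generated by the maximal ideals of
`x` and `y` is primary. -/
lemma maximalIdeal_le_radical_fiberIdeal {z : Z}
    (hz : ∀ z', p z' = p z → q z' = q z → z ⤳ z') :
    IsLocalRing.maximalIdeal (Z.presheaf.stalk z) ≤ (fiberIdeal p q z).radical := by
  rw [Ideal.radical_eq_sInf]
  refine le_sInf ?_
  rintro P ⟨hP, hPp⟩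
  obtain ⟨z', h, hP'⟩ := exists_generization P
  have h1 : p z' = p z := eq_of_map_le_of_specializes h fun f hf =>
    (hP' _).1 (hP (Ideal.mem_sup_left (Ideal.mem_map_of_mem (p.stalkMap z).hom hf)))
  have h2 : q z' = q z := eq_of_map_le_of_specializes h fun f hf =>
    (hP' _).1 (hP (Ideal.mem_sup_right (Ideal.mem_map_of_mem (q.stalkMap z).hom hf)))
  obtain rfl : z' = z := (h.antisymm (hz z' h1 h2)).eq
  intro f hf
  rw [hP', TopCat.Presheaf.stalkSpecializes_refl]
  exact (IsLocalRing.mem_maximalIdeal f).1 hf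

/-- The local ring of the fibre over `(x, y)` is the quotient by `fiberIdeal`. -/
lemma mem_fiberIdeal_of_stalkMap_eq_zero (h : IsPullback p q a b) {T : Scheme.{u}} {g : T ⟶ Z}
    [IsPreimmersion g] (v : T) {s : T ⟶ Spec (X.residueField (p (g v)))}
    {t : T ⟶ Spec (Y.residueField (q (g v)))}
    (hT : IsPullback s t (X.fromSpecResidueField (p (g v)) ≫ a)
      (Y.fromSpecResidueField (q (g v)) ≫ b))
    (e : g ≫ p = s ≫ X.fromSpecResidueField (p (g v)))
    (e' : g ≫ q = t ≫ Y.fromSpecResidueField (q (g v)))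
    {f : Z.presheaf.stalk (g v)} (hf : g.stalkMap v f = 0) : f ∈ fiberIdeal p q (g v) := by
  set N := fiberIdeal p q (g v) with hN
  have hNtop : N ≠ ⊤ := fun htop => (IsLocalRing.maximalIdeal.isMaximal _).ne_top
    (top_le_iff.1 (htop.ge.trans (fiberIdeal_le p q (g v))))
  have : Nontrivial (Z.presheaf.stalk (g v) ⧸ N) := Ideal.Quotient.nontrivial_iff.2 hNtop
  have : IsLocalHom (Ideal.Quotient.mk N) := .of_surjective _ Ideal.Quotient.mk_surjective
  have : IsLocalRing (Z.presheaf.stalk (g v) ⧸ N) :=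
    .of_surjective' (Ideal.Quotient.mk N) Ideal.Quotient.mk_surjective
  let D : CommRingCat.{u} := .of (Z.presheaf.stalk (g v) ⧸ N)
  have : IsLocalRing D := inferInstanceAs (IsLocalRing (Z.presheaf.stalk (g v) ⧸ N))
  let mk : Z.presheaf.stalk (g v) ⟶ D := CommRingCat.ofHom (Ideal.Quotient.mk N)
  have hmk : ∀ f, mk f = 0 ↔ f ∈ N := fun f => Ideal.Quotient.eq_zero_iff_mem
  let δ : Spec D ⟶ Z := Spec.map mk ≫ Z.fromSpecStalk (g v)
  have hδ : δ (IsLocalRing.closedPoint D) = g v := by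
    show Z.fromSpecStalk _ (PrimeSpectrum.comap (Ideal.Quotient.mk N) _) = _
    rw [IsLocalRing.comap_closedPoint]
    exact Scheme.fromSpecStalk_closedPoint
  let σ : X.residueField (p (g v)) ⟶ D := CommRingCat.ofHom
    (Ideal.Quotient.lift _ (p.stalkMap (g v) ≫ mk).hom fun f hf =>
      (hmk _).2 (Ideal.mem_sup_left (Ideal.mem_map_of_mem (p.stalkMap (g v)).hom hf)))
  let τ : Y.residueField (q (g v)) ⟶ D := CommRingCat.ofHom
    (Ideal.Quotient.lift _ (q.stalkMap (g v) ≫ mk).hom fun f hf =>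
      (hmk _).2 (Ideal.mem_sup_right (Ideal.mem_map_of_mem (q.stalkMap (g v)).hom hf)))
  have hσ : X.residue _ ≫ σ = p.stalkMap (g v) ≫ mk := by ext f; rfl
  have hτ : Y.residue _ ≫ τ = q.stalkMap (g v) ≫ mk := by ext f; rfl
  have hσ' : Spec.map σ ≫ X.fromSpecResidueField (p (g v)) = δ ≫ p := by
    rw [Scheme.fromSpecResidueField, ← Spec.map_comp_assoc, hσ, Spec.map_comp_assoc,
      Scheme.SpecMap_stalkMap_fromSpecStalk, Category.assoc]
  have hτ' : Spec.map τ ≫ Y.fromSpecResidueField (q (g v)) = δ ≫ q := by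
    rw [Scheme.fromSpecResidueField, ← Spec.map_comp_assoc, hτ, Spec.map_comp_assoc,
      Scheme.SpecMap_stalkMap_fromSpecStalk, Category.assoc]
  -- Modulo `fiberIdeal` the two local rings act through their residue fields, so the universal
  -- property of the fibre `T` gives `Spec D ⟶ T`. Thus the quotient map to `D` factors through the
  -- local ring of `T`, and whatever vanishes there lies in `fiberIdeal`.
  let ε : Spec D ⟶ T := hT.lift (Spec.map σ) (Spec.map τ) (by
    rw [← Category.assoc, hσ', ← Category.assoc, hτ', Category.assoc δ p, h.w, Category.assoc δ q])
  have hε : ε ≫ g = δ := by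
    apply h.hom_ext
    · rw [Category.assoc, e, hT.lift_fst_assoc, hσ']
    · rw [Category.assoc, e', hT.lift_snd_assoc, hτ']
  have hεv : ε (IsLocalRing.closedPoint D) = v := by
    apply g.isEmbedding.injective
    exact (congrArg (fun φ : Spec D ⟶ Z => φ (IsLocalRing.closedPoint D)) hε).trans hδ
  obtain ⟨θ, hθ⟩ : ∃ θ : T.presheaf.stalk v ⟶ D, Spec.map θ ≫ T.fromSpecStalk v = ε := by
    rw [← hεv]
    exact ⟨_, Scheme.Spec_stalkClosedPointTo_fromSpecStalk ε⟩
  have hcomp : g.stalkMap v ≫ θ = mk := by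
    apply specMap_comp_fromSpecStalk_injective
    rw [Spec.map_comp_assoc, Scheme.SpecMap_stalkMap_fromSpecStalk, ← Category.assoc, hθ, hε]
  rw [← hmk, ← hcomp]
  show θ (g.stalkMap v f) = 0
  rw [hf, map_zero]

/-- If the fibre over `(x, y)` is reduced, then its generic point has maximal ideal generated by
those of `x` and `y`. -/
lemma fiberIdeal_eq_of_isReduced (h : IsPullback p q a b) {z : Z}
    (hz : ∀ z', p z' = p z → q z' = q z → z ⤳ z')
    (hred : IsReduced (pullback (X.fromSpecResidueField (p z) ≫ a)
      (Y.fromSpecResidueField (q z) ≫ b))) :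
    fiberIdeal p q z = IsLocalRing.maximalIdeal (Z.presheaf.stalk z) := by
  refine le_antisymm (fiberIdeal_le p q z) fun f hf => ?_
  -- Some power of `f` is in `fiberIdeal`, hence zero in the reduced local ring of the fibre, so `f`
  -- itself vanishes there.
  obtain ⟨n, hn⟩ := maximalIdeal_le_radical_fiberIdeal hz hf
  obtain ⟨T, g, s, t, hg, hT, e, e', hr⟩ :=
    exists_isPullback h (X.fromSpecResidueField (p z)) (Y.fromSpecResidueField (q z))
  have hT' : IsReduced T := isReduced_of_isOpenImmersion hT.isoPullback.hom
  have hzr : z ∈ Set.range g := by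
    rw [hr, Scheme.range_fromSpecResidueField, Scheme.range_fromSpecResidueField]
    exact ⟨rfl, rfl⟩
  obtain ⟨v, rfl⟩ := hzr
  refine mem_fiberIdeal_of_stalkMap_eq_zero h v hT e e' ?_
  have hz0 : ∀ f ∈ fiberIdeal p q (g v), g.stalkMap v f = 0 := by
    obtain ⟨ρ, hρ⟩ := Spec.map_surjective (T.fromSpecStalk v ≫ s)
    obtain ⟨σ, hσ⟩ := Spec.map_surjective (T.fromSpecStalk v ≫ t)
    have eρ : X.residue _ ≫ ρ = p.stalkMap (g v) ≫ g.stalkMap v := by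
      apply specMap_comp_fromSpecStalk_injective
      rw [Spec.map_comp, Spec.map_comp, hρ, Category.assoc, Category.assoc (Spec.map _),
        Scheme.SpecMap_stalkMap_fromSpecStalk, Scheme.SpecMap_stalkMap_fromSpecStalk_assoc, e,
        Category.assoc]
      rfl
    have eσ : Y.residue _ ≫ σ = q.stalkMap (g v) ≫ g.stalkMap v := by
      apply specMap_comp_fromSpecStalk_injective
      rw [Spec.map_comp, Spec.map_comp, hσ, Category.assoc, Category.assoc (Spec.map _),
        Scheme.SpecMap_stalkMap_fromSpecStalk, Scheme.SpecMap_stalkMap_fromSpecStalk_assoc, e',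
        Category.assoc]
      rfl
    have : fiberIdeal p q (g v) ≤ RingHom.ker (g.stalkMap v).hom := by
      refine sup_le (Ideal.map_le_iff_le_comap.2 fun c hc => ?_)
        (Ideal.map_le_iff_le_comap.2 fun c hc => ?_)
      · refine (congr($(eρ).hom c) : ρ (X.residue _ c) = g.stalkMap v (p.stalkMap _ c)).symm.trans ?_
        have : X.residue (p (g v)) c = 0 := Ideal.Quotient.eq_zero_iff_mem.2 hc
        rw [this, map_zero]
      · refine (congr($(eσ).hom c) : σ (Y.residue _ c) = g.stalkMap v (q.stalkMap _ c)).symm.trans ?_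
        have : Y.residue (q (g v)) c = 0 := Ideal.Quotient.eq_zero_iff_mem.2 hc
        rw [this, map_zero]
    exact this
  have h1 := hz0 _ hn
  rw [map_pow] at h1
  exact eq_zero_of_pow_eq_zero h1

/-- If the quotient by `fiberIdeal` is regular, then `fiberIdeal` is the maximal ideal at the
generic point of the fibre. -/
lemma fiberIdeal_eq_of_isRegularLocalRing {z : Z}
    (hz : ∀ z', p z' = p z → q z' = q z → z ⤳ z')
    (hreg : IsRegularLocalRing (Z.presheaf.stalk z ⧸ fiberIdeal p q z)) :
    fiberIdeal p q z = IsLocalRing.maximalIdeal (Z.presheaf.stalk z) := by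
  set N := fiberIdeal p q z
  have hle : N ≤ IsLocalRing.maximalIdeal (Z.presheaf.stalk z) := fiberIdeal_le p q z
  have hmax := maximalIdeal_le_radical_fiberIdeal hz
  -- Since `N` is primary to the maximal ideal, the quotient has dimension zero; being regular, its
  -- maximal ideal is then generated by no elements.
  have hdim : ringKrullDim (Z.presheaf.stalk z ⧸ N) ≤ 0 := by
    have : Ring.KrullDimLE 0 (Z.presheaf.stalk z ⧸ N) := by
      refine Ring.krullDimLE_zero_iff.2 fun I hI => ?_
      have hI' : I.comap (Ideal.Quotient.mk N) = IsLocalRing.maximalIdeal _ := by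
        refine le_antisymm (IsLocalRing.le_maximalIdeal (Ideal.IsPrime.ne_top inferInstance)) ?_
        refine hmax.trans ((Ideal.radical_mono (J := I.comap (Ideal.Quotient.mk N)) ?_).trans
          (Ideal.IsPrime.radical inferInstance).le)
        intro f hf
        rw [Ideal.mem_comap, Ideal.Quotient.eq_zero_iff_mem.2 hf]
        exact zero_mem _
      have := Ideal.map_comap_of_surjective (Ideal.Quotient.mk N) Ideal.Quotient.mk_surjective I
      rw [← this, hI']
      refine Ideal.IsMaximal.map_of_surjective_of_ker_le Ideal.Quotient.mk_surjective ?_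
      rw [Ideal.mk_ker]
      exact hle
    exact_mod_cast Ring.krullDimLE_iff.1 this
  have h0 := hreg.spanFinrank_maximalIdeal
  have h1 : (IsLocalRing.maximalIdeal (Z.presheaf.stalk z ⧸ N)).spanFinrank = 0 := by
    rw [← h0] at hdim
    exact_mod_cast Nat.le_zero.1 (by exact_mod_cast hdim)
  have h2 : IsLocalRing.maximalIdeal (Z.presheaf.stalk z ⧸ N) = ⊥ :=
    (Submodule.spanFinrank_eq_zero_iff_eq_bot (IsNoetherian.noetherian _)).1 h1
  refine le_antisymm hle fun f hf => ?_
  rw [← Ideal.Quotient.eq_zero_iff_mem, ← Ideal.mem_bot, ← h2, IsLocalRing.mem_maximalIdeal]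
  intro hu
  have : IsLocalHom (Ideal.Quotient.mk N) := .of_surjective _ Ideal.Quotient.mk_surjective
  exact (IsLocalRing.mem_maximalIdeal f).1 hf (isUnit_of_map_unit (Ideal.Quotient.mk N) f hu)

end FiberPoints

/-! ### Geometric reducedness over a perfect field. -/

section Reduced

open scoped TensorProduct

/-- Flatness of `K` embeds `T ⊗ K` into `Frac T ⊗ K`, which is unramified and essentially of finite
type over a field, hence reduced. -/
lemma isReduced_tensorProduct_of_formallyUnramified (R T K : Type*) [CommRing R] [CommRing T]
    [CommRing K] [Algebra R T] [Algebra R K] [IsDomain T] [Algebra.FormallyUnramified R K]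
    [Algebra.EssFiniteType R K] [Module.Flat R K] : IsReduced (T ⊗[R] K) := by
  have : IsReduced (FractionRing T ⊗[R] K) :=
    Algebra.FormallyUnramified.isReduced_of_field (FractionRing T) _
  exact isReduced_of_injective
    (Algebra.TensorProduct.map (IsScalarTower.toAlgHom R T (FractionRing T)) (AlgHom.id R K))
    (Module.Flat.rTensor_preserves_injective_linearMap (M := K)
      (IsScalarTower.toAlgHom R T (FractionRing T)).toLinearMap
      (IsFractionRing.injective T (FractionRing T)))

open scoped IntermediateField.algebraAdjoinAdjoin in
/-- Finitely generated field extensions of a perfect field are geometrically reduced. -/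
lemma isReduced_tensorProduct_of_perfectField (k K L : Type u) [Field k] [Field K] [Field L]
    [Algebra k K] [Algebra k L] [PerfectField k] [Algebra.EssFiniteType k K] :
    IsReduced (K ⊗[k] L) := by
  -- With a separating transcendence basis `s`, `K` is flat and unramified over the polynomial ring
  -- `R = k[s]`, while `R ⊗ L = L[s]` is a domain. So `K ⊗ L = (R ⊗ L) ⊗_R K` is covered by the
  -- previous lemma.
  obtain ⟨s, hs, hsep⟩ := exists_isTranscendenceBasis_and_isSeparable_of_perfectField k K
  let R := Algebra.adjoin k (s : Set K)
  let F := IntermediateField.adjoin k (s : Set K)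
  have : Algebra.FormallyUnramified R F := .of_isLocalization (nonZeroDivisors R)
  have : Algebra.FormallyUnramified F K := Algebra.FormallyUnramified.of_isSeparable F K
  have : Algebra.FormallyUnramified R K := .comp R F K
  have : Algebra.EssFiniteType R K := .of_comp k R K
  have : Module.Flat R F := IsLocalization.flat F (nonZeroDivisors R)
  have : Module.Flat R K := Module.Flat.trans R F K
  have hind : AlgebraicIndependent k ((↑) : s → K) := hs.1
  let e : MvPolynomial s k ≃ₐ[k] R := hind.aevalEquiv.trans
    (Subalgebra.equivOfEq _ _ (by simp [R]))
  have : IsDomain (R ⊗[k] L) := by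
    let e' : R ⊗[k] L ≃ₐ[k] MvPolynomial s L :=
      (Algebra.TensorProduct.congr e.symm AlgEquiv.refl).trans
        ((Algebra.TensorProduct.comm k _ _).trans
          ((MvPolynomial.algebraTensorAlgEquiv k L).restrictScalars k))
    exact e'.injective.isDomain e'.toRingEquiv.toRingHom
  have h1 := isReduced_tensorProduct_of_formallyUnramified R (R ⊗[k] L) K
  let e'' : K ⊗[k] L ≃+* (R ⊗[k] L) ⊗[R] K :=
    (Algebra.TensorProduct.cancelBaseChange k R K K L).symm.toRingEquiv.trans
      (Algebra.TensorProduct.comm R _ _).toRingEquiv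
  exact isReduced_of_injective e'' e''.injective

end Reduced

/-! ### Reducedness of fibres and dimensions of local rings of products. -/

section

variable {S X Y Z : Scheme.{u}} {p : Z ⟶ X} {q : Z ⟶ Y}

lemma essFiniteType_toStalk {R : CommRingCat.{u}} (x : PrimeSpectrum R) :
    (StructureSheaf.toStalk R x).hom.EssFiniteType :=
  RingHom.essFiniteType_algebraMap.2 (Algebra.EssFiniteType.of_isLocalization
    ((Spec.structureSheaf R).presheaf.stalk x) x.asIdeal.primeCompl)

lemma isReduced_pullback_fromSpecResidueField {k : Type u} [Field k] [PerfectField k]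
    (a : X ⟶ Spec (.of k)) (b : Y ⟶ Spec (.of k)) [LocallyOfFiniteType a] (x : X) (y : Y) :
    IsReduced (pullback (X.fromSpecResidueField x ≫ a) (Y.fromSpecResidueField y ≫ b)) := by
  obtain ⟨φ, hφ⟩ := Spec.map_surjective (X.fromSpecResidueField x ≫ a)
  obtain ⟨ψ, hψ⟩ := Spec.map_surjective (Y.fromSpecResidueField y ≫ b)
  have hess : φ.hom.EssFiniteType := by
    obtain ⟨ρ, hρ, hρ'⟩ : ∃ ρ : CommRingCat.of k ⟶ (Spec (.of k)).presheaf.stalk (a x),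
        ρ.hom.EssFiniteType ∧ Spec.map ρ = (Spec (.of k)).fromSpecStalk (a x) := by
      refine ⟨StructureSheaf.toStalk _ (a x), essFiniteType_toStalk (R := .of k) (a x),
        (Spec.fromSpecStalk_eq _ _).symm⟩
    have : φ = ρ ≫ a.stalkMap x ≫ X.residue x := by
      apply Spec.map_injective
      rw [hφ, Spec.map_comp, Spec.map_comp, Category.assoc, hρ',
        Scheme.SpecMap_stalkMap_fromSpecStalk]
      rfl
    rw [this, CommRingCat.hom_comp, CommRingCat.hom_comp]
    have hres : (X.residue x).hom.EssFiniteType := RingHom.FiniteType.essFiniteType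
      (RingHom.FiniteType.of_surjective _ Ideal.Quotient.mk_surjective)
    exact (hρ.comp (LocallyOfFiniteType.stalkMap a x)).comp hres
  algebraize [φ.hom, ψ.hom]
  have := isReduced_tensorProduct_of_perfectField k (X.residueField x) (Y.residueField y)
  rw [← hφ, ← hψ]
  exact isReduced_of_isOpenImmersion
    (pullbackSpecIso k (X.residueField x) (Y.residueField y)).hom

/-- Flatness gives going down, and then the height of the maximal ideal of `S` is the sum of the
heights in the base and in the fibre. -/
lemma ringKrullDim_add_quotient_le {R S : Type*} [CommRing R] [CommRing S] [IsLocalRing R]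
    [IsLocalRing S] [Algebra R S] [IsLocalHom (algebraMap R S)] [Module.Flat R S]
    [IsNoetherianRing R] [IsNoetherianRing S] :
    ringKrullDim R + ringKrullDim (S ⧸ (IsLocalRing.maximalIdeal R).map (algebraMap R S)) ≤
      ringKrullDim S := by
  set m := IsLocalRing.maximalIdeal R
  set n := IsLocalRing.maximalIdeal S
  have hle : m.map (algebraMap R S) ≤ n := IsLocalRing.map_maximalIdeal_le (algebraMap R S)
  have : n.LiesOver m := ⟨(IsLocalRing.maximalIdeal_comap (algebraMap R S)).symm⟩
  have hntop : m.map (algebraMap R S) ≠ ⊤ := fun htop =>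
    (IsLocalRing.maximalIdeal.isMaximal S).ne_top (top_le_iff.1 (htop.ge.trans hle))
  have : Nontrivial (S ⧸ m.map (algebraMap R S)) := Ideal.Quotient.nontrivial_iff.2 hntop
  have : IsLocalRing (S ⧸ m.map (algebraMap R S)) :=
    .of_surjective' (Ideal.Quotient.mk _) Ideal.Quotient.mk_surjective
  have h := Ideal.height_eq_height_add_of_liesOver_of_hasGoingDown m n
  have h' : n.map (Ideal.Quotient.mk (m.map (algebraMap R S))) = IsLocalRing.maximalIdeal _ := by
    refine IsLocalRing.eq_maximalIdeal (Ideal.IsMaximal.map_of_surjective_of_ker_le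
      Ideal.Quotient.mk_surjective ?_)
    rw [Ideal.mk_ker]
    exact hle
  rw [h'] at h
  rw [← IsLocalRing.maximalIdeal_height_eq_ringKrullDim,
    ← IsLocalRing.maximalIdeal_height_eq_ringKrullDim,
    ← IsLocalRing.maximalIdeal_height_eq_ringKrullDim, ← WithBot.coe_add]
  exact WithBot.coe_le_coe.2 h.ge

lemma ringKrullDim_stalk_add_le (f : X ⟶ Y) [Flat f] (x : X)
    [IsNoetherianRing (X.presheaf.stalk x)] [IsNoetherianRing (Y.presheaf.stalk (f x))] :
    ringKrullDim (Y.presheaf.stalk (f x)) + ringKrullDim (X.presheaf.stalk x ⧸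
      (IsLocalRing.maximalIdeal (Y.presheaf.stalk (f x))).map (f.stalkMap x).hom) ≤
      ringKrullDim (X.presheaf.stalk x) := by
  have hf : (f.stalkMap x).hom.Flat := Flat.stalkMap f x
  have hl : IsLocalHom (f.stalkMap x).hom := inferInstance
  algebraize [(f.stalkMap x).hom]
  have : IsLocalHom (algebraMap (Y.presheaf.stalk (f x)) (X.presheaf.stalk x)) := hl
  exact ringKrullDim_add_quotient_le

lemma ringKrullDim_stalk_le (f : X ⟶ Y) [Flat f] (x : X) [IsNoetherianRing (X.presheaf.stalk x)]
    [IsNoetherianRing (Y.presheaf.stalk (f x))] :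
    ringKrullDim (Y.presheaf.stalk (f x)) ≤ ringKrullDim (X.presheaf.stalk x) := by
  have : Nontrivial (X.presheaf.stalk x ⧸
      (IsLocalRing.maximalIdeal (Y.presheaf.stalk (f x))).map (f.stalkMap x).hom) :=
    Ideal.Quotient.nontrivial_iff.2 fun htop =>
      (IsLocalRing.maximalIdeal.isMaximal (X.presheaf.stalk x)).ne_top
        (top_le_iff.1 (htop.ge.trans (IsLocalRing.map_maximalIdeal_le (f.stalkMap x).hom)))
  exact (le_add_of_nonneg_right ringKrullDim_nonneg_of_nontrivial).trans
    (ringKrullDim_stalk_add_le f x)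

/-- Flatness of `p` adds the dimension of the fibre ring to that of the base. The fibre is itself
flat over `Y`, so its local dimension is at least that of the local ring on `Y`. This supplies the
dimension bound on the product without log-regularity there. -/
lemma ringKrullDim_add_le_of_isPullback {a : X ⟶ S} {b : Y ⟶ S} [Subsingleton S] [IsIntegral S]
    (h : IsPullback p q a b) (z : Z) [IsNoetherianRing (X.presheaf.stalk (p z))]
    [IsNoetherianRing (Y.presheaf.stalk (q z))] [IsNoetherianRing (Z.presheaf.stalk z)] :
    ringKrullDim (X.presheaf.stalk (p z)) + ringKrullDim (Y.presheaf.stalk (q z)) ≤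
      ringKrullDim (Z.presheaf.stalk z) := by
  have := flat_of_isPullback h
  refine le_trans ?_ (ringKrullDim_stalk_add_le p z)
  obtain ⟨W, g, s, hg, hW, e, hr⟩ := exists_isPullback_left h (X.fromSpecResidueField (p z))
  have hz : z ∈ Set.range g := by
    rw [hr]
    show p z ∈ Set.range _
    rw [Scheme.range_fromSpecResidueField]
    rfl
  obtain ⟨w, rfl⟩ := hz
  have hsurj : Function.Surjective (g.stalkMap w).hom := g.stalkMap_surjective w
  have : IsNoetherianRing (W.presheaf.stalk w) := isNoetherianRing_of_surjective _ _ _ hsurj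
  have := flat_of_isPullback hW.flip
  have : IsNoetherianRing (Y.presheaf.stalk ((g ≫ q) w)) :=
    inferInstanceAs (IsNoetherianRing (Y.presheaf.stalk (q (g w))))
  gcongr
  refine (ringKrullDim_stalk_le (g ≫ q) w).trans ?_
  have hker : (IsLocalRing.maximalIdeal (X.presheaf.stalk (p (g w)))).map
      (p.stalkMap (g w)).hom ≤ RingHom.ker (g.stalkMap w).hom := by
    obtain ⟨ρ, hρ⟩ := Spec.map_surjective (W.fromSpecStalk w ≫ s)
    have eρ : X.residue _ ≫ ρ = p.stalkMap (g w) ≫ g.stalkMap w := by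
      apply specMap_comp_fromSpecStalk_injective
      rw [Spec.map_comp, Spec.map_comp, hρ, Category.assoc, Category.assoc (Spec.map _),
        Scheme.SpecMap_stalkMap_fromSpecStalk, Scheme.SpecMap_stalkMap_fromSpecStalk_assoc, e,
        Category.assoc]
      rfl
    refine Ideal.map_le_iff_le_comap.2 fun c hc => ?_
    refine (congr($(eρ).hom c) : ρ (X.residue _ c) = g.stalkMap w (p.stalkMap _ c)).symm.trans ?_
    have : X.residue (p (g w)) c = 0 := Ideal.Quotient.eq_zero_iff_mem.2 hc
    rw [this, map_zero]
  exact ringKrullDim_le_of_surjective (Ideal.Quotient.lift _ (g.stalkMap w).hom hker)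
    (Ideal.Quotient.lift_surjective_of_surjective _ hker hsurj)

end

/-! ### Products of log structures and of fs log schemes. -/

lemma IsFsMonoid.prod {P Q : Type u} [CommMonoid P] [CommMonoid Q] (hP : IsFsMonoid P)
    (hQ : IsFsMonoid Q) : IsFsMonoid (P × Q) where
  fg := by
    have := hP.fg
    have := hQ.fg
    infer_instance
  cancel := by
    have := hP.cancel
    have := hQ.cancel
    infer_instance
  saturated a b n hn h := by
    obtain ⟨c, hc⟩ := h
    obtain ⟨d, hd⟩ := hP.saturated a.1 b.1 n hn ⟨c.1, congrArg Prod.fst hc⟩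
    obtain ⟨e, he⟩ := hQ.saturated a.2 b.2 n hn ⟨c.2, congrArg Prod.snd hc⟩
    exact ⟨(d, e), Prod.ext hd he⟩

namespace LogStructure

variable {X Y Z : Scheme.{u}} (p : Z ⟶ X) (q : Z ⟶ Y) (M : LogStructure X) (N : LogStructure Y)

/-- The submonoid of the stalk generated by the units and by the images of two log structures. -/
def prodStalk (z : Z) : Submonoid (Z.presheaf.stalk z) where
  carrier := {f | ∃ m ∈ M.stalk (p z), ∃ n ∈ N.stalk (q z), ∃ u : Z.presheaf.stalk z, IsUnit u ∧
    f = p.stalkMap z m * q.stalkMap z n * u}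
  one_mem' := ⟨1, one_mem _, 1, one_mem _, 1, isUnit_one, by simp⟩
  mul_mem' := by
    rintro _ _ ⟨m, hm, n, hn, u, hu, rfl⟩ ⟨m', hm', n', hn', u', hu', rfl⟩
    refine ⟨m * m', mul_mem hm hm', n * n', mul_mem hn hn', u * u', hu.mul hu', ?_⟩
    rw [map_mul, map_mul]
    ring

/-- The log structure on `Z` generated by the pullbacks of two log structures. -/
def prod : LogStructure Z where
  sections U :=
    { carrier := {s | ∀ (z : Z) (hz : z ∈ U), Z.presheaf.germ U z hz s ∈ prodStalk p q M N z}
      one_mem' := fun z hz => by rw [map_one]; exact one_mem _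
      mul_mem' := fun h h' z hz => by rw [map_mul]; exact mul_mem (h z hz) (h' z hz) }
  unit_mem U s hs z hz := ⟨1, one_mem _, 1, one_mem _, _, hs.map (Z.presheaf.germ U z hz).hom, by
    simp⟩
  res_mem U V h s hs z hz := by
    rw [Z.presheaf.germ_res_apply (homOfLE h) z hz s]
    exact hs z (h hz)
  mem_of_local U s hs z hz := by
    obtain ⟨V, h, hzV, h'⟩ := hs z hz
    have := h' z hzV
    rwa [Z.presheaf.germ_res_apply (homOfLE h) z hzV s] at this

variable {p q M N}

lemma stalk_prod (z : Z) : (prod p q M N).stalk z = prodStalk p q M N z := by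
  refine le_antisymm ?_ ?_
  · rintro _ ⟨U, hz, s, hs, rfl⟩
    exact hs z hz
  · rintro _ ⟨_, ⟨U, hU, s, hs, rfl⟩, _, ⟨V, hV, t, ht, rfl⟩, f, hf, rfl⟩
    refine mul_mem (mul_mem ?_ ?_) ((prod p q M N).mem_stalk_of_isUnit hf)
    · refine ⟨p ⁻¹ᵁ U, hU, p.app U s, fun z' hz' => ?_, ?_⟩
      · refine ⟨_, M.germ_mem_stalk hs hz', 1, one_mem _, 1, isUnit_one, ?_⟩
        rw [map_one, mul_one, mul_one]
        exact (Scheme.Hom.germ_stalkMap_apply p U z' hz' s).symm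
      · exact (Scheme.Hom.germ_stalkMap_apply p U z hU s).symm
    · refine ⟨q ⁻¹ᵁ V, hV, q.app V t, fun z' hz' => ?_, ?_⟩
      · refine ⟨1, one_mem _, _, N.germ_mem_stalk ht hz', 1, isUnit_one, ?_⟩
        rw [map_one, one_mul, mul_one]
        exact (Scheme.Hom.germ_stalkMap_apply q V z' hz' t).symm
      · exact (Scheme.Hom.germ_stalkMap_apply q V z hV t).symm

end LogStructure

/-- The morphism is a variable with an equation because in the application it is only provably the
identity; substitution removes the mismatch of open sets. -/
lemma LogStructure.stalk_le_stalk_of_eq_id {Z : Scheme.{u}} {M N : LogStructure Z} (g : Z ⟶ Z)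
    (hg : g = 𝟙 Z) (h : ∀ (U : Z.Opens) (s : Γ(Z, U)), s ∈ M.sections U →
      g.app U s ∈ N.sections (g ⁻¹ᵁ U)) (z : Z) : M.stalk z ≤ N.stalk z := by
  subst hg
  rintro _ ⟨U, hz, s, hs, rfl⟩
  have := h U s hs
  rw [Scheme.Hom.id_app] at this
  exact ⟨U, hz, s, this, rfl⟩

section Flat

variable {X Y Z S : Scheme.{u}} {p : Z ⟶ X} {q : Z ⟶ Y} {a : X ⟶ S} {b : Y ⟶ S}

lemma mem_nonZeroDivisors_stalkMap (f : X ⟶ Y) [Flat f] (x : X) {r : Y.presheaf.stalk (f x)}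
    (hr : r ∈ nonZeroDivisors (Y.presheaf.stalk (f x))) :
    f.stalkMap x r ∈ nonZeroDivisors (X.presheaf.stalk x) := by
  have hf : (f.stalkMap x).hom.Flat := Flat.stalkMap f x
  algebraize [(f.stalkMap x).hom]
  have h := Module.Flat.isSMulRegular_of_nonZeroDivisors (M := X.presheaf.stalk x) hr
  refine mem_nonZeroDivisors_iff_right.2 fun s hs => h ?_
  show r • s = r • 0
  rw [smul_zero, Algebra.smul_def, mul_comm]
  exact hs

lemma dvd_of_stalkMap_dvd (f : X ⟶ Y) [Flat f] (x : X) {r s : Y.presheaf.stalk (f x)}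
    (h : f.stalkMap x r ∣ f.stalkMap x s) : r ∣ s := by
  have hf : (f.stalkMap x).hom.Flat := Flat.stalkMap f x
  have hl : IsLocalHom (f.stalkMap x).hom := inferInstance
  algebraize [(f.stalkMap x).hom]
  have : IsLocalHom (algebraMap (Y.presheaf.stalk (f x)) (X.presheaf.stalk x)) := hl
  have : Module.FaithfullyFlat (Y.presheaf.stalk (f x)) (X.presheaf.stalk x) :=
    Module.FaithfullyFlat.of_flat_of_isLocalHom
  rw [← Ideal.mem_span_singleton, ← Ideal.comap_map_eq_self_of_faithfullyFlat
    (B := X.presheaf.stalk x) (Ideal.span {r}), Ideal.mem_comap, Ideal.map_span,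
    Set.image_singleton, Ideal.mem_span_singleton]
  exact h

lemma stalkSpecializes_ne_zero [IsIntegral X] {x y : X} (h : y ⤳ x) {f : X.presheaf.stalk x}
    (hf : f ≠ 0) : X.presheaf.stalkSpecializes h f ≠ 0 := by
  intro e
  obtain ⟨s, hs, e'⟩ := exists_mul_eq_zero h e
  rcases mul_eq_zero.1 e' with rfl | e'
  · rw [map_zero] at hs
    exact not_isUnit_zero hs
  · exact hf e'

lemma isUnit_of_eq_genericPoint [IsIntegral X] {η : X} (hη : η = genericPoint X)
    {f : X.presheaf.stalk η} (hf : f ≠ 0) : IsUnit f := by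
  subst hη
  exact IsUnit.mk0 (G₀ := X.functionField) f hf

lemma dvd_of_stalkSpecializes_dvd_of_eq {x y : X} (h : y ⤳ x) (e : y = x)
    {r s : X.presheaf.stalk x}
    (hrs : X.presheaf.stalkSpecializes h r ∣ X.presheaf.stalkSpecializes h s) : r ∣ s := by
  subst e
  rwa [TopCat.Presheaf.stalkSpecializes_refl] at hrs

/-- Elements of the local ring at a point of `X` that agree in a product up to units and up to
functions on `Y` agree up to units. -/
lemma dvd_of_stalkMap_mul_dvd [Subsingleton S] [IsIntegral S] [IsIntegral Y]
    (h : IsPullback p q a b) (z : Z) {m m' : X.presheaf.stalk (p z)}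
    {n n' : Y.presheaf.stalk (q z)} (hn' : n' ≠ 0)
    (e : p.stalkMap z m * q.stalkMap z n ∣ p.stalkMap z m' * q.stalkMap z n') : m ∣ m' := by
  have := flat_of_isPullback h
  -- Generizing in the `Y`-direction to the generic point turns `n'` into a unit without moving `p
  -- z`; faithful flatness of `p` then descends divisibility to `X`.
  obtain ⟨z', hz, hx, hy⟩ := exists_specializes_right h z (genericPoint_specializes (q z))
  refine dvd_of_stalkSpecializes_dvd_of_eq (hz.map p.continuous) hx (dvd_of_stalkMap_dvd p z' ?_)
  have h1 := map_dvd (Z.presheaf.stalkSpecializes hz).hom e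
  have hu := isUnit_of_eq_genericPoint hy (stalkSpecializes_ne_zero (hz.map q.continuous) hn')
  have e1 : ∀ m, Z.presheaf.stalkSpecializes hz (p.stalkMap z m) = _ := fun m =>
    (Scheme.Hom.stalkSpecializes_stalkMap_apply p _ _ hz m).symm
  have e2 : ∀ n, Z.presheaf.stalkSpecializes hz (q.stalkMap z n) = _ := fun n =>
    (Scheme.Hom.stalkSpecializes_stalkMap_apply q _ _ hz n).symm
  replace h1 : Z.presheaf.stalkSpecializes hz (p.stalkMap z m * q.stalkMap z n) ∣
    Z.presheaf.stalkSpecializes hz (p.stalkMap z m' * q.stalkMap z n') := h1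
  rw [map_mul, map_mul, e1, e1, e2, e2] at h1
  exact (hu.map (q.stalkMap z').hom).dvd_mul_right.1 ((dvd_mul_right _ _).trans h1)

end Flat

namespace LogStructure

variable {X Y Z S : Scheme.{u}} {p : Z ⟶ X} {q : Z ⟶ Y} {a : X ⟶ S} {b : Y ⟶ S}
  {M : LogStructure X} {N : LogStructure Y}

section

variable [Subsingleton S] [IsIntegral S] [IsIntegral X] [IsIntegral Y]

lemma mul_mem_nonZeroDivisors (h : IsPullback p q a b) (hM : M.IsFs) (hN : N.IsFs) {z : Z}
    {m : X.presheaf.stalk (p z)} {n : Y.presheaf.stalk (q z)} (hm : m ∈ M.stalk (p z))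
    (hn : n ∈ N.stalk (q z)) :
    p.stalkMap z m * q.stalkMap z n ∈ nonZeroDivisors (Z.presheaf.stalk z) := by
  have := flat_of_isPullback h
  have := flat_of_isPullback h.flip
  exact mul_mem
    (mem_nonZeroDivisors_stalkMap p z (mem_nonZeroDivisors_of_ne_zero (hM.ne_zero _ hm)))
    (mem_nonZeroDivisors_stalkMap q z (mem_nonZeroDivisors_of_ne_zero (hN.ne_zero _ hn)))

lemma associated_of_stalkMap_mul (h : IsPullback p q a b) (hM : M.IsFs) (hN : N.IsFs) {z : Z}
    {m m' : X.presheaf.stalk (p z)} {n n' : Y.presheaf.stalk (q z)}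
    (hm : m ∈ M.stalk (p z)) (hm' : m' ∈ M.stalk (p z)) (hn : n ∈ N.stalk (q z))
    (hn' : n' ∈ N.stalk (q z))
    (e : Associated (p.stalkMap z m * q.stalkMap z n) (p.stalkMap z m' * q.stalkMap z n')) :
    Associated m m' ∧ Associated n n' := by
  have e' := e
  rw [mul_comm, mul_comm (p.stalkMap z m')] at e'
  exact ⟨associated_of_dvd_dvd (dvd_of_stalkMap_mul_dvd h z (hN.ne_zero _ hn') e.dvd)
    (dvd_of_stalkMap_mul_dvd h z (hN.ne_zero _ hn) e.symm.dvd),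
    associated_of_dvd_dvd (dvd_of_stalkMap_mul_dvd h.flip z (hM.ne_zero _ hm') e'.dvd)
    (dvd_of_stalkMap_mul_dvd h.flip z (hM.ne_zero _ hm) e'.symm.dvd)⟩

/-- The product of two charts is a chart. The point is injectivity: an equality up to a unit on the
product splits into one on each factor by `associated_of_stalkMap_mul`. Hence no further
integralization or saturation is needed. -/
lemma isFs_prod (h : IsPullback p q a b) (hM : M.IsFs) (hN : N.IsFs) :
    (prod p q M N).IsFs := by
  intro z
  obtain ⟨U, hU, P, _, φ, hP, hφ⟩ := hM (p z)
  obtain ⟨V, hV, Q, _, ψ, hQ, hψ⟩ := hN (q z)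
  let W : Z.Opens := p ⁻¹ᵁ U ⊓ q ⁻¹ᵁ V
  let χ : P × Q →* Γ(Z, W) := MonoidHom.coprod
    ((Z.presheaf.map (homOfLE inf_le_left).op).hom.toMonoidHom.comp
      ((p.app U).hom.toMonoidHom.comp φ))
    ((Z.presheaf.map (homOfLE inf_le_right).op).hom.toMonoidHom.comp
      ((q.app V).hom.toMonoidHom.comp ψ))
  have hχ : ∀ (z' : Z) (hz' : z' ∈ W) (c : P × Q), Z.presheaf.germ W z' hz' (χ c) =
      p.stalkMap z' (X.presheaf.germ U (p z') hz'.1 (φ c.1)) *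
        q.stalkMap z' (Y.presheaf.germ V (q z') hz'.2 (ψ c.2)) := by
    intro z' hz' c
    have e1 : Z.presheaf.germ W z' hz' (Z.presheaf.map (homOfLE inf_le_left).op
        (p.app U (φ c.1))) = _ :=
      (Z.presheaf.germ_res_apply (homOfLE inf_le_left) z' hz' _).trans
        (Scheme.Hom.germ_stalkMap_apply p U z' hz'.1 (φ c.1)).symm
    have e2 : Z.presheaf.germ W z' hz' (Z.presheaf.map (homOfLE inf_le_right).op
        (q.app V (ψ c.2))) = _ :=
      (Z.presheaf.germ_res_apply (homOfLE inf_le_right) z' hz' _).trans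
        (Scheme.Hom.germ_stalkMap_apply q V z' hz'.2 (ψ c.2)).symm
    rw [← e1, ← e2, ← map_mul]
    rfl
  refine ⟨W, ⟨hU, hV⟩, P × Q, inferInstance, χ, hP.prod hQ, ?_, ?_, ?_⟩
  · intro c z' hz'
    rw [hχ]
    exact ⟨_, M.germ_mem_stalk (hφ.mem _) _, _, N.germ_mem_stalk (hψ.mem _) _, 1, isUnit_one,
      (mul_one _).symm⟩
  · intro z' hz' f hf
    rw [stalk_prod] at hf
    obtain ⟨m, hm, n, hn, u, hu, rfl⟩ := hf
    obtain ⟨c, v, hv, rfl⟩ := hφ.surj _ hz'.1 m hm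
    obtain ⟨d, w, hw, rfl⟩ := hψ.surj _ hz'.2 n hn
    refine ⟨(c, d), p.stalkMap z' v * q.stalkMap z' w * u,
      ((hv.map (p.stalkMap z').hom).mul (hw.map (q.stalkMap z').hom)).mul hu, ?_⟩
    rw [hχ, map_mul, map_mul]
    ring
  · intro z' hz' c d u hu e
    rw [hχ, hχ] at e
    have hm : ∀ c, X.presheaf.germ U (p z') hz'.1 (φ c) ∈ M.stalk (p z') := fun c =>
      M.germ_mem_stalk (hφ.mem c) _
    have hn : ∀ c, Y.presheaf.germ V (q z') hz'.2 (ψ c) ∈ N.stalk (q z') := fun c =>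
      N.germ_mem_stalk (hψ.mem c) _
    obtain ⟨⟨v, hv⟩, ⟨w, hw⟩⟩ := associated_of_stalkMap_mul h hM hN (hm d.1) (hm c.1) (hn d.2)
      (hn c.2) ⟨hu.unit, e.symm⟩
    obtain ⟨s, t, hs, ht, est, est'⟩ := hφ.inj _ hz'.1 c.1 d.1 v v.isUnit hv.symm
    obtain ⟨s', t', hs', ht', est₂, est₂'⟩ := hψ.inj _ hz'.2 c.2 d.2 w w.isUnit hw.symm
    -- The unit is determined by the equation because images of monomials are nonzerodivisors, by
    -- flatness over integral schemes.
    have hu' : u = p.stalkMap z' v * q.stalkMap z' w := by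
      refine (mul_cancel_left_mem_nonZeroDivisors
        (mul_mem_nonZeroDivisors h hM hN (hm d.1) (hn d.2))).1 ?_
      rw [← e, ← hv, ← hw, map_mul, map_mul]
      ring
    refine ⟨(s, s'), (t, t'), ?_, ?_, Prod.ext est est₂, ?_⟩
    · rw [hχ]
      exact (hs.map (p.stalkMap z').hom).mul (hs'.map (q.stalkMap z').hom)
    · rw [hχ]
      exact (ht.map (p.stalkMap z').hom).mul (ht'.map (q.stalkMap z').hom)
    · rw [hχ, hχ, est', est₂', hu', map_mul, map_mul]
      ring

end

end LogStructure

namespace FsLogScheme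

variable {k : Type u} [Field k] {X Y Z : FsLogScheme k}

lemma stalkMap_mem (f : X ⟶ Y) (x : X.X) {m : Y.X.presheaf.stalk (f.f x)}
    (hm : m ∈ Y.M.stalk (f.f x)) : f.f.stalkMap x m ∈ X.M.stalk x := by
  obtain ⟨U, hU, s, hs, rfl⟩ := hm
  rw [Scheme.Hom.germ_stalkMap_apply f.f U x hU s]
  exact X.M.germ_mem_stalk (f.map_mem U s hs) hU

lemma stalkMap_mem_of_eq (f : X ⟶ Y) {W : Scheme.{u}} (h : X.X ⟶ W) (p : W ⟶ Y.X)
    (e : h ≫ p = f.f) (x : X.X) {m : Y.X.presheaf.stalk (p (h x))}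
    (hm : m ∈ Y.M.stalk (p (h x))) : h.stalkMap x (p.stalkMap (h x) m) ∈ X.M.stalk x := by
  obtain ⟨g, hg, hg'⟩ := f
  subst e
  have h1 := stalkMap_mem (X := X) (Y := Y) ⟨h ≫ p, hg, hg'⟩ x hm
  have h2 := congr($(Scheme.Hom.stalkMap_comp h p x).hom m)
  exact (h2 : (h ≫ p).stalkMap x m = _) ▸ h1

/-- The product of log schemes with integral underlying schemes, as a log structure on a given
product of the underlying schemes. -/
def ofIsPullback {T : Scheme.{u}} {p : T ⟶ X.X} {q : T ⟶ Y.X} (h : IsPullback p q X.str Y.str)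
    [IsIntegral X.X] [IsIntegral Y.X] : FsLogScheme k where
  X := T
  str := p ≫ X.str
  M := LogStructure.prod p q X.M Y.M
  fs := LogStructure.isFs_prod h X.fs Y.fs

section

variable [IsIntegral X.X] [IsIntegral Y.X] {T : Scheme.{u}} {p : T ⟶ X.X} {q : T ⟶ Y.X}
  (h : IsPullback p q X.str Y.str)

def ofIsPullbackFst : ofIsPullback h ⟶ X := ⟨p, rfl, fun U s hs z hz => by
  refine ⟨_, X.M.germ_mem_stalk hs hz, 1, one_mem _, 1, isUnit_one, ?_⟩
  rw [map_one, mul_one, mul_one]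
  exact (Scheme.Hom.germ_stalkMap_apply p U z hz s).symm⟩

def ofIsPullbackSnd : ofIsPullback h ⟶ Y := ⟨q, h.w.symm, fun U s hs z hz => by
  refine ⟨1, one_mem _, _, Y.M.germ_mem_stalk hs hz, 1, isUnit_one, ?_⟩
  rw [map_one, one_mul, mul_one]
  exact (Scheme.Hom.germ_stalkMap_apply q U z hz s).symm⟩

omit [IsIntegral X.X] [IsIntegral Y.X] in
lemma app_lift_mem {W : FsLogScheme k} (f : W ⟶ X) (g : W ⟶ Y) (l : W.X ⟶ T) (hf : l ≫ p = f.f)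
    (hg : l ≫ q = g.f) (U : T.Opens) (s : Γ(T, U))
    (hs : s ∈ (LogStructure.prod p q X.M Y.M).sections U) : l.app U s ∈ W.M.sections (l ⁻¹ᵁ U) := by
  refine W.M.mem_sections_iff.2 fun w hw => ?_
  rw [← Scheme.Hom.germ_stalkMap_apply l U w hw s]
  obtain ⟨m, hm, n, hn, u, hu, e⟩ := hs _ hw
  rw [e, map_mul, map_mul]
  exact mul_mem (mul_mem (stalkMap_mem_of_eq f l p hf w hm) (stalkMap_mem_of_eq g l q hg w hn))
    (W.M.mem_stalk_of_isUnit (hu.map (l.stalkMap w).hom))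

def ofIsPullbackLift (W : FsLogScheme k) (f : W ⟶ X) (g : W ⟶ Y) : W ⟶ ofIsPullback h :=
  ⟨h.lift f.f g.f (by rw [f.comp_str, g.comp_str]),
    (h.lift_fst_assoc _ _ _ _).trans f.comp_str,
    app_lift_mem f g _ (h.lift_fst _ _ _) (h.lift_snd _ _ _)⟩

end

/-- A product of log-schemes with integral underlying schemes is a product of schemes, with the
log structure generated by the pullbacks of the given log structures. -/
lemma isPullback_of_isProduct [IsIntegral X.X] [IsIntegral Y.X] {p : Z ⟶ X} {q : Z ⟶ Y}
    (hZ : IsProduct p q) : IsPullback p.f q.f X.str Y.str := by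
  obtain ⟨hl⟩ := hZ
  have h := IsPullback.of_hasPullback X.str Y.str
  let φ : Z ⟶ ofIsPullback h := ofIsPullbackLift h Z p q
  let ψ : ofIsPullback h ⟶ Z := hl.lift (BinaryFan.mk (ofIsPullbackFst h) (ofIsPullbackSnd h))
  have hψ1 : ψ ≫ p = ofIsPullbackFst h := hl.fac _ ⟨WalkingPair.left⟩
  have hψ2 : ψ ≫ q = ofIsPullbackSnd h := hl.fac _ ⟨WalkingPair.right⟩
  have hφ1 : φ.f ≫ pullback.fst X.str Y.str = p.f := h.lift_fst _ _ _
  have hφ2 : φ.f ≫ pullback.snd X.str Y.str = q.f := h.lift_snd _ _ _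
  have hψ1' : ψ.f ≫ p.f = pullback.fst X.str Y.str := congrArg Hom.f hψ1
  have hψ2' : ψ.f ≫ q.f = pullback.snd X.str Y.str := congrArg Hom.f hψ2
  have e1 : φ ≫ ψ = 𝟙 Z := by
    refine BinaryFan.IsLimit.hom_ext hl ?_ ?_
    · show (φ ≫ ψ) ≫ p = 𝟙 Z ≫ p
      rw [Category.assoc, hψ1, Category.id_comp]
      exact Hom.ext hφ1
    · show (φ ≫ ψ) ≫ q = 𝟙 Z ≫ q
      rw [Category.assoc, hψ2, Category.id_comp]
      exact Hom.ext hφ2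
  have e2 : ψ.f ≫ φ.f = 𝟙 (pullback X.str Y.str) := by
    refine h.hom_ext ?_ ?_
    · exact ((Category.assoc _ _ _).trans ((congrArg _ hφ1).trans hψ1')).trans
        (Category.id_comp _).symm
    · exact ((Category.assoc _ _ _).trans ((congrArg _ hφ2).trans hψ2')).trans
        (Category.id_comp _).symm
  let i : Z.X ≅ pullback X.str Y.str := ⟨φ.f, ψ.f, congrArg Hom.f e1, e2⟩
  exact IsPullback.of_iso_pullback ⟨by rw [p.comp_str, q.comp_str]⟩ i hφ1 hφ2

/-- The product log structure on the scheme underlying `Z` maps to `Z` by the universal property,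
over the identity of schemes, which bounds the stalks of `Z` from above. The other inclusion holds
as `p` and `q` are morphisms. -/
lemma stalk_of_isProduct [IsIntegral X.X] [IsIntegral Y.X] {p : Z ⟶ X} {q : Z ⟶ Y}
    (hZ : IsProduct p q) (z : Z.X) :
    Z.M.stalk z = LogStructure.prodStalk p.f q.f X.M Y.M z := by
  have h := isPullback_of_isProduct hZ
  obtain ⟨hl⟩ := hZ
  refine le_antisymm ?_ ?_
  · let ψ : ofIsPullback h ⟶ Z := hl.lift (BinaryFan.mk (ofIsPullbackFst h) (ofIsPullbackSnd h))
    have hψ1 : ψ.f ≫ p.f = p.f := congrArg Hom.f (hl.fac _ ⟨WalkingPair.left⟩)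
    have hψ2 : ψ.f ≫ q.f = q.f := congrArg Hom.f (hl.fac _ ⟨WalkingPair.right⟩)
    have hψ : ψ.f = 𝟙 Z.X := h.hom_ext (hψ1.trans (Category.id_comp _).symm)
      (hψ2.trans (Category.id_comp _).symm)
    rw [← LogStructure.stalk_prod]
    exact LogStructure.stalk_le_stalk_of_eq_id ψ.f hψ ψ.map_mem z
  · rintro _ ⟨m, hm, n, hn, u, hu, rfl⟩
    exact mul_mem (mul_mem (stalkMap_mem p z hm) (stalkMap_mem q z hn))
      (Z.M.mem_stalk_of_isUnit hu)

end FsLogScheme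

/-! ### The Kato fan and the characteristic monoids of a product. -/

namespace FsLogScheme

variable {k : Type u} [Field k] {X Y Z : FsLogScheme k}

/-- The map induced by a morphism on characteristic monoids. -/
def charMap (f : X ⟶ Y) (x : X.X) : Y.M.Char (f.f x) →* X.M.Char x where
  toFun c := Associates.mk ⟨f.f.stalkMap x (Y.M.rep c), stalkMap_mem f x (Y.M.rep_mem c)⟩
  map_one' := X.M.mk_eq_one_iff.2
    ((Y.M.mk_eq_one_iff.1 (Y.M.mk_rep 1)).map (f.f.stalkMap x).hom)
  map_mul' a b := by
    rw [Associates.mk_mul_mk, X.M.mk_eq_mk_iff]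
    have h := Y.M.rep_mk (⟨Y.M.rep a, Y.M.rep_mem a⟩ * ⟨Y.M.rep b, Y.M.rep_mem b⟩)
    rw [← Associates.mk_mul_mk, Y.M.mk_rep, Y.M.mk_rep] at h
    have := h.map (f.f.stalkMap x).hom
    rwa [Submonoid.coe_mul, map_mul] at this

lemma rep_charMap (f : X ⟶ Y) (x : X.X) (c : Y.M.Char (f.f x)) :
    Associated (X.M.rep (charMap f x c)) (f.f.stalkMap x (Y.M.rep c)) :=
  X.M.rep_mk _

section Pair

lemma isNoetherian_of_isLogRegularPair (hX : X.IsLogRegularPair) : IsNoetherian X.X := by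
  have := hX.variety.locallyOfFiniteType
  have := hX.variety.quasiCompact
  have : IsLocallyNoetherian X.X := LocallyOfFiniteType.isLocallyNoetherian X.str
  have : CompactSpace X.X := QuasiCompact.compactSpace_of_compactSpace X.str
  exact {}

/-- From the dimension formula; regularity of the quotient only serves to make it nonzero, hence of
nonnegative dimension. -/
lemma rank_le_ringKrullDim (hX : X.IsLogRegularPair) (x : X.X) :
    ((Module.finrank ℤ (Additive (Algebra.GrothendieckGroup (X.M.Char x))) : ℕ) : WithBot ℕ∞) ≤
      ringKrullDim (X.X.presheaf.stalk x) := by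
  rw [(hX.logRegular x).dim_eq]
  have := (hX.logRegular x).regular
  exact le_add_of_nonneg_left ringKrullDim_nonneg_of_nontrivial

lemma genericPoint_mem_katoFan [IsIntegral X.X] : genericPoint X.X ∈ X.M.katoFan := by
  have h : ∀ f : X.X.presheaf.stalk (genericPoint X.X), ¬ IsUnit f → f = 0 := fun f hf => by
    by_contra h
    exact hf (isUnit_of_eq_genericPoint rfl h)
  refine le_antisymm (Ideal.span_le.2 fun f hf => (IsLocalRing.mem_maximalIdeal f).2 hf.2)
    fun f hf => ?_
  rw [h f ((IsLocalRing.mem_maximalIdeal f).1 hf)]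
  exact zero_mem _

lemma isToroidal_of_isLogRegularPair [IsIntegral X.X] (hX : X.IsLogRegularPair) :
    X.IsToroidal (genericPoint X.X) where
  independent x hx := by
    have := isNoetherian_of_isLogRegularPair hX
    exact (X.M.isMonomialSystem_rep hx).isIndependentSystem (X.fs.isFsMonoid_char x)
      (isSharp_associates _) (rank_le_ringKrullDim hX x)
  finite := by
    have := isNoetherian_of_isLogRegularPair hX
    exact X.fs.finite_katoFan
  specializes x := genericPoint_specializes x
  generic_mem := genericPoint_mem_katoFan

end Pair

section Product

variable [IsIntegral X.X] [IsIntegral Y.X] {p : Z ⟶ X} {q : Z ⟶ Y} (hZ : IsProduct p q)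

include hZ

lemma exists_of_mem_stalk {z : Z.X} {f : Z.X.presheaf.stalk z} (hf : f ∈ Z.M.stalk z) :
    ∃ m ∈ X.M.stalk (p.f z), ∃ n ∈ Y.M.stalk (q.f z),
      Associated f (p.f.stalkMap z m * q.f.stalkMap z n) := by
  rw [stalk_of_isProduct hZ] at hf
  obtain ⟨m, hm, n, hn, u, hu, rfl⟩ := hf
  exact ⟨m, hm, n, hn, (associated_mul_unit_left _ _ hu)⟩

/-- The characteristic monoid of a product is the product of the characteristic monoids. -/
lemma charMap_bijective (z : Z.X) :
    Function.Bijective ((charMap p z).coprod (charMap q z)) := by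
  have key : ∀ c d, Associated (Z.M.rep ((charMap p z).coprod (charMap q z) (c, d)))
      (p.f.stalkMap z (X.M.rep c) * q.f.stalkMap z (Y.M.rep d)) := fun c d => by
    have h := Z.M.rep_mk ((⟨_, stalkMap_mem p z (X.M.rep_mem c)⟩ : Z.M.stalk z) *
      ⟨_, stalkMap_mem q z (Y.M.rep_mem d)⟩)
    rw [← Associates.mk_mul_mk] at h
    exact h
  constructor
  · rintro ⟨c, d⟩ ⟨c', d'⟩ e
    obtain ⟨h1, h2⟩ := LogStructure.associated_of_stalkMap_mul (isPullback_of_isProduct hZ) X.fs Y.fs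
      (X.M.rep_mem c) (X.M.rep_mem c') (Y.M.rep_mem d) (Y.M.rep_mem d')
      ((key c d).symm.trans (e ▸ key c' d'))
    refine Prod.ext ?_ ?_
    · have := X.M.mk_eq_mk_iff (m := ⟨_, X.M.rep_mem c⟩) (n := ⟨_, X.M.rep_mem c'⟩) |>.2 h1
      rwa [X.M.mk_rep, X.M.mk_rep] at this
    · have := Y.M.mk_eq_mk_iff (m := ⟨_, Y.M.rep_mem d⟩) (n := ⟨_, Y.M.rep_mem d'⟩) |>.2 h2
      rwa [Y.M.mk_rep, Y.M.mk_rep] at this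
  · intro c
    obtain ⟨m, hm, n, hn, e⟩ := exists_of_mem_stalk hZ (Z.M.rep_mem c)
    refine ⟨(Associates.mk ⟨m, hm⟩, Associates.mk ⟨n, hn⟩), ?_⟩
    rw [← Z.M.mk_rep c, ← Z.M.mk_rep (MonoidHom.coprod _ _ _), Z.M.mk_eq_mk_iff]
    refine (key _ _).trans (Associated.trans ?_ e.symm)
    exact ((X.M.rep_mk ⟨m, hm⟩).map (p.f.stalkMap z).hom).mul_mul
      ((Y.M.rep_mk ⟨n, hn⟩).map (q.f.stalkMap z).hom)

/-- The product decomposition of the characteristic monoids of a product. -/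
def charEquiv (z : Z.X) : X.M.Char (p.f z) × Y.M.Char (q.f z) ≃* Z.M.Char z :=
  MulEquiv.ofBijective _ (charMap_bijective hZ z)

lemma ideal_of_isProduct (z : Z.X) :
    Z.M.ideal z = (X.M.ideal (p.f z)).map (p.f.stalkMap z).hom ⊔
      (Y.M.ideal (q.f z)).map (q.f.stalkMap z).hom := by
  refine le_antisymm (Ideal.span_le.2 ?_) (sup_le ?_ ?_)
  · rintro f ⟨hf, hu⟩
    obtain ⟨m, hm, n, hn, e⟩ := exists_of_mem_stalk hZ hf
    refine (Ideal.mem_iff_of_associated e).2 ?_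
    rw [e.isUnit_iff, IsUnit.mul_iff, not_and_or] at hu
    rcases hu with hu | hu
    · exact Ideal.mul_mem_right _ _ (Ideal.mem_sup_left (Ideal.mem_map_of_mem (p.f.stalkMap z).hom
        (Ideal.subset_span ⟨hm, fun h => hu (h.map (p.f.stalkMap z).hom)⟩)))
    · exact Ideal.mul_mem_left _ _ (Ideal.mem_sup_right (Ideal.mem_map_of_mem (q.f.stalkMap z).hom
        (Ideal.subset_span ⟨hn, fun h => hu (h.map (q.f.stalkMap z).hom)⟩)))
  · refine Ideal.map_le_iff_le_comap.2 (Ideal.span_le.2 fun m hm => Ideal.subset_span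
      ⟨stalkMap_mem p z hm.1, fun h => hm.2 (isUnit_of_map_unit (p.f.stalkMap z).hom m h)⟩)
  · refine Ideal.map_le_iff_le_comap.2 (Ideal.span_le.2 fun m hm => Ideal.subset_span
      ⟨stalkMap_mem q z hm.1, fun h => hm.2 (isUnit_of_map_unit (q.f.stalkMap z).hom m h)⟩)

lemma mem_katoFan_of_isProduct {z : Z.X} (hz : z ∈ Z.M.katoFan) :
    p.f z ∈ X.M.katoFan ∧ q.f z ∈ Y.M.katoFan := by
  have hI : X.M.ideal (p.f z) ≤ IsLocalRing.maximalIdeal _ :=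
    Ideal.span_le.2 fun f hf => (IsLocalRing.mem_maximalIdeal f).2 hf.2
  have hJ : Y.M.ideal (q.f z) ≤ IsLocalRing.maximalIdeal _ :=
    Ideal.span_le.2 fun f hf => (IsLocalRing.mem_maximalIdeal f).2 hf.2
  have hI' := ne_top_of_le_ne_top (IsLocalRing.maximalIdeal.isMaximal _).ne_top hI
  have hJ' := ne_top_of_le_ne_top (IsLocalRing.maximalIdeal.isMaximal _).ne_top hJ
  have h := isPullback_of_isProduct hZ
  have e := ideal_of_isProduct hZ z
  rw [show Z.M.ideal z = _ from hz] at e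
  exact ⟨le_antisymm hI (maximalIdeal_le_of_le_sup h z hI' hJ' e.le),
    le_antisymm hJ (maximalIdeal_le_of_le_sup h.flip z hJ' hI' (by rw [sup_comm]; exact e.le))⟩

lemma ideal_eq_fiberIdeal {z : Z.X} (hx : p.f z ∈ X.M.katoFan) (hy : q.f z ∈ Y.M.katoFan) :
    Z.M.ideal z = fiberIdeal p.f q.f z := by
  rw [ideal_of_isProduct hZ, show X.M.ideal (p.f z) = _ from hx,
    show Y.M.ideal (q.f z) = _ from hy, fiberIdeal]

/-- A monomial on the product is a product of monomials of the factors, so whether it is a unit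
depends only on the pair of image points. A generization within the same fibre thus keeps nonunit
monomials nonunits, which excludes proper generizations of a Kato point. -/
lemma katoFan_specializes_eq {z z' : Z.X} (hz : z ∈ Z.M.katoFan) (h : z' ⤳ z)
    (hp : p.f z' = p.f z) (hq : q.f z' = q.f z) : z' = z := by
  refine LogStructure.eq_of_specializes_of_mem_katoFan hz h fun f hf hu hu' => hu ?_
  obtain ⟨m, hm, n, hn, e⟩ := exists_of_mem_stalk hZ hf
  have h1 : IsUnit (Z.X.presheaf.stalkSpecializes h (p.f.stalkMap z m * q.f.stalkMap z n)) :=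
    (e.map (Z.X.presheaf.stalkSpecializes h).hom).isUnit_iff.1 hu'
  rw [map_mul, IsUnit.mul_iff] at h1
  rw [e.isUnit_iff, IsUnit.mul_iff]
  have key : ∀ {W : FsLogScheme k} (r : Z ⟶ W) (m : W.X.presheaf.stalk (r.f z)),
      r.f z' = r.f z → IsUnit (Z.X.presheaf.stalkSpecializes h (r.f.stalkMap z m)) → IsUnit m := by
    intro W r m hr hm
    rw [← Scheme.Hom.stalkSpecializes_stalkMap_apply r.f _ _ h] at hm
    have h2 := isUnit_of_map_unit (r.f.stalkMap z').hom _ hm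
    rw [isUnit_iff_dvd_one] at h2 ⊢
    exact dvd_of_stalkSpecializes_dvd_of_eq (h.map r.f.continuous) hr (by rwa [map_one])
  exact ⟨(key p m hp h1.1).map (p.f.stalkMap z).hom, (key q n hq h1.2).map (q.f.stalkMap z).hom⟩

/-- The conditions under which the Kato fan of a product lies over the product of the Kato fans:
at the generic point of the fibre over a pair of points of the Kato fans, the local ring of the
fibre is a field. -/
lemma exists_mem_katoFan_of_fiberIdeal_eq
    (hf : ∀ z, p.f z ∈ X.M.katoFan → q.f z ∈ Y.M.katoFan →
      (∀ z', p.f z' = p.f z → q.f z' = q.f z → z ⤳ z') →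
      fiberIdeal p.f q.f z = IsLocalRing.maximalIdeal (Z.X.presheaf.stalk z))
    (hXs : X.HasGeometricallyIrreducibleStrata) {x : X.X} (hx : x ∈ X.M.katoFan) {y : Y.X}
    (hy : y ∈ Y.M.katoFan) :
    ∃ z ∈ Z.M.katoFan, p.f z = x ∧ q.f z = y ∧ ∀ z', p.f z' = x → q.f z' = y → z ⤳ z' := by
  have := hXs x hx
  obtain ⟨z, rfl, rfl, hz⟩ := exists_generic_point (isPullback_of_isProduct hZ) x y
  exact ⟨z, (ideal_eq_fiberIdeal hZ hx hy).trans (hf z hx hy hz), rfl, rfl, hz⟩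

end Product

/-- The data of a product of log-regular pairs that determine its skeleton. -/
structure IsToroidalProduct (p : Z ⟶ X) (q : Z ⟶ Y) (ξ : X.X) (η : Y.X) (ζ : Z.X) : Prop where
  left : X.IsToroidal ξ
  right : Y.IsToroidal η
  total : Z.IsToroidal ζ
  mem_katoFan : ∀ z ∈ Z.M.katoFan, p.f z ∈ X.M.katoFan ∧ q.f z ∈ Y.M.katoFan
  exists_mem_katoFan : ∀ x ∈ X.M.katoFan, ∀ y ∈ Y.M.katoFan,
    ∃ z ∈ Z.M.katoFan, p.f z = x ∧ q.f z = y
  eq_of_mem_katoFan : ∀ z ∈ Z.M.katoFan, ∀ z' ∈ Z.M.katoFan, p.f z = p.f z' → q.f z = q.f z' → z = z'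
  bijective : ∀ z, Function.Bijective ((charMap p z).coprod (charMap q z))

/-- Products of log-regular pairs with geometrically irreducible strata. -/
theorem isToroidalProduct {p : Z ⟶ X} {q : Z ⟶ Y}
    (hX : X.IsLogRegularPair) (hY : Y.IsLogRegularPair) (hZ : IsProduct p q)
    (hXs : X.HasGeometricallyIrreducibleStrata) (hk : PerfectField k ∨ Z.IsLogRegular) :
    ∃ ξ η ζ, IsToroidalProduct p q ξ η ζ := by
  have := hX.variety.integral
  have := hY.variety.integral
  have h := isPullback_of_isProduct hZ
  have := hX.variety.locallyOfFiniteType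
  have := hY.variety.locallyOfFiniteType
  have hf : ∀ z, p.f z ∈ X.M.katoFan → q.f z ∈ Y.M.katoFan →
      (∀ z', p.f z' = p.f z → q.f z' = q.f z → z ⤳ z') →
      fiberIdeal p.f q.f z = IsLocalRing.maximalIdeal (Z.X.presheaf.stalk z) := by
    intro z hx hy hz
    -- Over a perfect field the fibre is reduced. Otherwise, log-regularity of the product makes the
    -- quotient by `fiberIdeal`, which is its log ideal here, regular.
    rcases hk with hk | hk
    · exact fiberIdeal_eq_of_isReduced h hz (isReduced_pullback_fromSpecResidueField _ _ _ _)
    · refine fiberIdeal_eq_of_isRegularLocalRing hz ?_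
      rw [← ideal_eq_fiberIdeal hZ hx hy]
      exact (hk z).regular
  have hex := fun {x : X.X} (hx : x ∈ X.M.katoFan) {y : Y.X} (hy : y ∈ Y.M.katoFan) =>
    exists_mem_katoFan_of_fiberIdeal_eq hZ hf hXs hx hy
  have huniq : ∀ z ∈ Z.M.katoFan, ∀ z' ∈ Z.M.katoFan,
      p.f z = p.f z' → q.f z = q.f z' → z = z' := by
    intro z hz z' hz' hp hq
    obtain ⟨hx, hy⟩ := mem_katoFan_of_isProduct hZ hz
    obtain ⟨w, hw, hwp, hwq, hsp⟩ := hex hx hy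
    rw [← katoFan_specializes_eq hZ hz (hsp z rfl rfl) hwp hwq,
      ← katoFan_specializes_eq hZ hz' (hsp z' hp.symm hq.symm) (hwp.trans hp) (hwq.trans hq)]
  have hXn := isNoetherian_of_isLogRegularPair hX
  have hYn := isNoetherian_of_isLogRegularPair hY
  have hZft : LocallyOfFiniteType p.f :=
    MorphismProperty.of_isPullback (P := @LocallyOfFiniteType) h.flip inferInstance
  have hZn : IsLocallyNoetherian Z.X := LocallyOfFiniteType.isLocallyNoetherian p.f
  have hXt := isToroidal_of_isLogRegularPair hX
  have hYt := isToroidal_of_isLogRegularPair hY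
  obtain ⟨ζ, hζ, hζp, hζq, hζs⟩ := hex (genericPoint_mem_katoFan (X := X))
    (genericPoint_mem_katoFan (X := Y))
  refine ⟨_, _, ζ, hXt, hYt, ⟨?_, ?_, ?_, hζ⟩, fun z => mem_katoFan_of_isProduct hZ,
    fun x hx y hy => ?_, huniq, charMap_bijective hZ⟩
  · intro z hz
    -- The embeddings of the two characteristic monoids combine to one of rank the sum of the ranks;
    -- superadditivity of dimensions then gives independence at `z` from the bounds on the factors.
    obtain ⟨ι₁, hι₁⟩ := (X.fs.isFsMonoid_char (p.f z)).exists_embedding (isSharp_associates _)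
    obtain ⟨ι₂, hι₂⟩ := (Y.fs.isFsMonoid_char (q.f z)).exists_embedding (isSharp_associates _)
    let σ₁ := Fin (Module.finrank ℤ (Additive (Algebra.GrothendieckGroup (X.M.Char (p.f z)))))
    let σ₂ := Fin (Module.finrank ℤ (Additive (Algebra.GrothendieckGroup (Y.M.Char (q.f z)))))
    let j : Multiplicative (σ₁ → ℤ) × Multiplicative (σ₂ → ℤ) →* Multiplicative (σ₁ ⊕ σ₂ → ℤ) :=
      { toFun := fun a => .ofAdd (Sum.elim a.1.toAdd a.2.toAdd)
        map_one' := by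
          refine congrArg Multiplicative.ofAdd (funext fun i => ?_)
          cases i <;> rfl
        map_mul' := fun a b => by
          refine congrArg Multiplicative.ofAdd (funext fun i => ?_)
          cases i <;> rfl }
    have hj : Function.Injective j := by
      intro a b e
      have e' : Sum.elim a.1.toAdd a.2.toAdd = Sum.elim b.1.toAdd b.2.toAdd :=
        congrArg Multiplicative.toAdd e
      exact Prod.ext (funext fun i => congrFun e' (.inl i)) (funext fun i => congrFun e' (.inr i))
    let ι : Z.M.Char z →* Multiplicative (σ₁ ⊕ σ₂ → ℤ) :=
      j.comp ((ι₁.prodMap ι₂).comp (charEquiv hZ z).symm.toMonoidHom)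
    have hι : Function.Injective ι := hj.comp
      ((Function.Injective.prodMap hι₁ hι₂).comp (charEquiv hZ z).symm.injective)
    have hr := Z.M.isMonomialSystem_rep hz
    refine ⟨hr, inferInstance, (Z.fs.isFsMonoid_char z).fg, fun o c => ?_⟩
    refine hr.notMem_span (Z.fs.isFsMonoid_char z).fg ι hι ?_ o c
    refine le_trans ?_ (ringKrullDim_add_le_of_isPullback h z)
    have := add_le_add (rank_le_ringKrullDim hX (p.f z)) (rank_le_ringKrullDim hY (q.f z))
    simpa [σ₁, σ₂] using this
  · refine Set.Finite.of_finite_image (f := fun z => (p.f z, q.f z))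
      ((hXt.finite.prod hYt.finite).subset ?_) ?_
    · rintro _ ⟨z, hz, rfl⟩
      exact mem_katoFan_of_isProduct hZ hz
    · intro z hz z' hz' e
      exact huniq z hz z' hz' (congrArg Prod.fst e) (congrArg Prod.snd e)
  · intro z
    obtain ⟨z', hz', h1, h2⟩ := exists_specializes h z (genericPoint_specializes (p.f z))
      (genericPoint_specializes (q.f z))
    exact (hζs z' h1 h2).trans hz'
  · obtain ⟨z, hz, h1, h2, -⟩ := hex hx hy
    exact ⟨z, hz, h1, h2⟩

end FsLogScheme

/-! ### The skeleton of a product. -/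

open IsIndependentSystem

/-- Maximal extensions restrict to maximal extensions along a map of systems of monomials. -/
lemma IsIndependentSystem.IsMaximalExtension.comap {R S C D : Type*} [CommRing R] [IsLocalRing R] [CommRing S]
    [IsLocalRing S] [CommMonoid C] [CommMonoid D] {r : C → R} {s : D → S}
    (hr : IsIndependentSystem r) (hs : IsIndependentSystem s) (φ : R →+* S) (ψ : C →* D)
    (hψ : Function.Injective ψ) (hφ : ∀ c, Associated (s (ψ c)) (φ (r c)))
    {γ : D →* Multiplicative ℝ≥0} {w : Valuation S ℝ≥0} (hw : IsMaximalExtension s γ w)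
    {o : MonomialWellOrder D} (ho : ∀ a b, o.le a b → (γ a).toAdd ≤ (γ b).toAdd) :
    IsMaximalExtension r (γ.comp ψ) (w.comap φ) := by
  have ho' : ∀ a b, (o.comap ψ hψ).le a b → ((γ.comp ψ) a).toAdd ≤ ((γ.comp ψ) b).toAdd := by
    intro a b h
    refine ho _ _ fun h' => h h'
  have : w.comap φ = hr.valuation (o.comap ψ hψ) (γ.comp ψ) ho' := by
    ext1 f
    by_cases hf : f = 0
    · rw [hf, map_zero, map_zero]
    obtain ⟨c, hc⟩ := hr.exists_isInitial (o.comap ψ hψ) hf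
    rw [hr.valuation_of_isInitial _ _ _ hc]
    -- In the pulled back order, the image of `f` under `φ` has initial monomial `ψ (in f)`: the
    -- leading coefficient stays a unit and larger monomials map to larger ones.
    refine hw.apply_of_isInitial hs ho (p := ψ c) ?_
    obtain ⟨a, ha, g, hg, rfl⟩ := (hr.isInitial_iff _).1 hc
    obtain ⟨u, hu⟩ := hφ c
    refine (hs.isInitial_iff _).2 ⟨φ a * u, (ha.map φ).mul u.isUnit, φ g, ?_, ?_⟩
    · have := Ideal.mem_map_of_mem φ hg
      rw [Ideal.map_span] at this
      refine Ideal.span_le.2 ?_ this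
      rintro _ ⟨_, ⟨d, hd, rfl⟩, rfl⟩
      exact (Ideal.mem_iff_of_associated (hφ d)).1 (Ideal.subset_span ⟨ψ d, hd, rfl⟩)
    · rw [map_add, map_mul, ← hu]
      ring
  rw [this]
  exact hr.isMaximalExtension_valuation _ _ _

namespace FsLogScheme

variable {k : Type u} [Field k] {X Y Z : FsLogScheme k}

namespace IsToroidal

variable {ξ : X.X} (hX : X.IsToroidal ξ)

include hX

lemma weight_apply {v : X.skeleton} {x : X.X} {α : X.M.Char x →* Multiplicative ℝ≥0}
    (hα : IsMaximalExtension X.M.rep α (hX.valAt v x)) (c : X.M.Char x) :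
    (α c).toAdd = negLog (hX.valAt v x (X.M.rep c)) := by
  rw [hα.1.2, negLog_expNeg]

/-- The weight of a point of the skeleton on a generator of the characteristic monoid is a
continuous function. -/
lemma continuous_negLog_valAt {x : X.X} (hx : x ∈ X.M.katoFan) {f : X.X.presheaf.stalk x}
    (hf : f ≠ 0) : Continuous fun v => negLog (hX.valAt v x f) :=
  continuous_iff_continuousAt.2 fun v => (continuousAt_negLog (hX.valAt_ne_zero v hx hf)).comp
    (f := fun v => hX.valAt v x f) (hX.continuous_valAt x f).continuousAt

lemma eq_of_isMaximalExtension {v w : X.skeleton} {x : X.X}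
    {α : X.M.Char x →* Multiplicative ℝ≥0} (hv : IsMaximalExtension X.M.rep α (hX.valAt v x))
    (hw : IsMaximalExtension X.M.rep α (hX.valAt w x)) : v = w :=
  hX.ext x fun f => by rw [hv.unique hw]

end IsToroidal

namespace IsToroidalProduct

variable {p : Z ⟶ X} {q : Z ⟶ Y} {ξ : X.X} {η : Y.X} {ζ : Z.X}
  (H : IsToroidalProduct p q ξ η ζ)

include H

lemma charMap_left_injective (z : Z.X) : Function.Injective (charMap p z) := by
  intro a b h
  have : (charMap p z).coprod (charMap q z) (a, 1) = (charMap p z).coprod (charMap q z) (b, 1) := by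
    simp [h]
  exact congrArg Prod.fst ((H.bijective z).1 this)

lemma charMap_right_injective (z : Z.X) : Function.Injective (charMap q z) := by
  intro a b h
  have : (charMap p z).coprod (charMap q z) (1, a) = (charMap p z).coprod (charMap q z) (1, b) := by
    simp [h]
  exact congrArg Prod.snd ((H.bijective z).1 this)

omit H in
lemma isMaximalExtension_map {W : FsLogScheme k} {ω : W.X} (hZ : Z.IsToroidal ζ)
    (hW : W.IsToroidal ω) (f : Z ⟶ W) {z : Z.X} (hz : z ∈ Z.M.katoFan)
    (hw : f.f z ∈ W.M.katoFan) (hf : Function.Injective (charMap f z)) {v : Z.An} (h : v.ker ⤳ z)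
    {γ : Z.M.Char z →* Multiplicative ℝ≥0} (hγ : IsMaximalExtension Z.M.rep γ (v.seminorm h)) :
    IsMaximalExtension W.M.rep (γ.comp (charMap f z))
      ((An.map f v).seminorm (An.map_ker_specializes f v h)) := by
  obtain ⟨o, ho⟩ := exists_monomialOrder (Z.fs.isFsMonoid_char z) (isSharp_associates _) γ
  have := hγ.comap (hW.independent _ hw) (hZ.independent z hz) (f.f.stalkMap z).hom (charMap f z) hf
    (rep_charMap f z) ho
  have e : (An.map f v).seminorm (An.map_ker_specializes f v h) =
      (v.seminorm h).comap (f.f.stalkMap z).hom :=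
    Valuation.ext fun g => An.seminorm_map f v h _ g
  rwa [e]

lemma map_left_mem {v : Z.An} {z : Z.X} (hz : z ∈ Z.M.katoFan) (hv : v ∈ Z.face z) :
    An.map p v ∈ X.face (p.f z) := by
  obtain ⟨h, γ, hγ⟩ := IsToroidal.mem_face_iff.1 hv
  exact IsToroidal.mem_face_iff.2 ⟨_, _, isMaximalExtension_map H.total H.left p hz
    (H.mem_katoFan z hz).1 (H.charMap_left_injective z) h hγ⟩

lemma map_right_mem {v : Z.An} {z : Z.X} (hz : z ∈ Z.M.katoFan) (hv : v ∈ Z.face z) :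
    An.map q v ∈ Y.face (q.f z) := by
  obtain ⟨h, γ, hγ⟩ := IsToroidal.mem_face_iff.1 hv
  exact IsToroidal.mem_face_iff.2 ⟨_, _, isMaximalExtension_map H.total H.right q hz
    (H.mem_katoFan z hz).2 (H.charMap_right_injective z) h hγ⟩

/-- The projection of skeleta. -/
def toProd (v : Z.skeleton) : X.skeleton × Y.skeleton :=
  (⟨An.map p v, by
    obtain ⟨z, hz, hv⟩ := IsToroidal.exists_mem_face v
    exact Set.mem_iUnion₂.2 ⟨_, (H.mem_katoFan z hz).1, H.map_left_mem hz hv⟩⟩,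
   ⟨An.map q v, by
    obtain ⟨z, hz, hv⟩ := IsToroidal.exists_mem_face v
    exact Set.mem_iUnion₂.2 ⟨_, (H.mem_katoFan z hz).2, H.map_right_mem hz hv⟩⟩)

lemma continuous_toProd : Continuous H.toProd :=
  (((An.continuous_map p).comp continuous_subtype_val).subtype_mk _).prodMk
    (((An.continuous_map q).comp continuous_subtype_val).subtype_mk _)

lemma isMaximalExtension_left {v : Z.skeleton} {z : Z.X} (hz : z ∈ Z.M.katoFan)
    {γ : Z.M.Char z →* Multiplicative ℝ≥0} (hγ : IsMaximalExtension Z.M.rep γ (H.total.valAt v z)) :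
    IsMaximalExtension X.M.rep (γ.comp (charMap p z)) (H.left.valAt (H.toProd v).1 (p.f z)) :=
  isMaximalExtension_map H.total H.left p hz (H.mem_katoFan z hz).1 (H.charMap_left_injective z) _ hγ

lemma isMaximalExtension_right {v : Z.skeleton} {z : Z.X} (hz : z ∈ Z.M.katoFan)
    {γ : Z.M.Char z →* Multiplicative ℝ≥0} (hγ : IsMaximalExtension Z.M.rep γ (H.total.valAt v z)) :
    IsMaximalExtension Y.M.rep (γ.comp (charMap q z)) (H.right.valAt (H.toProd v).2 (q.f z)) :=
  isMaximalExtension_map H.total H.right q hz (H.mem_katoFan z hz).2 (H.charMap_right_injective z)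
    _ hγ

/-- The weight on a product with given weights on the factors. -/
def prodWeight (z : Z.X) (α : X.M.Char (p.f z) →* Multiplicative ℝ≥0)
    (β : Y.M.Char (q.f z) →* Multiplicative ℝ≥0) : Z.M.Char z →* Multiplicative ℝ≥0 :=
  (α.coprod β).comp (MulEquiv.ofBijective _ (H.bijective z)).symm.toMonoidHom

lemma prodWeight_apply (z : Z.X) (α : X.M.Char (p.f z) →* Multiplicative ℝ≥0)
    (β : Y.M.Char (q.f z) →* Multiplicative ℝ≥0) (c : X.M.Char (p.f z)) (d : Y.M.Char (q.f z)) :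
    H.prodWeight z α β (charMap p z c * charMap q z d) = α c * β d := by
  have : (MulEquiv.ofBijective _ (H.bijective z)).symm (charMap p z c * charMap q z d) = (c, d) := by
    rw [MulEquiv.symm_apply_eq]
    rfl
  show α.coprod β ((MulEquiv.ofBijective _ (H.bijective z)).symm _) = _
  rw [this]
  rfl

lemma toProd_eq {z : Z.X} (hz : z ∈ Z.M.katoFan) {a : X.skeleton} {b : Y.skeleton}
    {α : X.M.Char (p.f z) →* Multiplicative ℝ≥0} {β : Y.M.Char (q.f z) →* Multiplicative ℝ≥0}
    (ha : IsMaximalExtension X.M.rep α (H.left.valAt a (p.f z)))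
    (hb : IsMaximalExtension Y.M.rep β (H.right.valAt b (q.f z))) {v : Z.skeleton}
    (hv : IsMaximalExtension Z.M.rep (H.prodWeight z α β) (H.total.valAt v z)) :
    H.toProd v = (a, b) := by
  have h1 := H.isMaximalExtension_left hz hv
  have h2 := H.isMaximalExtension_right hz hv
  have e1 : (H.prodWeight z α β).comp (charMap p z) = α := by
    ext1 c
    have := H.prodWeight_apply z α β c 1
    rwa [map_one, map_one, mul_one, mul_one] at this
  have e2 : (H.prodWeight z α β).comp (charMap q z) = β := by
    ext1 d
    have := H.prodWeight_apply z α β 1 d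
    rwa [map_one, map_one, one_mul, one_mul] at this
  rw [e1] at h1
  rw [e2] at h2
  exact Prod.ext (H.left.eq_of_isMaximalExtension h1 ha) (H.right.eq_of_isMaximalExtension h2 hb)

/-- The centre of a point maps to the centres of its projections, which are unique by separatedness,
so both points have their centre at the same Kato point. Their weights there are determined by the
projected weights. -/
lemma toProd_injective [IsSeparated X.str] [IsSeparated Y.str] : Function.Injective H.toProd := by
  intro v w e
  have hp : An.map p v.1 = An.map p w.1 := congrArg (fun a => a.1.1) e
  have hq : An.map q v.1 = An.map q w.1 := congrArg (fun a => a.2.1) e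
  obtain ⟨z, hz, hv⟩ := IsToroidal.exists_mem_face v
  obtain ⟨z', hz', hw⟩ := IsToroidal.exists_mem_face w
  obtain ⟨y, hy, hyc, hyv⟩ := H.total.exists_isCentre hz hv
  obtain ⟨y', hy', hyc', hyw⟩ := H.total.exists_isCentre hz' hw
  have h1 : (An.map p w.1).IsCentre (p.f y) := hp ▸ hyc.map p
  have h2 : (An.map q w.1).IsCentre (q.f y) := hq ▸ hyc.map q
  obtain rfl := H.eq_of_mem_katoFan y hy y' hy' (h1.unique (hyc'.map p)) (h2.unique (hyc'.map q))
  obtain ⟨γ, hγ⟩ := H.total.mem_face_iff_exists.1 hyv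
  obtain ⟨δ, hδ⟩ := H.total.mem_face_iff_exists.1 hyw
  have hγδ : γ = δ := by
    ext1 c
    obtain ⟨⟨a, b⟩, rfl⟩ := (H.bijective y).2 c
    have e1 := H.left.weight_apply (H.isMaximalExtension_left hy hγ) a
    have e2 := H.left.weight_apply (H.isMaximalExtension_left hy hδ) a
    have e3 := H.right.weight_apply (H.isMaximalExtension_right hy hγ) b
    have e4 := H.right.weight_apply (H.isMaximalExtension_right hy hδ) b
    rw [e, ← e2] at e1
    rw [e, ← e4] at e3
    show γ (charMap p y a * charMap q y b) = δ (charMap p y a * charMap q y b)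
    rw [map_mul, map_mul]
    exact congrArg₂ (· * ·) (Multiplicative.toAdd.injective e1) (Multiplicative.toAdd.injective e3)
  subst hγδ
  exact H.total.eq_of_isMaximalExtension hγ hδ

lemma toProd_surjective : Function.Surjective H.toProd := by
  rintro ⟨a, b⟩
  obtain ⟨x, hx, ha⟩ := IsToroidal.exists_mem_face a
  obtain ⟨y, hy, hb⟩ := IsToroidal.exists_mem_face b
  obtain ⟨z, hz, rfl, rfl⟩ := H.exists_mem_katoFan x hx y hy
  obtain ⟨α, hα⟩ := H.left.mem_face_iff_exists.1 ha
  obtain ⟨β, hβ⟩ := H.right.mem_face_iff_exists.1 hb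
  obtain ⟨v, hv⟩ := H.total.exists_skeleton hz (H.prodWeight z α β)
  exact ⟨v, H.toProd_eq hz hα hβ hv⟩

/-- The skeleton of the product is the product of the skeleta. -/
def homeomorph [IsSeparated X.str] [IsSeparated Y.str] :
    Z.skeleton ≃ₜ X.skeleton × Y.skeleton where
  toEquiv := Equiv.ofBijective H.toProd ⟨H.toProd_injective, H.toProd_surjective⟩
  continuous_toFun := H.continuous_toProd
  continuous_invFun := by
    let e := Equiv.ofBijective H.toProd ⟨H.toProd_injective, H.toProd_surjective⟩
    show Continuous e.symm
    have := H.total.finite.to_subtype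
    let F : Z.M.katoFan → Set (X.skeleton × Y.skeleton) := fun z =>
      {a | a.1 ∈ X.face (p.f z)} ×ˢ {b | b.1 ∈ Y.face (q.f z)}
    -- The products of faces form a finite closed cover. On each piece, the weight of the preimage
    -- is the sum of the weights of the two components and so varies continuously.
    refine (locallyFinite_of_finite F).continuous ?_ ?_ ?_
    · refine Set.eq_univ_of_forall fun ⟨a, b⟩ => ?_
      obtain ⟨x, hx, ha⟩ := IsToroidal.exists_mem_face a
      obtain ⟨y, hy, hb⟩ := IsToroidal.exists_mem_face b
      obtain ⟨z, hz, rfl, rfl⟩ := H.exists_mem_katoFan x hx y hy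
      exact Set.mem_iUnion.2 ⟨⟨z, hz⟩, ha, hb⟩
    · intro z
      exact (H.left.isClosed_face (H.mem_katoFan z z.2).1).prod
        (H.right.isClosed_face (H.mem_katoFan z z.2).2)
    · rintro ⟨z, hz⟩
      rw [continuousOn_iff_continuous_domRestrict]
      obtain ⟨hx, hy⟩ := H.mem_katoFan z hz
      choose α hα using fun t : F ⟨z, hz⟩ => H.left.mem_face_iff_exists.1 t.2.1
      choose β hβ using fun t : F ⟨z, hz⟩ => H.right.mem_face_iff_exists.1 t.2.2
      refine H.total.continuous_of_isMaximalExtension hz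
        (fun t => H.prodWeight z (α t) (β t)) (fun c => ?_) (fun t => ?_)
      · obtain ⟨⟨a, b⟩, rfl⟩ := (H.bijective z).2 c
        have h1 : ∀ t, (H.prodWeight z (α t) (β t) (charMap p z a * charMap q z b)).toAdd =
            negLog (H.left.valAt t.1.1 (p.f z) (X.M.rep a)) +
              negLog (H.right.valAt t.1.2 (q.f z) (Y.M.rep b)) := fun t => by
          rw [H.prodWeight_apply, toAdd_mul, H.left.weight_apply (hα t),
            H.right.weight_apply (hβ t)]
        refine Continuous.congr ?_ fun t => (h1 t).symm
        exact ((H.left.continuous_negLog_valAt hx (X.fs.ne_zero _ (X.M.rep_mem a))).comp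
          (continuous_fst.comp continuous_subtype_val)).add
          ((H.right.continuous_negLog_valAt hy (Y.fs.ne_zero _ (Y.M.rep_mem b))).comp
          (continuous_snd.comp continuous_subtype_val))
      · obtain ⟨v, hv⟩ := H.total.exists_skeleton hz (H.prodWeight z (α t) (β t))
        have h1 : e v = t.1 := H.toProd_eq hz (hα t) (hβ t) hv
        have h2 : e.symm t.1 = v := by rw [← h1, e.symm_apply_apply]
        show IsMaximalExtension _ _ (H.total.valAt (e.symm t.1) z)
        rw [h2]
        exact hv

end IsToroidalProduct

end FsLogScheme

/-! ### Cones, their unit spheres, and joins. -/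

/-- A Hausdorff space with a continuous action of the multiplicative monoid `ℝ_{≥ 0}` such that
`0` contracts it to a point, and with a homogeneous norm with compact unit sphere. -/
structure Cone (S : Type*) [TopologicalSpace S] where
  /-- The action of `ℝ_{≥ 0}`. -/
  smul : ℝ≥0 → S → S
  /-- The vertex. -/
  vertex : S
  /-- The norm. -/
  norm : S → ℝ≥0
  t2 : T2Space S
  continuous_smul : Continuous fun p : ℝ≥0 × S => smul p.1 p.2
  continuous_norm : Continuous norm
  zero_smul : ∀ s, smul 0 s = vertex
  one_smul : ∀ s, smul 1 s = s
  mul_smul : ∀ a b s, smul (a * b) s = smul a (smul b s)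
  norm_smul : ∀ a s, norm (smul a s) = a * norm s
  eq_vertex : ∀ s, norm s = 0 → s = vertex
  isCompact : IsCompact {s | norm s = 1}

namespace Cone

variable {S T : Type*} [TopologicalSpace S] [TopologicalSpace T] (C : Cone S) (D : Cone T)

lemma norm_vertex : C.norm C.vertex = 0 := by
  rw [← C.zero_smul C.vertex, C.norm_smul, zero_mul]

lemma inv_smul_smul {a : ℝ≥0} (ha : a ≠ 0) (s : S) : C.smul a⁻¹ (C.smul a s) = s := by
  rw [← C.mul_smul, inv_mul_cancel₀ ha, C.one_smul]

lemma smul_inv_smul {a : ℝ≥0} (ha : a ≠ 0) (s : S) : C.smul a (C.smul a⁻¹ s) = s := by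
  rw [← C.mul_smul, mul_inv_cancel₀ ha, C.one_smul]

/-- Characterises the vertex by the action alone, so that an equivariant homeomorphism preserves
vertices without any comparison of norms. -/
lemma smul_two_eq_iff {s : S} : C.smul 2 s = s ↔ s = C.vertex := by
  constructor
  · intro h
    have h1 := congrArg C.norm h
    rw [C.norm_smul, two_mul, add_eq_left] at h1
    exact C.eq_vertex s h1
  · rintro rfl
    rw [← C.zero_smul C.vertex, ← C.mul_smul, mul_zero]

/-- The unit sphere. -/
def sphere : Set S := {s | C.norm s = 1}

/-- The ball is covered by the multiples of sphere points by `[0, 1]`, together with the vertex,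
which is listed separately since the sphere may be empty. -/
lemma isCompact_ball : IsCompact {s | C.norm s ≤ 1} := by
  have h : {s | C.norm s ≤ 1} ⊆ (fun p : ℝ≥0 × S => C.smul p.1 p.2) '' (Set.Icc 0 1 ×ˢ C.sphere) ∪
      {C.vertex} := by
    intro s hs
    by_cases h0 : C.norm s = 0
    · exact .inr (C.eq_vertex s h0)
    · refine .inl ⟨(C.norm s, C.smul (C.norm s)⁻¹ s), ⟨⟨zero_le, hs⟩, ?_⟩, C.smul_inv_smul h0 s⟩
      show C.norm _ = 1
      rw [C.norm_smul, inv_mul_cancel₀ h0]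
  exact (((isCompact_Icc.prod C.isCompact).image C.continuous_smul).union
    isCompact_singleton).of_isClosed_subset (isClosed_le C.continuous_norm continuous_const) h

lemma smul_inv_norm_mem {s : S} (hs : C.norm s ≠ 0) : C.smul (C.norm s)⁻¹ s ∈ C.sphere := by
  show C.norm _ = 1
  rw [C.norm_smul, inv_mul_cancel₀ hs]

/-- The product of two cones. -/
def prod : Cone (S × T) where
  smul a s := (C.smul a s.1, D.smul a s.2)
  vertex := (C.vertex, D.vertex)
  norm s := C.norm s.1 + D.norm s.2
  t2 := by
    have := C.t2
    have := D.t2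
    infer_instance
  continuous_smul := (C.continuous_smul.comp (by fun_prop : Continuous fun p : ℝ≥0 × S × T =>
    (p.1, p.2.1))).prodMk (D.continuous_smul.comp (by fun_prop : Continuous
      fun p : ℝ≥0 × S × T => (p.1, p.2.2)))
  continuous_norm := (C.continuous_norm.comp continuous_fst).add
    (D.continuous_norm.comp continuous_snd)
  zero_smul s := by rw [C.zero_smul, D.zero_smul]
  one_smul s := by rw [C.one_smul, D.one_smul]
  mul_smul a b s := by rw [C.mul_smul, D.mul_smul]
  norm_smul a s := by rw [C.norm_smul, D.norm_smul, mul_add]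
  eq_vertex s h := by
    rw [add_eq_zero] at h
    exact Prod.ext (C.eq_vertex _ h.1) (D.eq_vertex _ h.2)
  isCompact := by
    refine (C.isCompact_ball.prod D.isCompact_ball).of_isClosed_subset (isClosed_eq
      ((C.continuous_norm.comp continuous_fst).add (D.continuous_norm.comp continuous_snd))
      continuous_const) ?_
    intro s (hs : C.norm s.1 + D.norm s.2 = 1)
    exact ⟨show C.norm s.1 ≤ 1 from hs ▸ le_self_add, show D.norm s.2 ≤ 1 from hs ▸ le_add_self⟩

/-- The quotient of the complement of the vertex by the action of `ℝ_{> 0}` is homeomorphic to the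
unit sphere. -/
def quotientHomeomorph {P : Type*} [TopologicalSpace P] (r : Setoid P) (g : P → S)
    (hg : Continuous g) (hg0 : ∀ v, g v ≠ C.vertex) (σ : C.sphere → P) (hσ : Continuous σ)
    (hgσ : ∀ u, g (σ u) = u) (hr : ∀ v w, r v w ↔ ∃ a : ℝ≥0, a ≠ 0 ∧ g w = C.smul a (g v)) :
    Quotient r ≃ₜ C.sphere := by
  have hn : ∀ v, C.norm (g v) ≠ 0 := fun v h => hg0 v (C.eq_vertex _ h)
  -- Normalisation to norm one is constant on orbits; `σ` gives the inverse.
  let G : P → C.sphere := fun v => ⟨C.smul (C.norm (g v))⁻¹ (g v), C.smul_inv_norm_mem (hn v)⟩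
  have hG : Continuous G := by
    refine Continuous.subtype_mk (C.continuous_smul.comp (Continuous.prodMk ?_ hg)) _
    exact (C.continuous_norm.comp hg).inv₀ hn
  have hGr : ∀ v w, r v w → G v = G w := by
    intro v w h
    obtain ⟨a, ha, e⟩ := (hr v w).1 h
    refine Subtype.ext ?_
    show C.smul _ _ = C.smul _ _
    rw [e, C.norm_smul, ← C.mul_smul, mul_inv, mul_comm a⁻¹, mul_assoc, inv_mul_cancel₀ ha, mul_one]
  have hGσ : ∀ u, G (σ u) = u := fun u => Subtype.ext (by
    show C.smul (C.norm (g (σ u)))⁻¹ (g (σ u)) = u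
    rw [hgσ, show C.norm u = 1 from u.2, inv_one, C.one_smul])
  exact
    { toFun := Quotient.lift G hGr
      invFun := fun u => Quotient.mk r (σ u)
      left_inv := by
        rintro ⟨v⟩
        refine Quotient.sound ((hr _ _).2 ⟨C.norm (g v), hn v, ?_⟩)
        rw [hgσ]
        exact (C.smul_inv_smul (hn v) _).symm
      right_inv := hGσ
      continuous_toFun := hG.quotient_lift hGr
      continuous_invFun := continuous_quotient_mk'.comp hσ }

section Join

variable {A B : Type*} [TopologicalSpace A] [TopologicalSpace B] (f : A ≃ₜ C.sphere)
  (g : B ≃ₜ D.sphere)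

/-- The map from the join of the unit spheres to the unit sphere of the product. -/
def joinMap : (A × B × unitInterval) ⊕ (A ⊕ B) → (C.prod D).sphere
  | .inl (a, b, t) => ⟨(C.smul (unitInterval.toNNReal (unitInterval.symm t)) (f a),
      D.smul (unitInterval.toNNReal t) (g b)), by
      show C.norm _ + D.norm _ = 1
      rw [C.norm_smul, D.norm_smul, show C.norm (f a) = 1 from (f a).2,
        show D.norm (g b) = 1 from (g b).2]
      ext
      simp⟩
  | .inr (.inl a) => ⟨(f a, D.vertex), by
      show C.norm _ + D.norm _ = 1
      rw [D.norm_vertex, add_zero]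
      exact (f a).2⟩
  | .inr (.inr b) => ⟨(C.vertex, g b), by
      show C.norm _ + D.norm _ = 1
      rw [C.norm_vertex, zero_add]
      exact (g b).2⟩

lemma continuous_joinMap : Continuous (joinMap C D f g) := by
  have h1 : Continuous fun t : unitInterval => unitInterval.toNNReal t :=
    Continuous.subtype_mk continuous_subtype_val _
  refine continuous_sum_dom.2 ⟨?_, continuous_sum_dom.2 ⟨?_, ?_⟩⟩
  · refine Continuous.subtype_mk (Continuous.prodMk
      (C.continuous_smul.comp (Continuous.prodMk ?_ ?_))
      (D.continuous_smul.comp (Continuous.prodMk ?_ ?_))) _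
    · exact h1.comp (unitInterval.continuous_symm.comp (continuous_snd.comp continuous_snd))
    · exact continuous_subtype_val.comp (f.continuous.comp continuous_fst)
    · exact h1.comp (continuous_snd.comp continuous_snd)
    · exact continuous_subtype_val.comp (g.continuous.comp (continuous_fst.comp continuous_snd))
  · exact Continuous.subtype_mk ((continuous_subtype_val.comp f.continuous).prodMk
      continuous_const) _
  · exact Continuous.subtype_mk (continuous_const.prodMk
      (continuous_subtype_val.comp g.continuous)) _

lemma joinMap_eq_of_joinRel {x y : (A × B × unitInterval) ⊕ (A ⊕ B)} (h : JoinRel A B x y) :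
    joinMap C D f g x = joinMap C D f g y := by
  cases h with
  | left a b =>
    refine Subtype.ext (Prod.ext ?_ ?_)
    · show C.smul (unitInterval.toNNReal (unitInterval.symm 0)) (f a) = f a
      rw [unitInterval.symm_zero, show unitInterval.toNNReal 1 = 1 from rfl, C.one_smul]
    · show D.smul (unitInterval.toNNReal 0) (g b) = D.vertex
      rw [show unitInterval.toNNReal 0 = 0 from rfl, D.zero_smul]
  | right a b =>
    refine Subtype.ext (Prod.ext ?_ ?_)
    · show C.smul (unitInterval.toNNReal (unitInterval.symm 1)) (f a) = C.vertex
      rw [unitInterval.symm_one, show unitInterval.toNNReal 0 = 0 from rfl, C.zero_smul]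
    · show D.smul (unitInterval.toNNReal 1) (g b) = g b
      rw [show unitInterval.toNNReal 1 = 1 from rfl, D.one_smul]

omit [TopologicalSpace A] [TopologicalSpace B] in
-- A normal form for points of the join: the endpoints of the interval are moved to the summands `A`
-- and `B`.
lemma exists_join_rep (x : Join A B) :
    (∃ a, x = Quot.mk _ (.inr (.inl a))) ∨ (∃ b, x = Quot.mk _ (.inr (.inr b))) ∨
      ∃ a b t, t ≠ 0 ∧ t ≠ 1 ∧ x = Quot.mk _ (.inl (a, b, t)) := by
  obtain ⟨x, rfl⟩ := Quot.exists_rep x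
  rcases x with ⟨a, b, t⟩ | a | b
  · by_cases h0 : t = 0
    · subst h0
      exact .inl ⟨a, Quot.sound (.left a b)⟩
    · by_cases h1 : t = 1
      · subst h1
        exact .inr (.inl ⟨b, Quot.sound (.right a b)⟩)
      · exact .inr (.inr ⟨a, b, t, h0, h1, rfl⟩)
  · exact .inl ⟨a, rfl⟩
  · exact .inr (.inl ⟨b, rfl⟩)

lemma norm_snd_joinMap_inl (a : A) (b : B) (t : unitInterval) :
    D.norm (joinMap C D f g (.inl (a, b, t))).1.2 = unitInterval.toNNReal t := by
  show D.norm (D.smul _ _) = _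
  rw [D.norm_smul, show D.norm (g b) = 1 from (g b).2, mul_one]

lemma norm_snd_joinMap_left (a : A) : D.norm (joinMap C D f g (.inr (.inl a))).1.2 = 0 :=
  D.norm_vertex

lemma norm_snd_joinMap_right (b : B) : D.norm (joinMap C D f g (.inr (.inr b))).1.2 = 1 :=
  (g b).2

lemma smul_injective {a : ℝ≥0} (ha : a ≠ 0) : Function.Injective (C.smul a) := fun s t h => by
  rw [← C.inv_smul_smul ha s, h, C.inv_smul_smul ha]

/-- The norm of the second component recovers the parameter, which separates the three normal forms;
strictly inside the interval both components can be divided by their norms. -/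
lemma joinMap_lift_injective :
    Function.Injective (Quot.lift (joinMap C D f g) fun _ _ => joinMap_eq_of_joinRel C D f g) := by
  have h0 : ∀ t : unitInterval, t ≠ 0 → unitInterval.toNNReal t ≠ 0 := fun t h e =>
    h (Subtype.ext (congrArg NNReal.toReal e))
  have h1 : ∀ t : unitInterval, t ≠ 1 → unitInterval.toNNReal t ≠ 1 := fun t h e =>
    h (Subtype.ext (congrArg NNReal.toReal e))
  intro x y e
  rcases exists_join_rep x with ⟨a, rfl⟩ | ⟨b, rfl⟩ | ⟨a, b, t, ht0, ht1, rfl⟩ <;>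
  rcases exists_join_rep y with ⟨a', rfl⟩ | ⟨b', rfl⟩ | ⟨a', b', t', ht0', ht1', rfl⟩ <;>
  have en := congrArg (fun s => D.norm s.1.2) e <;>
  simp only [norm_snd_joinMap_inl, norm_snd_joinMap_left, norm_snd_joinMap_right] at en
  · have : (f a : S) = f a' := congrArg (fun s => s.1.1) e
    rw [f.injective (Subtype.ext this)]
  · exact absurd en zero_ne_one
  · exact absurd en.symm (h0 _ ht0')
  · exact absurd en one_ne_zero
  · have : (g b : T) = g b' := congrArg (fun s => s.1.2) e
    rw [g.injective (Subtype.ext this)]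
  · exact absurd en.symm (h1 _ ht1')
  · exact absurd en (h0 _ ht0)
  · exact absurd en (h1 _ ht1)
  · obtain rfl : t = t' := Subtype.ext (congrArg NNReal.toReal en)
    have e1 : C.smul _ (f a : S) = C.smul _ (f a' : S) := congrArg (fun s => s.1.1) e
    have e2 : D.smul _ (g b : T) = D.smul _ (g b' : T) := congrArg (fun s => s.1.2) e
    have ht : unitInterval.symm t ≠ 0 := fun h => ht1 (by
      rw [← unitInterval.symm_symm t, h, unitInterval.symm_zero])
    rw [f.injective (Subtype.ext (C.smul_injective (h0 _ ht) e1)),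
      g.injective (Subtype.ext (D.smul_injective (h0 _ ht0) e2))]

/-- Points with one component at the vertex come from the summands `A` and `B`, so the argument also
covers an empty factor. -/
lemma joinMap_lift_surjective :
    Function.Surjective (Quot.lift (joinMap C D f g) fun _ _ => joinMap_eq_of_joinRel C D f g) := by
  rintro ⟨⟨s, t⟩, hst⟩
  replace hst : C.norm s + D.norm t = 1 := hst
  by_cases hs : C.norm s = 0
  · rw [hs, zero_add] at hst
    refine ⟨Quot.mk _ (.inr (.inr (g.symm ⟨t, hst⟩))), Subtype.ext (Prod.ext ?_ ?_)⟩
    · exact (C.eq_vertex s hs).symm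
    · show (g (g.symm ⟨t, hst⟩) : T) = t
      rw [g.apply_symm_apply]
  by_cases ht : D.norm t = 0
  · rw [ht, add_zero] at hst
    refine ⟨Quot.mk _ (.inr (.inl (f.symm ⟨s, hst⟩))), Subtype.ext (Prod.ext ?_ ?_)⟩
    · show (f (f.symm ⟨s, hst⟩) : S) = s
      rw [f.apply_symm_apply]
    · exact (D.eq_vertex t ht).symm
  have ht1 : D.norm t ≤ 1 := hst ▸ le_add_self
  let τ : unitInterval := ⟨D.norm t, (D.norm t).2, ht1⟩
  refine ⟨Quot.mk _ (.inl (f.symm ⟨_, C.smul_inv_norm_mem hs⟩, g.symm ⟨_, D.smul_inv_norm_mem ht⟩,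
    τ)), Subtype.ext (Prod.ext ?_ ?_)⟩
  · have hτ : unitInterval.toNNReal (unitInterval.symm τ) = C.norm s := by
      ext
      have : (C.norm s : ℝ) + D.norm t = 1 := congrArg NNReal.toReal hst
      show 1 - (D.norm t : ℝ) = C.norm s
      linarith
    show C.smul _ (f (f.symm _) : S) = s
    rw [f.apply_symm_apply, hτ]
    exact C.smul_inv_smul hs s
  · have hτ : unitInterval.toNNReal τ = D.norm t := rfl
    show D.smul _ (g (g.symm _) : T) = t
    rw [g.apply_symm_apply, hτ]
    exact D.smul_inv_smul ht t

/-- The join of the unit spheres of two cones is the unit sphere of the product. -/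
def joinHomeomorph : Join A B ≃ₜ (C.prod D).sphere := by
  have : CompactSpace A := by
    have : CompactSpace C.sphere := isCompact_iff_compactSpace.1 C.isCompact
    exact f.symm.compactSpace
  have : CompactSpace B := by
    have : CompactSpace D.sphere := isCompact_iff_compactSpace.1 D.isCompact
    exact g.symm.compactSpace
  have : CompactSpace (Join A B) := inferInstanceAs (CompactSpace (Quot (JoinRel A B)))
  have := (C.prod D).t2
  exact Continuous.homeoOfEquivCompactToT2
    (f := Equiv.ofBijective _ ⟨joinMap_lift_injective C D f g, joinMap_lift_surjective C D f g⟩)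
    (continuous_quot_lift _ (continuous_joinMap C D f g))

end Join

end Cone

/-! ### The skeleton as a cone, and its link. -/

open IsIndependentSystem

/-- Rescaling of a weight. -/
def smulWeight {C : Type*} [CommMonoid C] (a : ℝ≥0) (α : C →* Multiplicative ℝ≥0) :
    C →* Multiplicative ℝ≥0 where
  toFun c := .ofAdd (a * (α c).toAdd)
  map_one' := by simp
  map_mul' c d := by
    rw [MonoidHom.map_mul, toAdd_mul, mul_add, ofAdd_add]

lemma expNeg_mul (a t : ℝ≥0) : expNeg (a * t) = expNeg t ^ (a : ℝ) := by
  ext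
  rw [NNReal.coe_rpow, coe_expNeg, coe_expNeg, ← Real.exp_mul, NNReal.coe_mul]
  ring_nf

/-- The maximal extension of a rescaled weight is the rescaled maximal extension. -/
lemma IsIndependentSystem.IsMaximalExtension.apply_smulWeight {R C : Type*} [CommRing R]
    [IsLocalRing R] [CommMonoid C] {r : C → R} (hr : IsIndependentSystem r) (hC : IsFsMonoid C)
    (hs : IsSharp C) {α : C →* Multiplicative ℝ≥0} {a : ℝ≥0} {w w' : Valuation R ℝ≥0}
    (hw : IsMaximalExtension r α w) (hw' : IsMaximalExtension r (smulWeight a α) w') {f : R}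
    (hf : f ≠ 0) : w' f = w f ^ (a : ℝ) := by
  obtain ⟨o, ho⟩ := exists_monomialOrder hC hs α
  obtain ⟨p, hp⟩ := hr.exists_isInitial o hf
  rw [hw.apply_of_isInitial hr ho hp,
    hw'.apply_of_isInitial hr (fun b c h => mul_le_mul_of_nonneg_left (ho b c h) zero_le) hp,
    ← expNeg_mul]
  rfl

namespace FsLogScheme

variable {k : Type u} [Field k] {X : FsLogScheme k}

namespace IsToroidal

variable {η : X.X} (hX : X.IsToroidal η)

include hX

lemma isUnit_generic {f : X.X.presheaf.stalk η} (hf : f ≠ 0) : IsUnit f := by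
  have := hX.isUnit_stalkSpecializes hX.generic_mem hf
  rwa [TopCat.Presheaf.stalkSpecializes_refl] at this

/-- The rescaling of a point of the skeleton, as a point of the skeleton. -/
lemma exists_smul (a : ℝ≥0) (v : X.skeleton) :
    ∃ w : X.skeleton, ∀ f, f ≠ 0 → hX.valAt w η f = hX.valAt v η f ^ (a : ℝ) := by
  obtain ⟨x, hx, hv⟩ := exists_mem_face v
  obtain ⟨α, hα⟩ := hX.mem_face_iff_exists.1 hv
  obtain ⟨w, hw⟩ := hX.exists_skeleton hx (smulWeight a α)
  have key : ∀ f, f ≠ 0 → hX.valAt w x f = hX.valAt v x f ^ (a : ℝ) := fun f hf =>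
    hα.apply_smulWeight (hX.independent x hx) (X.fs.isFsMonoid_char x) (isSharp_associates _) hw hf
  refine ⟨w, fun f hf => ?_⟩
  obtain ⟨b, s, hs, e⟩ := exists_fraction (hX.specializes x) f
  have hs0 : s ≠ 0 := by
    rintro rfl
    rw [map_zero] at hs
    exact not_isUnit_zero hs
  have hb0 : b ≠ 0 := by
    rintro rfl
    rw [map_zero] at e
    have hu := (hX.isUnit_generic hf).mul hs
    rw [e] at hu
    exact not_isUnit_zero hu
  have h1 : ∀ u : X.skeleton, hX.valAt u η f * hX.valAt u x s = hX.valAt u x b := fun u => by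
    rw [← hX.valAt_stalkSpecializes u (hX.specializes x) s, ← map_mul, e,
      hX.valAt_stalkSpecializes]
  have h2 := h1 w
  rw [key s hs0, key b hb0, ← h1 v, NNReal.mul_rpow] at h2
  refine mul_right_cancel₀ ?_ h2
  exact (NNReal.rpow_pos (pos_of_ne_zero (hX.valAt_ne_zero v hx hs0))).ne'

/-- The action of `ℝ_{≥ 0}` on the skeleton. -/
def smul (a : ℝ≥0) (v : X.skeleton) : X.skeleton := (hX.exists_smul a v).choose

/-- Zero has to be excluded: for `a = 0` the right-hand side would be `0 ^ 0 = 1`. -/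
lemma valAt_smul (a : ℝ≥0) (v : X.skeleton) {f : X.X.presheaf.stalk η} (hf : f ≠ 0) :
    hX.valAt (hX.smul a v) η f = hX.valAt v η f ^ (a : ℝ) :=
  (hX.exists_smul a v).choose_spec f hf

lemma ext_generic {v w : X.skeleton} (h : ∀ f, f ≠ 0 → hX.valAt v η f = hX.valAt w η f) :
    v = w := by
  refine hX.ext η fun f => ?_
  by_cases hf : f = 0
  · rw [hf, map_zero, map_zero]
  · exact h f hf

/-- The vertex of the skeleton. -/
def vertex : X.skeleton := (hX.exists_skeleton hX.generic_mem 1).choose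

lemma valAt_vertex {x : X.X} (hx : x ∈ X.M.katoFan) {f : X.X.presheaf.stalk x} (hf : f ≠ 0) :
    hX.valAt hX.vertex x f = 1 := by
  rw [← hX.valAt_stalkSpecializes _ (hX.specializes x)]
  exact Valuation.eq_one_of_isUnit (hX.exists_skeleton hX.generic_mem 1).choose_spec.1.1
    (hX.isUnit_stalkSpecializes hx hf)

lemma eq_vertex {v : X.skeleton} {x : X.X} (hx : x ∈ X.M.katoFan)
    {α : X.M.Char x →* Multiplicative ℝ≥0} (hα : IsMaximalExtension X.M.rep α (hX.valAt v x))
    (h : α = 1) : v = hX.vertex := by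
  refine hX.ext x fun f => ?_
  by_cases hf : f = 0
  · rw [hf, map_zero, map_zero]
  obtain ⟨o, ho⟩ := exists_monomialOrder (X.fs.isFsMonoid_char x) (isSharp_associates _) α
  obtain ⟨p, hp⟩ := (hX.independent x hx).exists_isInitial o hf
  rw [hX.valAt_vertex hx hf, hα.apply_of_isInitial (hX.independent x hx) ho hp, h]
  exact expNeg_zero

omit hX in
variable (X) in
lemma exists_generators (x : X.X) :
    ∃ G : Finset (X.M.Char x), Submonoid.closure (G : Set (X.M.Char x)) = ⊤ :=
  (X.fs.isFsMonoid_char x).fg.fg_top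

omit hX in
variable (X) in
/-- Generators of the characteristic monoid. -/
def generators (x : X.X) : Finset (X.M.Char x) := (exists_generators X x).choose

omit hX in
lemma closure_generators (x : X.X) :
    Submonoid.closure (generators X x : Set (X.M.Char x)) = ⊤ :=
  (exists_generators X x).choose_spec

/-- The sum of the weights of generators of the characteristic monoids. -/
def norm (v : X.skeleton) : ℝ≥0 :=
  -- At Kato points whose face does not contain `v`, a monomial may have value greater than `1`;
  -- `negLog` truncates its contribution to `0`, which preserves continuity and homogeneity.
  ∑ x ∈ hX.finite.toFinset, ∑ c ∈ generators X x, negLog (hX.valAt v x (X.M.rep c))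

lemma continuous_norm : Continuous hX.norm := by
  refine continuous_finsetSum _ fun x hx => continuous_finsetSum _ fun c _ => ?_
  exact hX.continuous_negLog_valAt (hX.finite.mem_toFinset.1 hx) (X.fs.ne_zero _ (X.M.rep_mem c))

lemma valAt_smul_of_mem (a : ℝ≥0) (v : X.skeleton) {x : X.X} (hx : x ∈ X.M.katoFan)
    {f : X.X.presheaf.stalk x} (hf : f ≠ 0) :
    hX.valAt (hX.smul a v) x f = hX.valAt v x f ^ (a : ℝ) := by
  rw [← hX.valAt_stalkSpecializes _ (hX.specializes x), ← hX.valAt_stalkSpecializes _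
    (hX.specializes x), hX.valAt_smul]
  intro h
  have := hX.isUnit_stalkSpecializes hx hf
  rw [h] at this
  exact not_isUnit_zero this

lemma norm_smul (a : ℝ≥0) (v : X.skeleton) : hX.norm (hX.smul a v) = a * hX.norm v := by
  rw [norm, norm, Finset.mul_sum]
  refine Finset.sum_congr rfl fun x hx => ?_
  rw [Finset.mul_sum]
  refine Finset.sum_congr rfl fun c _ => ?_
  rw [hX.valAt_smul_of_mem a v (hX.finite.mem_toFinset.1 hx) (X.fs.ne_zero _ (X.M.rep_mem c)),
    negLog_rpow]

lemma weight_le_norm {v : X.skeleton} {x : X.X} (hx : x ∈ X.M.katoFan)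
    {α : X.M.Char x →* Multiplicative ℝ≥0} (hα : IsMaximalExtension X.M.rep α (hX.valAt v x))
    {c : X.M.Char x} (hc : c ∈ generators X x) : (α c).toAdd ≤ hX.norm v := by
  rw [hX.weight_apply hα]
  refine (Finset.single_le_sum (f := fun c => negLog (hX.valAt v x (X.M.rep c)))
    (fun _ _ => zero_le) hc).trans ?_
  exact Finset.single_le_sum
    (f := fun x => ∑ c ∈ generators X x, negLog (hX.valAt v x (X.M.rep c)))
    (fun _ _ => zero_le) (hX.finite.mem_toFinset.2 hx)

lemma eq_vertex_of_norm_eq_zero {v : X.skeleton} (hv : hX.norm v = 0) : v = hX.vertex := by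
  obtain ⟨x, hx, hv'⟩ := exists_mem_face v
  obtain ⟨α, hα⟩ := hX.mem_face_iff_exists.1 hv'
  refine hX.eq_vertex hx hα (MonoidHom.eq_of_eqOn_denseM (closure_generators x) fun c hc => ?_)
  have := hX.weight_le_norm hx hα hc
  rw [hv] at this
  exact Multiplicative.toAdd.injective (le_antisymm this zero_le)

lemma continuous_smul : Continuous fun t : ℝ≥0 × X.skeleton => hX.smul t.1 t.2 := by
  rw [hX.continuous_iff]
  intro f
  by_cases hf : f = 0
  · simp only [hf, map_zero]
    exact continuous_const
  · simp only [hX.valAt_smul _ _ hf]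
    refine continuous_iff_continuousAt.2 fun t => ?_
    have h1 : ContinuousAt (fun s : ℝ≥0 × ℝ => s.1 ^ s.2) (hX.valAt t.2 η f, (t.1 : ℝ)) :=
      NNReal.continuousAt_rpow (.inl (hX.valAt_ne_zero t.2 hX.generic_mem hf))
    exact h1.comp (f := fun t : ℝ≥0 × X.skeleton => (hX.valAt t.2 η f, (t.1 : ℝ)))
      (((hX.continuous_valAt η f).comp continuous_snd).prodMk
        (NNReal.continuous_coe.comp continuous_fst)).continuousAt

omit hX in
/-- The weights that are at most `1` on the given generators. -/
lemma isCompact_weights (x : X.X) :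
    IsCompact {α : X.M.Char x → ℝ≥0 | (α 1 = 0 ∧ ∀ c d, α (c * d) = α c + α d) ∧
      ∀ c ∈ generators X x, α c ≤ 1} := by
  -- A bound on generators bounds the weight of each element, so the weights form a closed subset of
  -- a product of compact intervals.
  have hB : ∀ c : X.M.Char x, ∃ B : ℝ≥0, ∀ α : X.M.Char x → ℝ≥0,
      (α 1 = 0 ∧ ∀ c d, α (c * d) = α c + α d) ∧ (∀ c ∈ generators X x, α c ≤ 1) → α c ≤ B := by
    intro c
    have hc : c ∈ Submonoid.closure (generators X x : Set (X.M.Char x)) := by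
      rw [closure_generators]
      trivial
    induction hc using Submonoid.closure_induction with
    | mem c hc => exact ⟨1, fun α hα => hα.2 c hc⟩
    | one => exact ⟨0, fun α hα => hα.1.1.le⟩
    | mul c d _ _ hc hd =>
      obtain ⟨B, hB⟩ := hc
      obtain ⟨B', hB'⟩ := hd
      refine ⟨B + B', fun α hα => ?_⟩
      rw [hα.1.2]
      exact add_le_add (hB α hα) (hB' α hα)
  choose B hB using hB
  refine (isCompact_univ_pi fun c => isCompact_Icc (a := 0) (b := B c)).of_isClosed_subset ?_
    fun α hα c _ => ⟨zero_le, hB c α hα⟩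
  have h1 : ∀ c, Continuous fun α : X.M.Char x → ℝ≥0 => α c := fun c => continuous_apply c
  simp only [Set.ofPred_and, Set.ofPred_forall]
  refine ((isClosed_eq (h1 _) continuous_const).inter (isClosed_iInter fun c =>
    isClosed_iInter fun d => isClosed_eq (h1 _) ((h1 _).add (h1 _)))).inter
    (isClosed_iInter fun c => isClosed_iInter fun _ => isClosed_le (h1 _) continuous_const)

/-- The norm dominates the weights of the generators, so the sphere is a closed subset of a finite
union of images of compact spaces of weights. -/
lemma isCompact_sphere : IsCompact {v | hX.norm v = 1} := by
  let K : X.X → Set X.skeleton := fun x => {v | ∃ α : X.M.Char x →* Multiplicative ℝ≥0,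
    IsMaximalExtension X.M.rep α (hX.valAt v x) ∧ ∀ c ∈ generators X x, (α c).toAdd ≤ 1}
  have hK : ∀ x ∈ X.M.katoFan, IsCompact (K x) := by
    intro x hx
    let A := {α : X.M.Char x → ℝ≥0 | (α 1 = 0 ∧ ∀ c d, α (c * d) = α c + α d) ∧
      ∀ c ∈ generators X x, α c ≤ 1}
    have : CompactSpace A := isCompact_iff_compactSpace.1 (isCompact_weights x)
    let φ : A → X.M.Char x →* Multiplicative ℝ≥0 := fun α =>
      { toFun := fun c => .ofAdd (α.1 c)
        map_one' := by rw [α.2.1.1]; rfl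
        map_mul' := fun c d => by rw [α.2.1.2, ofAdd_add] }
    choose g hg using fun α : A => hX.exists_skeleton hx (φ α)
    have hgc : Continuous g := hX.continuous_of_isMaximalExtension hx φ
      (fun c => (continuous_apply c).comp continuous_subtype_val) hg
    have : K x = Set.range g := by
      ext v
      constructor
      · rintro ⟨α, hα, hα1⟩
        refine ⟨⟨fun c => (α c).toAdd, ⟨by simp, fun c d => by simp⟩, hα1⟩, ?_⟩
        exact hX.eq_of_isMaximalExtension (hg _) hα
      · rintro ⟨α, rfl⟩
        exact ⟨φ α, hg α, α.2.2⟩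
    rw [this]
    exact isCompact_range hgc
  refine (hX.finite.isCompact_biUnion hK).of_isClosed_subset
    (isClosed_eq hX.continuous_norm continuous_const) fun v hv => ?_
  obtain ⟨x, hx, hv'⟩ := exists_mem_face v
  obtain ⟨α, hα⟩ := hX.mem_face_iff_exists.1 hv'
  exact Set.mem_iUnion₂.2 ⟨x, hx, α, hα, fun c hc => (hX.weight_le_norm hx hα hc).trans hv.le⟩

/-- The skeleton as a cone. -/
def cone : Cone X.skeleton where
  smul := hX.smul
  vertex := hX.vertex
  norm := hX.norm
  t2 := hX.t2Space
  continuous_smul := hX.continuous_smul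
  continuous_norm := hX.continuous_norm
  zero_smul v := hX.ext_generic fun f hf => by
    rw [hX.valAt_smul _ _ hf, hX.valAt_vertex hX.generic_mem hf]
    exact NNReal.rpow_zero _
  one_smul v := hX.ext_generic fun f hf => by
    rw [hX.valAt_smul _ _ hf]
    exact NNReal.rpow_one _
  mul_smul a b v := hX.ext_generic fun f hf => by
    rw [hX.valAt_smul _ _ hf, hX.valAt_smul _ _ hf, hX.valAt_smul _ _ hf, ← NNReal.rpow_mul,
      NNReal.coe_mul, mul_comm]
  norm_smul := hX.norm_smul
  eq_vertex _ := hX.eq_vertex_of_norm_eq_zero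
  isCompact := hX.isCompact_sphere

lemma scale_eq_smul (v : X.skeleton) {a : ℝ≥0} (ha : (0 : ℝ) < a) :
    (v : X.An).scale a ha = hX.smul a v := by
  have h := specializes_of_eq (hX.ker_eq v.2)
  refine An.ext_of_seminorm (x := η) h (specializes_of_eq (hX.ker_eq (hX.smul a v).2)) fun f => ?_
  rw [An.seminorm_scale v.1 a ha h]
  by_cases hf : f = 0
  · rw [hf, map_zero, map_zero, NNReal.zero_rpow ha.ne']
  · exact (hX.valAt_smul a v hf).symm

lemma isVertex_iff (v : X.skeleton) : (v : X.An).IsVertex ↔ v = hX.vertex := by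
  have hker := hX.ker_eq v.2
  constructor
  · intro h
    refine hX.ext_generic fun f hf => ?_
    rw [hX.valAt_vertex hX.generic_mem hf]
    refine h.2 _ ?_
    refine (An.residue_eq_zero_iff (X := X)).not.2 (not_not.2 ?_)
    exact (hX.isUnit_generic hf).map
      (X.X.presheaf.stalkSpecializes (hX.ker_specializes v.2 η)).hom
  · rintro rfl
    refine ⟨?_, fun f hf => ?_⟩
    · rw [isGenericPoint_def, hker]
      exact Set.eq_univ_of_forall fun x => (hX.specializes x).mem_closure
    · have hs : (hX.vertex : X.An).ker ⤳ η := hX.ker_specializes hX.vertex.2 η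
      -- The kernel equals `η` only propositionally and its residue field depends on it, so the
      -- statement is generalised before substituting.
      have key : ∀ {ξ : X.X} (hs : ξ ⤳ η) (e : ξ = η) (f : X.X.residueField ξ), f ≠ 0 →
          ∃ g : X.X.presheaf.stalk η, g ≠ 0 ∧
            X.X.residue ξ (X.X.presheaf.stalkSpecializes hs g) = f := by
        rintro ξ hs rfl f hf
        obtain ⟨g, rfl⟩ := X.X.residue_surjective ξ f
        refine ⟨g, ?_, by rw [TopCat.Presheaf.stalkSpecializes_refl]; rfl⟩
        rintro rfl
        exact hf (map_zero _)
      obtain ⟨g, hg, rfl⟩ := key hs hker f hf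
      exact hX.valAt_vertex hX.generic_mem hg

/-- The link of the skeleton is the unit sphere of a cone, in terms of any equivariant
homeomorphism of the skeleton with the cone. -/
def linkHomeomorph {S : Type*} [TopologicalSpace S] (C : Cone S) (e : X.skeleton ≃ₜ S)
    (he : ∀ a v, a ≠ 0 → e (hX.smul a v) = C.smul a (e v)) : X.Link ≃ₜ C.sphere := by
  -- On both sides the vertex is the only fixed point of multiplication by `2`, with which `e`
  -- commutes.
  have hv : ∀ v : X.skeleton, (v : X.An).IsVertex ↔ e v = C.vertex := by
    intro v
    rw [hX.isVertex_iff, ← C.smul_two_eq_iff, ← he 2 v two_ne_zero, e.injective.eq_iff]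
    exact hX.cone.smul_two_eq_iff.symm
  refine C.quotientHomeomorph X.linkSetoid (fun v => e ⟨v.1, v.2.1⟩)
    (e.continuous.comp (continuous_subtype_val.subtype_mk _))
    (fun v h => v.2.2 ((hv ⟨v.1, v.2.1⟩).2 h))
    (fun u => ⟨(e.symm u).1, (e.symm u).2, fun h => ?_⟩) ?_ ?_ ?_
  · have h1 := (hv _).1 h
    rw [e.apply_symm_apply] at h1
    have h2 : C.norm u = 1 := u.2
    rw [h1, C.norm_vertex] at h2
    exact zero_ne_one h2
  · exact (continuous_subtype_val.comp (e.symm.continuous.comp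
      continuous_subtype_val)).subtype_mk _
  · intro u
    exact e.apply_symm_apply _
  · intro v w
    constructor
    · rintro ⟨a, ha, h⟩
      have ha0 : (⟨a, ha.le⟩ : ℝ≥0) ≠ 0 := fun h0 => ha.ne' (congrArg NNReal.toReal h0)
      refine ⟨⟨a, ha.le⟩, ha0, Eq.trans (congrArg e ?_) (he _ ⟨v.1, v.2.1⟩ ha0)⟩
      refine Subtype.ext (h.trans ?_)
      exact hX.scale_eq_smul ⟨v.1, v.2.1⟩ (a := ⟨a, ha.le⟩) ha
    · rintro ⟨a, ha, h⟩
      have ha' : (0 : ℝ) < a := by positivity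
      refine ⟨a, ha', ?_⟩
      rw [hX.scale_eq_smul ⟨v.1, v.2.1⟩ ha']
      exact congrArg Subtype.val (e.injective (h.trans (he _ ⟨v.1, v.2.1⟩ ha).symm))

end IsToroidal

/-- The skeleton and the link of a product. -/
theorem IsToroidalProduct.exists_homeomorph {X Y Z : FsLogScheme k} {p : Z ⟶ X} {q : Z ⟶ Y}
    {ξ : X.X} {η : Y.X} {ζ : Z.X} (H : IsToroidalProduct p q ξ η ζ) [IsSeparated X.str]
    [IsSeparated Y.str] :
    (∃ e : Z.skeleton ≃ₜ X.skeleton × Y.skeleton, ∀ v : Z.skeleton,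
      ((e v).1 : X.An) = An.map p v ∧ ((e v).2 : Y.An) = An.map q v) ∧
    Nonempty (Z.Link ≃ₜ Join X.Link Y.Link) := by
  refine ⟨⟨H.homeomorph, fun v => ⟨rfl, rfl⟩⟩, ⟨?_⟩⟩
  have h1 := H.left.linkHomeomorph H.left.cone (.refl _) fun _ _ _ => rfl
  have h2 := H.right.linkHomeomorph H.right.cone (.refl _) fun _ _ _ => rfl
  refine (H.total.linkHomeomorph (H.left.cone.prod H.right.cone) H.homeomorph ?_).trans
    (Cone.joinHomeomorph _ _ h1 h2).symm
  intro a v ha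
  have ha' : (0 : ℝ) < a := by positivity
  refine Prod.ext (Subtype.ext ?_) (Subtype.ext ?_)
  · show An.map p (H.total.smul a v).1 = (H.left.smul a (H.toProd v).1).1
    rw [← H.total.scale_eq_smul v ha', ← H.left.scale_eq_smul _ ha', An.map_scale]
    rfl
  · show An.map q (H.total.smul a v).1 = (H.right.smul a (H.toProd v).2).1
    rw [← H.total.scale_eq_smul v ha', ← H.right.scale_eq_smul _ ha', An.map_scale]
    rfl

end FsLogScheme

end LogSkeleton

end

theorem mainTheorem10 {k : Type u} [Field k] (X Y Z : LogSkeleton.FsLogScheme k) (p : Z ⟶ X) (q : Z ⟶ Y)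
    (hX : X.IsLogRegularPair) (hY : Y.IsLogRegularPair) (hZ : LogSkeleton.FsLogScheme.IsProduct p q)
    (hXs : X.HasGeometricallyIrreducibleStrata) (hYs : Y.HasGeometricallyIrreducibleStrata)
    (hk : PerfectField k ∨ Z.IsLogRegular) :
    (∃ e : Z.skeleton ≃ₜ X.skeleton × Y.skeleton, ∀ v : Z.skeleton,
      ((e v).1 : X.An) = LogSkeleton.FsLogScheme.An.map p v ∧ ((e v).2 : Y.An) = LogSkeleton.FsLogScheme.An.map q v) ∧
    Nonempty (Z.Link ≃ₜ LogSkeleton.Join X.Link Y.Link) := by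
  have := hX.variety.separated
  have := hY.variety.separated
  obtain ⟨ξ, η, ζ, H⟩ := LogSkeleton.FsLogScheme.isToroidalProduct hX hY hZ hXs hk
  exact H.exists_homeomorph
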